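/- Let $G$ be a finite $2$-group. Write $\mathrm{Z}(G)$ for its center, $\gamma(G)$ for its commutator subgroup, $\Phi(G)$ for its Frattini subgroup and $\mathrm{Soc}(G)$ for its socle, i.e. the subgroup generated by the central elements of prime order. Assume that \[ |G : \gamma(G)\mathrm{Z}(G)| = 4 \quad\text{and}\quad |\mathrm{Soc}(G)\cap\Phi(G)| = 2 . \] Then the modular isomorphism problem has a positive solution for $G$: for every field $F$ of characteristic $2$ and every finite $2$-group $H$, if the group algebras $FG$ and $FH$ are isomorphic as $F$-algebras, then $G \cong H$. -/

import Mathlib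

/-- The socle of a finite `p`-group: the subgroup generated by the central elements of
prime order. -/
def groupSocle (G : Type*) [Group G] : Subgroup G :=
  Subgroup.closure {g : G | g ∈ Subgroup.center G ∧ (orderOf g).Prime}

/-! Write Z for the center of G, Ω for its elements with square one, and G² for the subgroup
generated by squares, which contains the commutator subgroup and lies in the Frattini subgroup.
Structure. Induction through G/Z shows that an index of four forces G/Z to have a cyclic subgroup of
index two (`exists_index_zpowers_sup_center_eq_two`). Hence there are a and b such that ⟨a⟩Z has
index two and b inverts a modulo Z. The socle condition gives Z ∩ G² at most one involution, so Z ∩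
G² is cyclic. After adjusting a and b one gets Z = E × ⟨z⟩ with E elementary abelian, bab⁻¹a = z^s
and b² = z^t. Here (s, t) is (0,0), (0,1) or (1,0), the last only if the order q of c = aba⁻¹b⁻¹ is
divisible by four (`exists_normalForm`). The numbers s, t, q, |z|, |E| determine the multiplication
table, hence the group (`NormalForm.nonempty_mulEquiv`). Invariants. Three indices come from
dimensions of ideals of FG that are defined without reference to G, because each is the kernel of FG
→ F[G/N] for a suitable N. The orders of Z and Ω come from the center of FG and its position
relative to the span of additive commutators. Both rest on one fact: in characteristic two a class
function on a 2-group has the same sum as its restriction to Z (`sum_eq_sum_center`). These data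
show that the other group satisfies the same hypotheses, and they give q, |z| and |E|. The pair (s,
t) needs a finer invariant. The derivations of FG modulo the inner ones are the product, over
conjugacy classes, of the additive characters Hom(C(x), F) of centralizers
(`finrank_leibnizSubspace`). The dimension of this product is computable from the normal form, and
its only term not yet known counts the elements outside ⟨a⟩Z whose square is the square of a central
element (`NormalForm.card_mul_finrank_characters`). As (ba^i u)² = z^(si+t)u², the count covers all
such elements for (0,0), none for (0,1), and some but not all for (1,0). So it determines (s, t). -/

/-- The subgroup generated by the squares. -/
def squareSubgroup (G : Type*) [Group G] : Subgroup G :=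
  Subgroup.closure (Set.range fun g : G => g ^ 2)

/-! ### Squares, commutators and the Frattini argument in 2-groups -/

section TwoGroups

variable {G : Type*} [Group G]

theorem sq_mem_squareSubgroup (g : G) : g ^ 2 ∈ squareSubgroup G :=
  Subgroup.subset_closure ⟨g, rfl⟩

theorem commutator_mem_squareSubgroup (x y : G) : x * y * x⁻¹ * y⁻¹ ∈ squareSubgroup G := by
  have h : x * y * x⁻¹ * y⁻¹ = (x * y) ^ 2 * (y⁻¹ * x⁻¹ * y) ^ 2 * (y⁻¹) ^ 2 := by
    simp only [pow_two]; group
  rw [h]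
  exact mul_mem (mul_mem (sq_mem_squareSubgroup _) (sq_mem_squareSubgroup _))
    (sq_mem_squareSubgroup _)

theorem commutator_le_squareSubgroup : commutator G ≤ squareSubgroup G := by
  rw [commutator_def, Subgroup.commutator_le]
  intro x _ y _
  exact commutator_mem_squareSubgroup x y

instance squareSubgroup_normal : (squareSubgroup G).Normal := by
  refine ⟨fun n hn g => ?_⟩
  have h : g * n * g⁻¹ = (g * n * g⁻¹ * n⁻¹) * n := by group
  rw [h]
  exact mul_mem (commutator_mem_squareSubgroup g n) hn

theorem IsCoatom.index_eq_two [Finite G] (hG : IsPGroup 2 G) {M : Subgroup G}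
    (hM : IsCoatom M) : M.index = 2 := by
  obtain ⟨n, hn⟩ := IsPGroup.iff_card.mp hG
  obtain ⟨m, hm⟩ := IsPGroup.iff_card.mp (hG.to_subgroup M)
  have hdvd : (2 : ℕ) ^ (m + 1) ∣ Nat.card G := by
    have h1 : Nat.card M ∣ Nat.card G := Subgroup.card_subgroup_dvd_card M
    rw [hn, hm] at h1
    rw [hn]
    refine pow_dvd_pow 2 ?_
    rcases Nat.lt_or_ge m n with h | h
    · exact h
    · exfalso
      have h2 : m ≤ n := (Nat.pow_dvd_pow_iff_le_right (by norm_num)).1 h1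
      apply hM.1
      apply Subgroup.eq_top_of_card_eq
      rw [hm, hn, le_antisymm h2 h]
  obtain ⟨K, hK, hMK⟩ := Sylow.exists_subgroup_card_pow_succ hdvd hm
  have hlt : M < K := by
    refine lt_of_le_of_ne hMK ?_
    rintro rfl
    rw [hm] at hK
    exact absurd hK (by simp [pow_succ])
  have hKtop := hM.2 K hlt
  have hc := M.card_mul_index
  have hGK : Nat.card G = 2 ^ (m + 1) := by
    rw [← hK, hKtop, Subgroup.card_top]
  rw [hGK, hm, pow_succ] at hc
  exact Nat.eq_of_mul_eq_mul_left (by positivity) hc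

theorem squareSubgroup_le_of_isCoatom [Finite G] (hG : IsPGroup 2 G) {M : Subgroup G}
    (hM : IsCoatom M) : squareSubgroup G ≤ M := by
  rw [squareSubgroup, Subgroup.closure_le]
  rintro _ ⟨g, rfl⟩
  exact Subgroup.sq_mem_of_index_two (hM.index_eq_two hG) g

theorem squareSubgroup_le_frattini [Finite G] (hG : IsPGroup 2 G) :
    squareSubgroup G ≤ frattini G := by
  simp only [frattini, Order.radical, le_iInf_iff]
  intro M hM
  exact squareSubgroup_le_of_isCoatom hG hM

/-- Squares are non-generators: a maximal subgroup over K would contain them too. -/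
theorem eq_top_of_sup_squareSubgroup_eq_top [Finite G] (hG : IsPGroup 2 G) {K : Subgroup G}
    (hK : K ⊔ squareSubgroup G = ⊤) : K = ⊤ := by
  by_contra hne
  obtain ⟨M, hM, hKM⟩ := (eq_top_or_exists_le_coatom K).resolve_left hne
  have h := sup_le hKM (squareSubgroup_le_of_isCoatom hG hM)
  rw [hK, top_le_iff] at h
  exact hM.1 h

theorem mem_zpowers_sup_center {a g : G} :
    g ∈ Subgroup.zpowers a ⊔ Subgroup.center G ↔
      ∃ i : ℤ, ∃ u ∈ Subgroup.center G, g = a ^ i * u := by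
  rw [Subgroup.mem_sup_of_normal_right]
  constructor
  · rintro ⟨_, ⟨i, rfl⟩, u, hu, rfl⟩
    exact ⟨i, u, hu, rfl⟩
  · rintro ⟨i, u, hu, rfl⟩
    exact ⟨_, ⟨i, rfl⟩, u, hu, rfl⟩

theorem central_comm {u : G} (hu : u ∈ Subgroup.center G) (g : G) : g * u = u * g :=
  Subgroup.mem_center_iff.1 hu g

/-- A single element a generates G together with commutators and the center. Commutators are
non-generators, so G = ⟨a⟩Z is abelian. In the induction below this separates index four from the
degenerate case. -/
theorem commute_of_index_commutator_sup_center_le [Finite G] (hG : IsPGroup 2 G)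
    (h : (commutator G ⊔ Subgroup.center G).index ≤ 2) (x y : G) : x * y = y * x := by
  set M := commutator G ⊔ Subgroup.center G with hM
  have hex : ∃ a : G, Subgroup.zpowers a ⊔ M = ⊤ := by
    by_cases htop : M = ⊤
    · exact ⟨1, by rw [htop]; simp⟩
    · obtain ⟨a, ha⟩ : ∃ a, a ∉ M := by
        by_contra hcon
        push Not at hcon
        exact htop (by ext; simp [hcon])
      refine ⟨a, ?_⟩
      have hlt : M < Subgroup.zpowers a ⊔ M := by
        refine lt_of_le_of_ne le_sup_right ?_
        intro heq
        exact ha (heq ▸ Subgroup.mem_sup_left (Subgroup.mem_zpowers a))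
      have h1 := Subgroup.relIndex_mul_index hlt.le
      have h2 : M.relIndex (Subgroup.zpowers a ⊔ M) ≠ 1 := by
        rw [Ne, Subgroup.relIndex_eq_one]
        exact fun h3 => absurd hlt (not_lt_of_ge h3)
      have h3 : M.relIndex (Subgroup.zpowers a ⊔ M) ≠ 0 := Subgroup.FiniteIndex.index_ne_zero
      have h4 : (Subgroup.zpowers a ⊔ M).index ≠ 0 := Subgroup.FiniteIndex.index_ne_zero
      rw [← Subgroup.index_eq_one]
      -- The two indices multiply to at most two and the first is at least two, so the second is
      -- one.
      nlinarith [Nat.two_le_iff _ |>.2 ⟨h3, h2⟩, Nat.one_le_iff_ne_zero.2 h4]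
  obtain ⟨a, ha⟩ := hex
  have htop : Subgroup.zpowers a ⊔ Subgroup.center G = ⊤ := by
    apply eq_top_of_sup_squareSubgroup_eq_top hG
    rw [eq_top_iff, ← ha, hM]
    refine sup_le (le_sup_left.trans le_sup_left) (sup_le ?_ (le_sup_right.trans le_sup_left))
    exact commutator_le_squareSubgroup.trans le_sup_right
  obtain ⟨i, u, hu, rfl⟩ := mem_zpowers_sup_center.1 (htop ▸ Subgroup.mem_top x)
  obtain ⟨j, v, hv, rfl⟩ := mem_zpowers_sup_center.1 (htop ▸ Subgroup.mem_top y)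
  have e1 : Commute (a ^ i) (a ^ j) := (Commute.refl a).zpow_zpow i j
  have e2 : ∀ g, Commute g u := central_comm hu
  have e3 : ∀ g, Commute g v := central_comm hv
  exact ((e1.mul_right (e3 _)).mul_left ((e2 _).symm))

end TwoGroups

/-! ### Dihedral pairs and their commutators -/

/-- `G` is generated by `a`, `b` and its center, noncommuting, and `b` acts as a reflection on `a`
modulo the center, so that `G` modulo its center is dihedral. -/
structure DihedralPair {G : Type*} [Group G] (a b : G) : Prop where
  cover : ∀ g, ∃ i : ℤ, ∃ u ∈ Subgroup.center G, g = a ^ i * u ∨ g = b * a ^ i * u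
  sq_mem : b ^ 2 ∈ Subgroup.center G
  reflect_mem : b * a * b⁻¹ * a ∈ Subgroup.center G
  not_commute : ¬ Commute a b

namespace DihedralPair

variable {G : Type*} [Group G] {a b : G}

theorem mem_center_of_commute (h : DihedralPair a b) {x : G} (ha : Commute a x)
    (hb : Commute b x) : x ∈ Subgroup.center G := by
  rw [Subgroup.mem_center_iff]
  intro g
  obtain ⟨i, u, hu, rfl | rfl⟩ := h.cover g
  · exact (ha.zpow_left i).mul_left (central_comm hu x).symm
  · exact (hb.mul_left (ha.zpow_left i)).mul_left (central_comm hu x).symm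

/-- This expresses c through a² and the central element ζ = bab⁻¹a, so computations with c reduce to
powers of a and ζ. -/
theorem commutator_eq (a b : G) :
    a * b * a⁻¹ * b⁻¹ = a ^ 2 * (b * a * b⁻¹ * a)⁻¹ := by
  rw [pow_two]; group

theorem conj_zpow_eq (h : DihedralPair a b) (i : ℤ) :
    b * a ^ i * b⁻¹ = a ^ (-i) * (b * a * b⁻¹ * a) ^ i := by
  have h1 : Commute a⁻¹ (b * a * b⁻¹ * a) := central_comm h.reflect_mem _
  have h2 : b * a * b⁻¹ = a⁻¹ * (b * a * b⁻¹ * a) := by rw [h1.eq]; group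
  rw [← conj_zpow, zpow_neg, ← inv_zpow, ← h1.mul_zpow, ← h2]

theorem commutator_zpow (h : DihedralPair a b) (i : ℤ) :
    a ^ i * b * (a ^ i)⁻¹ * b⁻¹ = (a * b * a⁻¹ * b⁻¹) ^ i := by
  have h1 : Commute (a ^ 2) (b * a * b⁻¹ * a)⁻¹ := central_comm (inv_mem h.reflect_mem) _
  have h2 := h.conj_zpow_eq (-i)
  rw [commutator_eq a b, h1.mul_zpow]
  calc a ^ i * b * (a ^ i)⁻¹ * b⁻¹ = a ^ i * (b * a ^ (-i) * b⁻¹) := by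
        rw [zpow_neg]; group
    _ = _ := by
        rw [h2, ← mul_assoc, ← zpow_add, inv_zpow', ← zpow_natCast a 2, ← zpow_mul]
        congr 2
        push_cast
        ring

/-- Only commutation with b is at stake, and [a^i, b] = c^i. Consequently a has the same order
modulo the center as c has in G. -/
theorem zpow_mem_center_iff (h : DihedralPair a b) (i : ℤ) :
    a ^ i ∈ Subgroup.center G ↔ (a * b * a⁻¹ * b⁻¹) ^ i = 1 := by
  rw [← h.commutator_zpow]
  constructor
  · intro hi
    rw [← central_comm hi b]
    group
  · intro hi
    refine h.mem_center_of_commute ((Commute.refl a).zpow_right i) ?_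
    have := mul_inv_eq_one.1 hi
    exact (mul_inv_eq_iff_eq_mul.1 this).symm

theorem zpow_mem_center_iff_dvd (h : DihedralPair a b) (i : ℤ) :
    a ^ i ∈ Subgroup.center G ↔ (orderOf (a * b * a⁻¹ * b⁻¹) : ℤ) ∣ i := by
  rw [h.zpow_mem_center_iff, orderOf_dvd_iff_zpow_eq_one]

theorem mul_zpow_notMem_center (h : DihedralPair a b) (i : ℤ) :
    b * a ^ i ∉ Subgroup.center G := by
  intro hi
  apply h.not_commute
  have h1 : Commute a (b * a ^ i) := central_comm hi a
  have h2 : Commute a (a ^ (-i)) := (Commute.refl a).zpow_right _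
  have := h1.mul_right h2
  rwa [mul_assoc, ← zpow_add, add_neg_cancel, zpow_zero, mul_one] at this

theorem commute_commutator (h : DihedralPair a b) : Commute a (a * b * a⁻¹ * b⁻¹) := by
  rw [commutator_eq]
  exact ((Commute.refl a).pow_right 2).mul_right (central_comm (inv_mem h.reflect_mem) _)

theorem conj_commutator (h : DihedralPair a b) :
    b * (a * b * a⁻¹ * b⁻¹) * b⁻¹ = (a * b * a⁻¹ * b⁻¹)⁻¹ := by
  have h1 := h.conj_zpow_eq 2
  have h2 : Commute (a ^ (-2 : ℤ)) ((b * a * b⁻¹ * a)) := central_comm h.reflect_mem _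
  have h3 : Commute b ((b * a * b⁻¹ * a)⁻¹) := central_comm (inv_mem h.reflect_mem) _
  rw [commutator_eq]
  generalize hz : b * a * b⁻¹ * a = ζ at *
  calc b * (a ^ 2 * ζ⁻¹) * b⁻¹ = b * a ^ 2 * (b⁻¹ * ζ⁻¹) := by
        rw [(h3.inv_left).eq]; group
    _ = a ^ (-2 : ℤ) * ζ ^ 2 * ζ⁻¹ := by
        rw [← mul_assoc]; congr 1; exact_mod_cast h1
    _ = (a ^ 2 * ζ⁻¹)⁻¹ := by
        rw [mul_inv_rev, inv_inv, pow_two, mul_assoc, mul_assoc, mul_inv_cancel, mul_one, h2.eq, zpow_neg]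
        norm_cast

theorem index_eq_two (h : DihedralPair a b) :
    (Subgroup.zpowers a ⊔ Subgroup.center G).index = 2 := by
  rw [Subgroup.index_eq_two_iff_exists_notMem_and]
  have hb : ∀ i : ℤ, ∀ u ∈ Subgroup.center G,
      b * a ^ i * u ∉ Subgroup.zpowers a ⊔ Subgroup.center G := by
    intro i u hu hmem
    obtain ⟨j, v, hv, hj⟩ := mem_zpowers_sup_center.1 hmem
    apply h.mul_zpow_notMem_center (i - j)
    have : b * a ^ (i - j) = v * u⁻¹ := by
      rw [sub_eq_add_neg, zpow_add, ← mul_assoc, zpow_neg, mul_inv_eq_iff_eq_mul,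
        mul_assoc, ← central_comm (inv_mem hu), ← mul_assoc, ← central_comm hv, ← hj]
      group
    rw [this]
    exact mul_mem hv (inv_mem hu)
  refine ⟨b⁻¹, ?_, ?_⟩
  · intro hmem
    have := hb 0 1 (one_mem _)
    simp only [zpow_zero, mul_one] at this
    exact this (by simpa using inv_mem hmem)
  · intro g
    obtain ⟨i, u, hu, rfl | rfl⟩ := h.cover g
    · exact Or.inr (mem_zpowers_sup_center.2 ⟨i, u, hu, rfl⟩)
    · left
      have h1 := h.conj_zpow_eq i
      refine mem_zpowers_sup_center.2 ⟨-i, (b * a * b⁻¹ * a) ^ i * u,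
        mul_mem (zpow_mem h.reflect_mem i) hu, ?_⟩
      rw [← mul_assoc, ← h1, mul_assoc, mul_assoc (b * a ^ i), central_comm hu b⁻¹]

end DihedralPair

/-- Any b outside A = ⟨a⟩Z works. Its square lies in A, say b² = a^k u with u central, and commutes
with b; so a^k commutes with both a and b and is central. The same applies to ba, and bab⁻¹a =
(ba)²b⁻². -/
theorem exists_dihedralPair_of_index_eq_two {G : Type*} [Group G] {a : G}
    (h : (Subgroup.zpowers a ⊔ Subgroup.center G).index = 2) : ∃ b, DihedralPair a b := by
  set A := Subgroup.zpowers a ⊔ Subgroup.center G with hA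
  have haA : a ∈ A := Subgroup.mem_sup_left (Subgroup.mem_zpowers a)
  have hcover : ∀ b, b ∉ A → ∀ g, ∃ i : ℤ, ∃ u ∈ Subgroup.center G,
      g = a ^ i * u ∨ g = b * a ^ i * u := by
    intro b hb g
    by_cases hg : g ∈ A
    · obtain ⟨i, u, hu, rfl⟩ := mem_zpowers_sup_center.1 hg
      exact ⟨i, u, hu, Or.inl rfl⟩
    · have : b⁻¹ * g ∈ A := by
        rw [Subgroup.mul_mem_iff_of_index_two h]
        simp [hb, hg]
      obtain ⟨i, u, hu, hi⟩ := mem_zpowers_sup_center.1 this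
      exact ⟨i, u, hu, Or.inr (by rw [mul_assoc, ← hi]; group)⟩
  have hsq : ∀ b, b ∉ A → b ^ 2 ∈ Subgroup.center G := by
    intro b hb
    obtain ⟨k, u, hu, hk⟩ := mem_zpowers_sup_center.1 (Subgroup.sq_mem_of_index_two h b)
    have h1 : Commute b (a ^ k) := by
      have : a ^ k = b ^ 2 * u⁻¹ := by rw [hk]; group
      rw [this]
      exact ((Commute.refl b).pow_right 2).mul_right (central_comm (inv_mem hu) b)
    have h2 : a ^ k ∈ Subgroup.center G := by
      rw [Subgroup.mem_center_iff]
      intro g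
      obtain ⟨i, v, hv, rfl | rfl⟩ := hcover b hb g
      · exact ((Commute.refl a).zpow_zpow i k).mul_left (central_comm hv _).symm
      · exact (h1.mul_left ((Commute.refl a).zpow_zpow i k)).mul_left (central_comm hv _).symm
    rw [hk]
    exact mul_mem h2 hu
  obtain ⟨b, hb⟩ : ∃ b, b ∉ A := by
    by_contra hcon
    push Not at hcon
    have : A = ⊤ := by ext; simp [hcon]
    rw [this, Subgroup.index_top] at h
    omega
  refine ⟨b, hcover b hb, hsq b hb, ?_, ?_⟩
  · have hba : b * a ∉ A := by
      rw [Subgroup.mul_mem_iff_of_index_two h]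
      simp [hb, haA]
    have h1 : b * a * b⁻¹ * a = (b * a) ^ 2 * (b ^ 2)⁻¹ := by
      have h2 := central_comm (inv_mem (hsq b hb)) ((b * a) ^ 2)
      have h3 := central_comm (inv_mem (hsq b hb)) (b * a * b)
      calc b * a * b⁻¹ * a = (b * a * b) * (b ^ 2)⁻¹ * a := by rw [pow_two]; group
        _ = (b ^ 2)⁻¹ * ((b * a) ^ 2) := by rw [h3, pow_two (b * a)]; simp only [mul_assoc]
        _ = _ := h2.symm
    rw [h1]
    exact mul_mem (hsq _ hba) (inv_mem (hsq b hb))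
  · intro hcomm
    apply hb
    apply Subgroup.mem_sup_right
    rw [Subgroup.mem_center_iff]
    intro g
    obtain ⟨i, v, hv, rfl | rfl⟩ := hcover b hb g
    · exact (hcomm.zpow_left i).mul_left (central_comm hv _).symm
    · exact ((Commute.refl b).mul_left (hcomm.zpow_left i)).mul_left (central_comm hv _).symm

namespace DihedralPair

variable {G : Type*} [Group G] {a b : G}

theorem zpowers_commutator_normal (h : DihedralPair a b) :
    (Subgroup.zpowers (a * b * a⁻¹ * b⁻¹)).Normal := by
  have hc := h.conj_commutator
  have hac := h.commute_commutator
  generalize a * b * a⁻¹ * b⁻¹ = c at *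
  have key : ∀ g : G, g * c * g⁻¹ = c ∨ g * c * g⁻¹ = c⁻¹ := by
    intro g
    obtain ⟨i, u, hu, rfl | rfl⟩ := h.cover g
    · left
      have h1 : Commute (a ^ i * u) c := (hac.zpow_left i).mul_left (central_comm hu c).symm
      rw [h1.eq]; group
    · right
      have h1 : Commute (a ^ i * u) c := (hac.zpow_left i).mul_left (central_comm hu c).symm
      rw [mul_assoc b, mul_assoc b, h1.eq, ← hc]; group
  refine ⟨?_⟩
  rintro _ ⟨k, rfl⟩ g
  change g * c ^ k * g⁻¹ ∈ _
  rw [← conj_zpow]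
  refine zpow_mem ?_ k
  rcases key g with h1 | h1 <;> rw [h1]
  · exact Subgroup.mem_zpowers c
  · exact inv_mem (Subgroup.mem_zpowers c)

/-- Modulo the normal subgroup ⟨c⟩ the images of a, b and the center commute pairwise, so the
quotient is abelian. -/
theorem commutator_eq_zpowers (h : DihedralPair a b) :
    commutator G = Subgroup.zpowers (a * b * a⁻¹ * b⁻¹) := by
  apply le_antisymm
  · have hn := h.zpowers_commutator_normal
    rw [commutator_def, Subgroup.commutator_le]
    intro x _ y _
    set N := Subgroup.zpowers (a * b * a⁻¹ * b⁻¹) with hN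
    have hab : Commute (a : G ⧸ N) (b : G ⧸ N) := by
      have h1 : ((a * b * a⁻¹ * b⁻¹ : G) : G ⧸ N) = 1 :=
        (QuotientGroup.eq_one_iff _).2 (Subgroup.mem_zpowers _)
      simp only [QuotientGroup.mk_mul, QuotientGroup.mk_inv] at h1
      exact mul_inv_eq_iff_eq_mul.1 (mul_inv_eq_one.1 h1)
    have hcen : ∀ u ∈ Subgroup.center G, ∀ g : G ⧸ N, Commute g (u : G ⧸ N) := by
      intro u hu g
      induction g using QuotientGroup.induction_on with
      | H g => exact congrArg (QuotientGroup.mk' N) (central_comm hu g)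
    have hall : ∀ z : G ⧸ N, Commute z (a : G ⧸ N) → Commute z (b : G ⧸ N) →
        ∀ g : G, Commute z (g : G ⧸ N) := by
      intro z hza hzb g
      obtain ⟨i, u, hu, rfl | rfl⟩ := h.cover g
      · simpa using (hza.zpow_right i).mul_right (hcen u hu z)
      · simpa using (hzb.mul_right (hza.zpow_right i)).mul_right (hcen u hu z)
    have h2 : Commute (x : G ⧸ N) (y : G ⧸ N) := by
      apply hall
      · exact (hall _ (Commute.refl _) hab x).symm
      · exact (hall _ hab.symm (Commute.refl _) x).symm
    have h3 : ((x * y * x⁻¹ * y⁻¹ : G) : G ⧸ N) = 1 := by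
      simp only [QuotientGroup.mk_mul, QuotientGroup.mk_inv]
      rw [h2.eq]; group
    exact (QuotientGroup.eq_one_iff _).1 h3
  · rw [Subgroup.zpowers_le]
    exact Subgroup.commutator_mem_commutator (Subgroup.mem_top a) (Subgroup.mem_top b)

theorem orderOf_commutator_ne_one (h : DihedralPair a b) : orderOf (a * b * a⁻¹ * b⁻¹) ≠ 1 := by
  rw [Ne, orderOf_eq_one_iff]
  intro h1
  exact h.not_commute (mul_inv_eq_iff_eq_mul.1 (mul_inv_eq_one.1 h1))

theorem orderOf_commutator [Finite G] (hG : IsPGroup 2 G) (h : DihedralPair a b) :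
    ∃ k, orderOf (a * b * a⁻¹ * b⁻¹) = 2 ^ (k + 1) := by
  obtain ⟨k, hk⟩ := (IsPGroup.iff_orderOf.1 hG) (a * b * a⁻¹ * b⁻¹)
  cases k with
  | zero => exact absurd hk h.orderOf_commutator_ne_one
  | succ k => exact ⟨k, hk⟩

end DihedralPair

/-! ### Cyclic subgroups of index two in the central quotient -/

/-- A nonabelian `2`-group whose elements do not all square to the identity and of order eight has
a cyclic subgroup of index two; here it is used for the small case of the induction below. -/
theorem exists_zpowers_index_eq_two_of_card_eq_eight {G : Type*} [Group G] [Finite G]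
    (hG : IsPGroup 2 G) (hcard : Nat.card G = 8) {a b : G} (hab : ¬ Commute a b) :
    ∃ x : G, (Subgroup.zpowers x).index = 2 := by
  by_cases h2 : ∀ x : G, x ^ 2 = 1
  · exfalso
    apply hab
    have hinv : ∀ x : G, x⁻¹ = x := fun x => by
      rw [inv_eq_iff_mul_eq_one, ← pow_two, h2]
    change a * b = b * a
    rw [← hinv (a * b), mul_inv_rev, hinv, hinv]
  · push Not at h2
    obtain ⟨x, hx⟩ := h2
    refine ⟨x, ?_⟩
    have h1 := (Subgroup.zpowers x).card_mul_index
    obtain ⟨k, hk⟩ := (IsPGroup.iff_orderOf.1 hG) x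
    rw [Nat.card_zpowers, hk, hcard] at h1
    have hk1 : ¬ k ≤ 1 := by
      intro hle
      apply hx
      apply orderOf_dvd_iff_pow_eq_one.1
      rw [hk]
      exact pow_dvd_pow 2 hle
    have hk3 : k ≤ 3 := by
      have : (2 : ℕ) ^ k ∣ 2 ^ 3 := ⟨_, by rw [h1]; norm_num⟩
      exact (Nat.pow_dvd_pow_iff_le_right (by norm_num)).1 this
    have hk4 : k = 2 ∨ k = 3 := by omega
    rcases hk4 with rfl | rfl
    · omega
    · exfalso
      have h3 : (Subgroup.zpowers x).index = 1 := by omega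
      rw [Subgroup.index_eq_one] at h3
      apply hab
      obtain ⟨i, rfl⟩ := Subgroup.mem_zpowers_iff.1 (h3 ▸ Subgroup.mem_top a)
      obtain ⟨j, rfl⟩ := Subgroup.mem_zpowers_iff.1 (h3 ▸ Subgroup.mem_top b)
      exact (Commute.refl x).zpow_zpow i j

/-- If c has order two, then |G| = 8. Otherwise ζ = c^m is central and inverted by b, which forces m
to be even. Then a² = cζ is an odd power of c, so ⟨a⟩ contains ⟨c⟩, hence the center, and ⟨a⟩ itself
has index two. -/
theorem DihedralPair.exists_zpowers_index_eq_two {G : Type*} [Group G] [Finite G]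
    (hG : IsPGroup 2 G) {a b : G} (h : DihedralPair a b) (hindex : (commutator G).index = 4)
    (hcenter : Subgroup.center G ≤ commutator G) :
    ∃ x : G, (Subgroup.zpowers x).index = 2 := by
  have hcomm := h.commutator_eq_zpowers
  obtain ⟨k, hk⟩ := h.orderOf_commutator hG
  have hconj := h.conj_commutator
  have hceq := DihedralPair.commutator_eq a b
  have hcard := (commutator G).card_mul_index
  rw [hindex, hcomm, Nat.card_zpowers] at hcard
  have hζ := h.reflect_mem
  have hidx := h.index_eq_two
  rw [hcomm] at hcenter
  generalize b * a * b⁻¹ * a = ζ at *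
  generalize a * b * a⁻¹ * b⁻¹ = c at *
  cases k with
  | zero =>
    refine exists_zpowers_index_eq_two_of_card_eq_eight hG ?_ h.not_commute
    rw [← hcard, hk]; norm_num
  | succ k =>
    refine ⟨a, ?_⟩
    obtain ⟨m, hm⟩ := Subgroup.mem_zpowers_iff.1 (hcenter hζ)
    have h1 : c ^ m = (c ^ m)⁻¹ := by
      calc c ^ m = b * c ^ m * b⁻¹ := by
            rw [hm, central_comm hζ b]; group
        _ = (c ^ m)⁻¹ := by rw [← conj_zpow, hconj, inv_zpow]
    have h2 : c ^ (2 * m) = 1 := by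
      rw [two_mul, zpow_add]
      nth_rewrite 1 [h1]
      group
    rw [← orderOf_dvd_iff_zpow_eq_one, hk] at h2
    -- Here the order of c is divisible by four and divides 2m.
    have h3 : (2 : ℤ) ∣ m := by
      have h4 : (2 * 2 : ℤ) ∣ 2 * m := by
        refine dvd_trans ?_ h2
        push_cast
        exact ⟨2 ^ k, by ring⟩
      exact (mul_dvd_mul_iff_left two_ne_zero).1 h4
    have h5 : IsCoprime (1 + m) (orderOf c : ℤ) := by
      rw [hk]
      push_cast
      apply IsCoprime.pow_right
      obtain ⟨l, rfl⟩ := h3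
      exact ⟨1, -l, by ring⟩
    have h6 : a ^ 2 = c ^ (1 + m) := by
      rw [zpow_add, hm, zpow_one, hceq, inv_mul_cancel_right]
    have hca : c ∈ Subgroup.zpowers a := by
      obtain ⟨x, y, hxy⟩ := h5
      have : c = (a ^ 2) ^ x := by
        rw [h6, ← zpow_mul]
        have h7 : (1 + m) * x = 1 - y * orderOf c := by linarith
        rw [h7, zpow_sub, zpow_one, mul_comm y, zpow_mul, zpow_natCast, pow_orderOf_eq_one,
          one_zpow]
        simp
      rw [this]
      exact zpow_mem (pow_mem (Subgroup.mem_zpowers a) 2) x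
    have hle : Subgroup.center G ≤ Subgroup.zpowers a :=
      hcenter.trans ((Subgroup.zpowers_le).2 hca)
    rwa [sup_eq_left.2 hle] at hidx

theorem index_zpowers_mk_center {G : Type*} [Group G] (a : G) :
    (Subgroup.zpowers (QuotientGroup.mk a : G ⧸ Subgroup.center G)).index =
      (Subgroup.zpowers a ⊔ Subgroup.center G).index := by
  have h := Subgroup.index_map (Subgroup.zpowers a) (QuotientGroup.mk' (Subgroup.center G))
  rw [MonoidHom.map_zpowers, QuotientGroup.ker_mk', MonoidHom.range_eq_top.2
    (QuotientGroup.mk'_surjective _), Subgroup.index_top, mul_one] at h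
  exact h

theorem index_commutator_quotient_center (G : Type*) [Group G] :
    (commutator (G ⧸ Subgroup.center G)).index = (commutator G ⊔ Subgroup.center G).index := by
  have h := Subgroup.index_map (commutator G) (QuotientGroup.mk' (Subgroup.center G))
  rw [commutator_def, Subgroup.map_commutator, Subgroup.map_top_of_surjective _
    (QuotientGroup.mk'_surjective _), QuotientGroup.ker_mk', MonoidHom.range_eq_top.2
    (QuotientGroup.mk'_surjective _), Subgroup.index_top, mul_one] at h
  exact h

/-- Let Q = G/Z, whose abelianization has order four. If Q'Z(Q) has index at most two in Q, then Q
is abelian of order four. Otherwise Z(Q) ≤ Q', and induction gives Q a dihedral pair, hence a cyclic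
subgroup of index two, whose generator is lifted to G. -/
theorem exists_index_zpowers_sup_center_eq_two (n : ℕ) : ∀ {G : Type*} [Group G] [Finite G],
    Nat.card G ≤ n → IsPGroup 2 G → (commutator G ⊔ Subgroup.center G).index = 4 →
    ∃ a : G, (Subgroup.zpowers a ⊔ Subgroup.center G).index = 2 := by
  induction n with
  | zero => intro G _ _ h; exact absurd h (by simpa using Nat.card_pos.ne')
  | succ n ih =>
    intro G _ _ hcard hG hindex
    have hQ2 : IsPGroup 2 (G ⧸ Subgroup.center G) := hG.to_quotient _
    have hQidx := index_commutator_quotient_center G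
    rw [hindex] at hQidx
    suffices hx : ∃ x : G ⧸ Subgroup.center G, (Subgroup.zpowers x).index = 2 by
      obtain ⟨x, hx⟩ := hx
      induction x using QuotientGroup.induction_on with
      | H a => exact ⟨a, by rw [← index_zpowers_mk_center, hx]⟩
    have hnt : Nontrivial G := by
      by_contra hcon
      rw [not_nontrivial_iff_subsingleton] at hcon
      have : (commutator G ⊔ Subgroup.center G) = ⊤ := Subsingleton.elim _ _
      rw [this, Subgroup.index_top] at hindex
      omega
    have hlt : Nat.card (G ⧸ Subgroup.center G) ≤ n := by
      have h1 := (Subgroup.center G).card_mul_index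
      have h2 : 1 < Nat.card (Subgroup.center G) := by
        have := hG.center_nontrivial
        exact Finite.one_lt_card
      have h3 : 0 < (Subgroup.center G).index := Nat.pos_of_ne_zero
        Subgroup.FiniteIndex.index_ne_zero
      change (Subgroup.center G).index ≤ n
      nlinarith
    have hdvd : (commutator (G ⧸ Subgroup.center G) ⊔
        Subgroup.center (G ⧸ Subgroup.center G)).index ∣ 4 := by
      rw [← hQidx]
      exact Subgroup.index_dvd_of_le le_sup_left
    by_cases hle : (commutator (G ⧸ Subgroup.center G) ⊔
        Subgroup.center (G ⧸ Subgroup.center G)).index ≤ 2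
    · have hcommQ := commute_of_index_commutator_sup_center_le hQ2 hle
      have hbot : commutator (G ⧸ Subgroup.center G) = ⊥ := by
        rw [commutator_def, Subgroup.commutator_eq_bot_iff_le_centralizer]
        intro x _ y _
        exact hcommQ y x
      rw [hbot, Subgroup.index_bot] at hQidx
      have : Fact (Nat.Prime 2) := ⟨Nat.prime_two⟩
      obtain ⟨x, hx⟩ := exists_prime_orderOf_dvd_card' (G := G ⧸ Subgroup.center G) 2
        (by rw [hQidx]; norm_num)
      refine ⟨x, ?_⟩
      have h1 := (Subgroup.zpowers x).card_mul_index
      rw [Nat.card_zpowers, hx, hQidx] at h1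
      omega
    · have h4 : (commutator (G ⧸ Subgroup.center G) ⊔
          Subgroup.center (G ⧸ Subgroup.center G)).index = 4 := by
        have h5 := Nat.le_of_dvd (by norm_num) hdvd
        interval_cases (commutator (G ⧸ Subgroup.center G) ⊔
          Subgroup.center (G ⧸ Subgroup.center G)).index
        all_goals first | rfl | omega
      obtain ⟨x, hx⟩ := ih hlt hQ2 h4
      obtain ⟨y, hxy⟩ := exists_dihedralPair_of_index_eq_two hx
      refine hxy.exists_zpowers_index_eq_two hQ2 hQidx ?_
      -- Both subgroups have index four, so the center of the quotient lies in its commutator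
      -- subgroup.
      have h6 : commutator (G ⧸ Subgroup.center G) = commutator (G ⧸ Subgroup.center G) ⊔
          Subgroup.center (G ⧸ Subgroup.center G) :=
        Subgroup.eq_of_le_of_card_ge le_sup_left (by
          have h7 := (commutator (G ⧸ Subgroup.center G)).card_mul_index
          have h8 := (commutator (G ⧸ Subgroup.center G) ⊔
            Subgroup.center (G ⧸ Subgroup.center G)).card_mul_index
          rw [hQidx] at h7
          rw [h4] at h8
          omega)
      rw [h6]
      exact le_sup_right

/-! ### The cyclic part of the center -/

/-- Squaring is at most two-to-one, so by induction x^(2^k) = 1 has at most 2^k solutions; this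
bound characterizes cyclic groups. -/
theorem isCyclic_of_involution_unique {P : Type*} [CommGroup P] [Finite P] (hP : IsPGroup 2 P)
    (w : P) (hw : ∀ x : P, x ^ 2 = 1 → x = 1 ∨ x = w) : IsCyclic P := by
  classical
  have := Fintype.ofFinite P
  have key : ∀ k : ℕ, (Finset.univ.filter fun x : P => x ^ 2 ^ k = 1).card ≤ 2 ^ k := by
    intro k
    induction k with
    | zero => exact Finset.card_le_one.2 (by intro x hx y hy; simp_all)
    | succ k ih =>
      have h1 := Finset.card_le_mul_card_image (f := fun x : P => x ^ 2)
        (Finset.univ.filter fun x : P => x ^ 2 ^ (k + 1) = 1) 2 (by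
          intro y hy
          obtain ⟨x, -, rfl⟩ := Finset.mem_image.1 hy
          refine (Finset.card_le_card (t := {x, x * w}) ?_).trans Finset.card_le_two
          intro v hv
          rw [Finset.mem_filter] at hv
          have h2 : (x⁻¹ * v) ^ 2 = 1 := by
            rw [mul_pow, inv_pow, hv.2, inv_mul_cancel]
          rw [Finset.mem_insert, Finset.mem_singleton]
          rcases hw _ h2 with h3 | h3
          · exact Or.inl (inv_mul_eq_one.1 h3).symm
          · exact Or.inr (inv_mul_eq_iff_eq_mul.1 h3))
      refine h1.trans ?_
      rw [pow_succ 2 k, mul_comm]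
      refine Nat.mul_le_mul_right 2 (le_trans (Finset.card_le_card ?_) ih)
      intro y hy
      obtain ⟨x, hx, rfl⟩ := Finset.mem_image.1 hy
      rw [Finset.mem_filter] at hx ⊢
      refine ⟨Finset.mem_univ _, ?_⟩
      rw [← pow_mul, ← pow_succ']
      exact hx.2
  apply isCyclic_of_card_pow_eq_one_le
  intro n hn
  -- The odd part of the exponent is irrelevant in a 2-group.
  obtain ⟨k, m, hm, rfl⟩ := Nat.exists_eq_two_pow_mul_odd hn.ne'
  refine le_trans (Finset.card_le_card ?_) ((key k).trans (Nat.le_mul_of_pos_right _ hm.pos))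
  intro x hx
  rw [Finset.mem_filter] at hx ⊢
  refine ⟨Finset.mem_univ _, ?_⟩
  obtain ⟨j, hj⟩ := (IsPGroup.iff_orderOf.1 hP) x
  rw [← orderOf_dvd_iff_pow_eq_one] at hx ⊢
  rw [hj] at hx ⊢
  refine Nat.Coprime.dvd_of_dvd_mul_right ?_ hx.2
  exact Nat.Coprime.pow_left j (Nat.coprime_two_left.2 hm)

theorem mem_zpowers_zpow_of_odd {G : Type*} [Group G] [Finite G] (hG : IsPGroup 2 G) (x : G)
    (k : ℤ) : ∃ m : ℤ, x = (x ^ (2 * k + 1)) ^ m := by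
  obtain ⟨j, hj⟩ := (IsPGroup.iff_orderOf.1 hG) x
  have h1 : IsCoprime (2 * k + 1) ((orderOf x : ℕ) : ℤ) := by
    rw [hj]
    push_cast
    exact IsCoprime.pow_right ⟨1, -k, by ring⟩
  obtain ⟨u, v, huv⟩ := h1
  refine ⟨u, ?_⟩
  have h2 : (2 * k + 1) * u = 1 - v * orderOf x := by linarith
  rw [← zpow_mul, h2, zpow_sub, zpow_one, mul_comm v, zpow_mul, zpow_natCast,
    pow_orderOf_eq_one, one_zpow]
  simp

theorem eq_pow_half_orderOf_of_mem_zpowers {G : Type*} [Group G] [Finite G] {x z : G}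
    (hx : x ∈ Subgroup.zpowers z) (h2 : x ^ 2 = 1) (h1 : x ≠ 1) : x = z ^ (orderOf z / 2) := by
  obtain ⟨k, rfl⟩ := Subgroup.mem_zpowers_iff.1 hx
  rw [← zpow_natCast, ← zpow_mul, ← orderOf_dvd_iff_zpow_eq_one] at h2
  rw [Ne, ← orderOf_dvd_iff_zpow_eq_one] at h1
  rw [← zpow_natCast, ← mul_inv_eq_one, ← zpow_sub, ← orderOf_dvd_iff_zpow_eq_one]
  push_cast at h2 ⊢
  generalize orderOf z = n at *
  obtain ⟨l, hl⟩ := h2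
  rcases Int.even_or_odd' l with ⟨j, hj | hj⟩
  · exfalso
    exact h1 ⟨j, by subst hj; linarith⟩
  · refine ⟨j, ?_⟩
    subst hj
    have h3 : (n : ℤ) = 2 * (k - n * j) := by linarith
    have h4 : (n : ℤ) / 2 = k - n * j := by omega
    rw [h4]; ring

/-- The intersection of the center with the square subgroup is cyclic, generated by some π. The
element z must absorb all central squares: it is a central square root of an odd power of π if one
exists, and π itself otherwise. -/
theorem exists_center_generator {G : Type*} [Group G] [Finite G] (hG : IsPGroup 2 G) (w : G)
    (hw : ∀ x ∈ Subgroup.center G ⊓ squareSubgroup G, x ^ 2 = 1 → x = 1 ∨ x = w)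
    (hwmem : w ∈ Subgroup.center G ⊓ squareSubgroup G) :
    ∃ z ∈ Subgroup.center G, (∀ u ∈ Subgroup.center G, ∃ k : ℤ, u ^ 2 = z ^ (2 * k)) ∧
      ∀ p ∈ Subgroup.center G ⊓ squareSubgroup G, ∃ k : ℤ, p = z ^ k := by
  set P := Subgroup.center G ⊓ squareSubgroup G with hPdef
  let _ : CommGroup P :=
    { (inferInstance : Group P) with
      mul_comm := fun x y => Subtype.ext (central_comm (Subgroup.mem_inf.1 y.2).1 x) }
  have hcyc : IsCyclic P := isCyclic_of_involution_unique (hG.to_subgroup P) ⟨w, hwmem⟩ (by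
    rintro ⟨x, hx⟩ h2
    rcases hw x hx (by simpa using congrArg Subtype.val h2) with h | h
    · exact Or.inl (Subtype.ext h)
    · exact Or.inr (Subtype.ext h))
  obtain ⟨⟨π, hπ⟩, hgen⟩ := hcyc.exists_generator
  have hgen' : ∀ p ∈ P, ∃ k : ℤ, p = π ^ k := by
    intro p hp
    obtain ⟨k, hk⟩ := hgen ⟨p, hp⟩
    exact ⟨k, by simpa using (congrArg Subtype.val hk).symm⟩
  have hsq : ∀ u ∈ Subgroup.center G, ∃ k : ℤ, u ^ 2 = π ^ k := fun u hu =>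
    hgen' _ (Subgroup.mem_inf.2 ⟨pow_mem hu 2, sq_mem_squareSubgroup u⟩)
  by_cases hodd : ∃ y ∈ Subgroup.center G, ∃ k : ℤ, y ^ 2 = π ^ (2 * k + 1)
  · obtain ⟨y, hy, k, hk⟩ := hodd
    -- An odd power of π generates ⟨π⟩, so every power of π is an even power of y.
    obtain ⟨m, hm⟩ := mem_zpowers_zpow_of_odd hG π k
    rw [← hk] at hm
    have hpi : ∀ i : ℤ, π ^ i = y ^ (2 * (m * i)) := by
      intro i
      rw [zpow_mul, zpow_mul]
      rw [hm]
      norm_cast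
    refine ⟨y, hy, fun u hu => ?_, fun p hp => ?_⟩
    · obtain ⟨i, hi⟩ := hsq u hu
      exact ⟨m * i, by rw [hi, hpi]⟩
    · obtain ⟨i, hi⟩ := hgen' p hp
      exact ⟨2 * (m * i), by rw [hi, hpi]⟩
  · push Not at hodd
    refine ⟨π, (Subgroup.mem_inf.1 hπ).1, fun u hu => ?_, hgen'⟩
    obtain ⟨i, hi⟩ := hsq u hu
    rcases Int.even_or_odd' i with ⟨j, hj | hj⟩
    · exact ⟨j, by rw [hi, hj]⟩
    · exact absurd (hj ▸ hi) (hodd u hu j)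

/-! ### Changing the pair: central twists, b ↦ ba, and exchange of a and b -/

namespace DihedralPair

variable {G : Type*} [Group G] {a b : G}

theorem twist_commutator (a b : G) {u v : G} (hu : u ∈ Subgroup.center G)
    (hv : v ∈ Subgroup.center G) :
    (a * u) * (b * v) * (a * u)⁻¹ * (b * v)⁻¹ = a * b * a⁻¹ * b⁻¹ := by
  rw [central_comm hu a, central_comm hv b, mul_inv_rev, mul_inv_rev,
    show u * a * (v * b) = u * (a * v) * b by group, central_comm hv a]
  rw [show u * (v * a) * b * (a⁻¹ * u⁻¹) * (b⁻¹ * v⁻¹) = u * (v * (a * b * a⁻¹ * (u⁻¹ * b⁻¹))) * v⁻¹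
    by group, ← central_comm (inv_mem hu) b⁻¹]
  rw [show u * (v * (a * b * a⁻¹ * (b⁻¹ * u⁻¹))) * v⁻¹ =
    u * (v * ((a * b * a⁻¹ * b⁻¹) * (u⁻¹ * v⁻¹))) by group,
    central_comm (mul_mem (inv_mem hu) (inv_mem hv)), central_comm (inv_mem hv) u⁻¹]
  group

theorem twist_reflect (a b : G) {u v : G} (hu : u ∈ Subgroup.center G)
    (hv : v ∈ Subgroup.center G) :
    (b * v) * (a * u) * (b * v)⁻¹ * (a * u) = b * a * b⁻¹ * a * u ^ 2 := by
  have h : Commute (a * u) v := central_comm hv _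
  have h' : (b * v) * (a * u) * (b * v)⁻¹ = b * a * (u * b⁻¹) := by
    rw [mul_assoc b, ← h.eq]; group
  rw [h', ← central_comm hu b⁻¹, pow_two, ← mul_assoc, ← mul_assoc, mul_assoc _ u a,
    ← central_comm hu a]
  group

theorem twist_sq {b v : G} (hv : v ∈ Subgroup.center G) : (b * v) ^ 2 = b ^ 2 * v ^ 2 :=
  (show Commute b v from central_comm hv b).mul_pow 2

theorem twist (h : DihedralPair a b) {u v : G} (hu : u ∈ Subgroup.center G)
    (hv : v ∈ Subgroup.center G) : DihedralPair (a * u) (b * v) where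
  cover g := by
    have h1 : ∀ i : ℤ, (a * u) ^ i = a ^ i * u ^ i := fun i =>
      (show Commute a u from central_comm hu a).mul_zpow i
    obtain ⟨i, x, hx, rfl | rfl⟩ := h.cover g
    · exact ⟨i, (u ^ i)⁻¹ * x, mul_mem (inv_mem (zpow_mem hu i)) hx, Or.inl (by rw [h1]; group)⟩
    · refine ⟨i, (v * u ^ i)⁻¹ * x, mul_mem (inv_mem (mul_mem hv (zpow_mem hu i))) hx, Or.inr ?_⟩
      rw [h1, mul_assoc b v, ← mul_assoc v, ← central_comm hv (a ^ i)]
      group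
  sq_mem := by rw [twist_sq hv]; exact mul_mem h.sq_mem (pow_mem hv 2)
  reflect_mem := by rw [twist_reflect a b hu hv]; exact mul_mem h.reflect_mem (pow_mem hu 2)
  not_commute hc := by
    apply h.not_commute
    have h1 := twist_commutator a b hu hv
    rw [hc.eq] at h1
    have h2 : a * b * a⁻¹ * b⁻¹ = 1 := by rw [← h1]; group
    exact mul_inv_eq_iff_eq_mul.1 (mul_inv_eq_one.1 h2)

theorem shift_commutator (a b : G) : a * (b * a) * a⁻¹ * (b * a)⁻¹ = a * b * a⁻¹ * b⁻¹ := by group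

theorem shift_reflect (a b : G) : (b * a) * a * (b * a)⁻¹ * a = b * a * b⁻¹ * a := by group

theorem shift_sq (h : DihedralPair a b) : (b * a) ^ 2 = b * a * b⁻¹ * a * b ^ 2 := by
  rw [mul_assoc _ a, central_comm h.sq_mem a, pow_two, pow_two]; group

theorem shift (h : DihedralPair a b) : DihedralPair a (b * a) where
  cover g := by
    obtain ⟨i, x, hx, rfl | rfl⟩ := h.cover g
    · exact ⟨i, x, hx, Or.inl rfl⟩
    · refine ⟨i - 1, x, hx, Or.inr ?_⟩
      rw [mul_assoc b a, ← zpow_one_add, add_sub_cancel]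
  sq_mem := by rw [h.shift_sq]; exact mul_mem h.reflect_mem h.sq_mem
  reflect_mem := by rw [shift_reflect]; exact h.reflect_mem
  not_commute hc := by
    apply h.not_commute
    have h1 := shift_commutator a b
    rw [hc.eq] at h1
    have h2 : a * b * a⁻¹ * b⁻¹ = 1 := by rw [← h1]; group
    exact mul_inv_eq_iff_eq_mul.1 (mul_inv_eq_one.1 h2)

theorem swap_commutator (a b : G) : b * a * b⁻¹ * a⁻¹ = (a * b * a⁻¹ * b⁻¹)⁻¹ := by group

theorem swap_reflect (a b : G) : a * b * a⁻¹ * b = a * b * a⁻¹ * b⁻¹ * b ^ 2 := by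
  rw [pow_two]; group

/-- When a² is central, so is c. Modulo the center a and b then commute and have square one, so
their roles are symmetric. -/
theorem swap (h : DihedralPair a b) (ha : a ^ 2 ∈ Subgroup.center G) : DihedralPair b a where
  cover g := by
    have hc : a * b * a⁻¹ * b⁻¹ ∈ Subgroup.center G := by
      rw [commutator_eq]; exact mul_mem ha (inv_mem h.reflect_mem)
    have hzp : ∀ j : ℤ, a ^ (2 * j) ∈ Subgroup.center G := fun j => by
      rw [zpow_mul]; exact zpow_mem (by exact_mod_cast ha) j
    obtain ⟨i, x, hx, rfl | rfl⟩ := h.cover g <;> rcases Int.even_or_odd' i with ⟨j, rfl | rfl⟩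
    · refine ⟨0, a ^ (2 * j) * x, mul_mem ?_ hx, Or.inl (by simp)⟩
      exact hzp j
    · refine ⟨0, a ^ (2 * j) * x, mul_mem ?_ hx, Or.inr ?_⟩
      · exact hzp j
      · rw [zpow_zero, mul_one, add_comm, zpow_one_add, mul_assoc]
    · refine ⟨1, a ^ (2 * j) * x, mul_mem ?_ hx, Or.inl ?_⟩
      · exact hzp j
      · rw [zpow_one, mul_assoc]
    · refine ⟨1, (a * b * a⁻¹ * b⁻¹)⁻¹ * (a ^ (2 * j) * x),
        mul_mem (inv_mem hc) (mul_mem ?_ hx), Or.inr ?_⟩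
      · exact hzp j
      · rw [← mul_assoc (a * b ^ (1 : ℤ)), central_comm (inv_mem hc), add_comm, zpow_one_add]
        group
  sq_mem := ha
  reflect_mem := by
    rw [swap_reflect, commutator_eq]
    exact mul_mem (mul_mem ha (inv_mem h.reflect_mem)) h.sq_mem
  not_commute hc := h.not_commute hc.symm

end DihedralPair

/-! ### The normal form and its existence -/

/-- A presentation of a finite `2`-group with dihedral central quotient whose center is the product
of an elementary abelian group `E` and the cyclic group generated by `z`. -/
structure NormalForm {G : Type*} [Group G] (a b z : G) (E : Subgroup G) (s t : ℕ) : Prop where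
  pair : DihedralPair a b
  z_mem : z ∈ Subgroup.center G
  z_ne_one : z ≠ 1
  E_le : E ≤ Subgroup.center G
  E_sq : ∀ x ∈ E, x ^ 2 = 1
  E_inter : ∀ x ∈ E, x ∈ Subgroup.zpowers z → x = 1
  decomp : ∀ u ∈ Subgroup.center G, ∃ x ∈ E, ∃ k : ℤ, u = x * z ^ k
  reflect : b * a * b⁻¹ * a = z ^ s
  sq : b ^ 2 = z ^ t
  half : (a * b * a⁻¹ * b⁻¹) ^ (orderOf (a * b * a⁻¹ * b⁻¹) / 2) = z ^ (orderOf z / 2)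

/-- Take E maximal among elementary abelian central subgroups avoiding w, the involution of ⟨z⟩. By
maximality every central u with u² = 1 has u or uw in E. A general central u reduces to this case on
dividing by z^k, where u² = z^(2k). -/
theorem exists_central_complement {G : Type*} [Group G] [Finite G] {z : G}
    (hz : z ∈ Subgroup.center G)
    (hsq : ∀ u ∈ Subgroup.center G, ∃ k : ℤ, u ^ 2 = z ^ (2 * k))
    {w : G} (hw : w ∈ Subgroup.zpowers z) (hw2 : w ^ 2 = 1) (hw1 : w ≠ 1) :
    ∃ E ≤ Subgroup.center G, (∀ x ∈ E, x ^ 2 = 1) ∧ (∀ x ∈ E, x ∈ Subgroup.zpowers z → x = 1) ∧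
      ∀ u ∈ Subgroup.center G, ∃ x ∈ E, ∃ k : ℤ, u = x * z ^ k := by
  obtain ⟨E, -, hE⟩ := Finite.exists_le_maximal (p := fun E : Subgroup G =>
    E ≤ Subgroup.center G ∧ (∀ x ∈ E, x ^ 2 = 1) ∧ w ∉ E) (a := ⊥) (by
      refine ⟨bot_le, ?_, ?_⟩
      · intro x hx; rw [Subgroup.mem_bot.1 hx, one_pow]
      · rwa [Subgroup.mem_bot])
  obtain ⟨hEc, hE2, hwE⟩ := hE.prop
  have hwz : w ∈ Subgroup.center G := (Subgroup.zpowers_le.2 hz) hw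
  have hsplit : ∀ u ∈ Subgroup.center G, u ^ 2 = 1 → u ∈ E ∨ u * w ∈ E := by
    intro u hu hu2
    by_contra hcon
    push Not at hcon
    obtain ⟨hu1, huw⟩ := hcon
    have hlt : E < E ⊔ Subgroup.zpowers u := by
      refine lt_of_le_of_ne le_sup_left ?_
      intro heq
      exact hu1 (heq ▸ Subgroup.mem_sup_right (Subgroup.mem_zpowers u))
    have hzc : Subgroup.zpowers u ≤ Subgroup.center G := Subgroup.zpowers_le.2 hu
    have hEn : E.Normal := ⟨fun n hn g => by
      rw [central_comm (hEc hn) g, mul_inv_cancel_right]; exact hn⟩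
    have hmem : ∀ x ∈ E ⊔ Subgroup.zpowers u, ∃ e ∈ E, ∃ k : ℤ, x = e * u ^ k := by
      intro x hx
      rw [Subgroup.mem_sup_of_normal_left] at hx
      obtain ⟨e, he, _, ⟨k, rfl⟩, rfl⟩ := hx
      exact ⟨e, he, k, rfl⟩
    refine hE.not_prop_of_gt hlt ⟨sup_le hEc hzc, ?_, ?_⟩
    · intro x hx
      obtain ⟨e, he, k, rfl⟩ := hmem x hx
      have h1 : Commute e (u ^ k) := central_comm (zpow_mem hu k) e
      rw [h1.mul_pow, hE2 e he, one_mul, ← zpow_natCast, ← zpow_mul, mul_comm, zpow_mul,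
        zpow_natCast, hu2, one_zpow]
    · intro hx
      obtain ⟨e, he, k, hk⟩ := hmem w hx
      rcases Int.even_or_odd' k with ⟨j, rfl | rfl⟩
      · rw [zpow_mul] at hk
        norm_cast at hk
        rw [hu2, one_zpow, mul_one] at hk
        exact hwE (hk ▸ he)
      · rw [zpow_add, zpow_mul, zpow_one] at hk
        norm_cast at hk
        rw [hu2, one_zpow, one_mul] at hk
        apply huw
        have h1 : u * w = e := by
          rw [hk, central_comm hu, ← mul_assoc, ← pow_two, hu2, one_mul]
        rwa [h1]
  refine ⟨E, hEc, hE2, ?_, ?_⟩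
  · intro x hx hxz
    by_contra hx1
    apply hwE
    rw [eq_pow_half_orderOf_of_mem_zpowers hw hw2 hw1,
      ← eq_pow_half_orderOf_of_mem_zpowers hxz (hE2 x hx) hx1]
    exact hx
  · intro u hu
    obtain ⟨k, hk⟩ := hsq u hu
    have h1 : Commute u (z ^ (-k)) := central_comm (zpow_mem hz _) u
    have h2 : (u * z ^ (-k)) ^ 2 = 1 := by
      rw [h1.mul_pow, hk, ← zpow_natCast, ← zpow_mul, ← zpow_add]
      simp [mul_comm]
    rcases hsplit _ (mul_mem hu (zpow_mem hz _)) h2 with h3 | h3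
    · exact ⟨_, h3, k, by group⟩
    · obtain ⟨m, rfl⟩ := Subgroup.mem_zpowers_iff.1 hw
      exact ⟨_, h3, k - m, by group⟩

theorem zpow_eq_zpow_mul_sq {G : Type*} [Group G] (z : G) (k : ℤ) :
    ∃ s : ℕ, ∃ j : ℤ, (s = 0 ∨ s = 1) ∧ z ^ k * (z ^ j) ^ 2 = z ^ s := by
  rcases Int.even_or_odd' k with ⟨j, rfl | rfl⟩
  · refine ⟨0, -j, Or.inl rfl, ?_⟩
    rw [← zpow_natCast, ← zpow_mul, ← zpow_add, ← zpow_natCast]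
    congr 1; push_cast; ring
  · refine ⟨1, -j, Or.inr rfl, ?_⟩
    rw [← zpow_natCast, ← zpow_mul, ← zpow_add, ← zpow_natCast]
    congr 1; push_cast; ring

/-- Adjusting a dihedral pair by central elements and by the substitutions `b ↦ b * a` and
`a ↔ b` reduces the pair of exponents to three possibilities. -/
theorem DihedralPair.exists_reduced {G : Type*} [Group G] [Finite G] (hG : IsPGroup 2 G) {a b z : G}
    (h : DihedralPair a b) (hz : z ∈ Subgroup.center G) (hz1 : z ≠ 1)
    (hc : (a * b * a⁻¹ * b⁻¹) ^ 2 = 1 → ∃ m : ℤ, a * b * a⁻¹ * b⁻¹ = z ^ m)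
    {k l : ℤ} (hk : b * a * b⁻¹ * a = z ^ k) (hl : b ^ 2 = z ^ l) :
    ∃ a' b' : G, ∃ s t : ℕ, DihedralPair a' b' ∧
      (a' * b' * a'⁻¹ * b'⁻¹ = a * b * a⁻¹ * b⁻¹ ∨ a' * b' * a'⁻¹ * b'⁻¹ = (a * b * a⁻¹ * b⁻¹)⁻¹) ∧
      b' * a' * b'⁻¹ * a' = z ^ s ∧ b' ^ 2 = z ^ t ∧
      ((s = 0 ∧ t = 0) ∨ (s = 0 ∧ t = 1) ∨
        (s = 1 ∧ t = 0 ∧ (a * b * a⁻¹ * b⁻¹) ^ 2 ≠ 1)) := by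
  -- Twisting by powers of z multiplies ζ and b² by independent squares, so both exponents matter
  -- only modulo two.
  have adjust : ∀ {x y : G}, DihedralPair x y → ∀ {i j : ℤ}, y * x * y⁻¹ * x = z ^ i →
      y ^ 2 = z ^ j → ∀ {i' j' : ℤ} {s t : ℕ}, z ^ i * (z ^ i') ^ 2 = z ^ s →
      z ^ j * (z ^ j') ^ 2 = z ^ t → ∃ x' y' : G, DihedralPair x' y' ∧
      x' * y' * x'⁻¹ * y'⁻¹ = x * y * x⁻¹ * y⁻¹ ∧ y' * x' * y'⁻¹ * x' = z ^ s ∧ y' ^ 2 = z ^ t := by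
    intro x y hxy i j hi hj i' j' s t hs ht
    have hzi := zpow_mem hz i'
    have hzj := zpow_mem hz j'
    refine ⟨_, _, hxy.twist hzi hzj, twist_commutator x y hzi hzj, ?_, ?_⟩
    · rw [twist_reflect x y hzi hzj, hi, hs]
    · rw [twist_sq hzj, hj, ht]
  have hζβ : ∃ a' b' : G, ∃ s t : ℕ, DihedralPair a' b' ∧
      a' * b' * a'⁻¹ * b'⁻¹ = a * b * a⁻¹ * b⁻¹ ∧
      b' * a' * b'⁻¹ * a' = z ^ s ∧ b' ^ 2 = z ^ t ∧
      ((s = 0 ∧ t = 0) ∨ (s = 0 ∧ t = 1) ∨ (s = 1 ∧ t = 0)) := by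
    obtain ⟨s, i, hs, hs'⟩ := zpow_eq_zpow_mul_sq z k
    obtain ⟨t, j, ht, ht'⟩ := zpow_eq_zpow_mul_sq z l
    obtain ⟨x, y, hxy, h1, h2, h3⟩ := adjust h hk hl hs' ht'
    rcases hs with rfl | rfl <;> rcases ht with rfl | rfl
    · exact ⟨x, y, 0, 0, hxy, h1, h2, h3, by simp⟩
    · exact ⟨x, y, 0, 1, hxy, h1, h2, h3, by simp⟩
    · exact ⟨x, y, 1, 0, hxy, h1, h2, h3, by simp⟩
    -- The exponents (1,1) become (1,2) under b ↦ ba, since (ba)² = ζb²; the twist by z⁻¹ then gives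
    -- (1,0).
    · obtain ⟨x', y', hxy', h1', h2', h3'⟩ := adjust hxy.shift (i := 1) (j := 2) (i' := 0)
        (j' := -1) (s := 1) (t := 0) (by rw [shift_reflect, h2]; simp)
        (by rw [hxy.shift_sq, h2, h3, pow_one, ← pow_two]; norm_cast) (by simp)
        (by rw [zpow_neg_one, inv_pow, pow_zero, mul_inv_eq_one]; norm_cast)
      exact ⟨x', y', 1, 0, hxy', by rw [h1', shift_commutator, h1], h2', h3', by simp⟩
  obtain ⟨x, y, s, t, hxy, h1, h2, h3, h4⟩ := hζβ
  by_cases hc2 : (a * b * a⁻¹ * b⁻¹) ^ 2 = 1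
  swap
  · refine ⟨x, y, s, t, hxy, Or.inl h1, h2, h3, ?_⟩
    rcases h4 with h4 | h4 | h4
    · exact Or.inl h4
    · exact Or.inr (Or.inl h4)
    · exact Or.inr (Or.inr ⟨h4.1, h4.2, hc2⟩)
  rcases h4 with h4 | h4 | ⟨rfl, rfl⟩
  · exact ⟨x, y, s, t, hxy, Or.inl h1, h2, h3, Or.inl h4⟩
  · exact ⟨x, y, s, t, hxy, Or.inl h1, h2, h3, Or.inr (Or.inl h4)⟩
  obtain ⟨m, hm⟩ := hc hc2
  -- With c² = 1 and c = z^m, the case (1,0) is removed by exchanging the generators, which yields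
  -- exponents (m, m + 1).
  have hcx : x ^ 2 = z ^ (m + 1) := by
    have h5 := commutator_eq x y
    rw [h2, h1, hm, eq_mul_inv_iff_mul_eq, pow_one] at h5
    rw [← h5, zpow_add_one]
  have hxc : x ^ 2 ∈ Subgroup.center G := hcx ▸ zpow_mem hz _
  have hsw := hxy.swap hxc
  have hswr : x * y * x⁻¹ * y = z ^ m := by
    rw [swap_reflect, h1, hm, h3, pow_zero, mul_one]
  rcases Int.even_or_odd' m with ⟨j, rfl | rfl⟩
  · obtain ⟨x', y', hxy', h1', h2', h3'⟩ := adjust hsw hswr hcx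
      (i' := -j) (j' := -j) (s := 0) (t := 1)
      (by rw [← zpow_natCast, ← zpow_mul, ← zpow_add]; simp [mul_comm])
      (by rw [← zpow_natCast, ← zpow_mul, ← zpow_add, ← zpow_natCast]; congr 1; push_cast; ring)
    exact ⟨x', y', 0, 1, hxy', Or.inr (by rw [h1', swap_commutator, h1]), h2', h3', by simp⟩
  -- For odd m the element z is a power of c, so z = c has order two, and x² = y² = 1. The pair (xy,
  -- y), obtained by exchange, shift and exchange, has both exponents zero.
  · obtain ⟨i, hi⟩ := mem_zpowers_zpow_of_odd hG z j
    rw [← hm] at hi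
    have hzc : z = a * b * a⁻¹ * b⁻¹ := by
      have hcm : ∀ n : ℤ, (a * b * a⁻¹ * b⁻¹) ^ n = 1 ∨
          (a * b * a⁻¹ * b⁻¹) ^ n = a * b * a⁻¹ * b⁻¹ := by
        intro n
        rcases Int.even_or_odd' n with ⟨r, rfl | rfl⟩
        · left; rw [zpow_mul]; norm_cast; rw [hc2, one_zpow]
        · right; rw [zpow_add, zpow_mul]; norm_cast; rw [hc2, one_zpow, one_mul, pow_one]
      rcases hcm i with h6 | h6
      · exact absurd (hi.trans h6) hz1
      · exact hi.trans h6
    have hz2 : z ^ 2 = 1 := by rw [hzc]; exact hc2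
    have hzz : z ^ (2 * j + 1) = z := by rw [← hm, ← hzc]
    have hx2 : x ^ 2 = 1 := by rw [hcx, zpow_add_one, hzz, ← pow_two, hz2]
    rw [hzz] at hswr
    have hxys : (x * y) ^ 2 = z := by
      rw [hsw.shift_sq, hswr, hx2, mul_one]
    have hyc : y ^ 2 ∈ Subgroup.center G := h3 ▸ pow_mem hz 0
    have hfin := hsw.shift.swap hyc
    refine ⟨x * y, y, 0, 0, hfin, Or.inr ?_, ?_, h3, by simp⟩
    · rw [swap_commutator, shift_commutator, swap_commutator, h1, inv_inv, ← hzc,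
        eq_inv_iff_mul_eq_one, ← pow_two, hz2]
    · rw [swap_reflect, shift_commutator, swap_commutator, h1, ← hzc, hxys]
      simp

/-- The involution w = c^(q/2) is inverted, hence fixed, by b, and commutes with a; so it is central
and lies in the square subgroup. It is the only involution there, hence the involution of ⟨z⟩, which
links the orders of c and z. Both ζ and b² are central products of squares, hence powers of z. -/
theorem exists_normalForm {G : Type*} [Group G] [Finite G] (hG : IsPGroup 2 G)
    (hindex : (commutator G ⊔ Subgroup.center G).index = 4)
    (hsoc : ∀ x y : G, x ∈ Subgroup.center G ⊓ squareSubgroup G →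
      y ∈ Subgroup.center G ⊓ squareSubgroup G → x ^ 2 = 1 → y ^ 2 = 1 → x ≠ 1 → y ≠ 1 → x = y) :
    ∃ (a b z : G) (E : Subgroup G) (s t : ℕ), NormalForm a b z E s t ∧
      ((s = 0 ∧ t = 0) ∨ (s = 0 ∧ t = 1) ∨
        (s = 1 ∧ t = 0 ∧ 4 ∣ orderOf (a * b * a⁻¹ * b⁻¹))) := by
  obtain ⟨a, ha⟩ := exists_index_zpowers_sup_center_eq_two _ le_rfl hG hindex
  obtain ⟨b, h⟩ := exists_dihedralPair_of_index_eq_two ha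
  set c := a * b * a⁻¹ * b⁻¹ with hc
  obtain ⟨n, hn⟩ := h.orderOf_commutator hG
  set w := c ^ (orderOf c / 2) with hw
  have hq : orderOf c / 2 * 2 = orderOf c := by rw [hn, pow_succ]; omega
  have hw2 : w ^ 2 = 1 := by rw [hw, ← pow_mul, hq, pow_orderOf_eq_one]
  have hw1 : w ≠ 1 := by
    rw [hw, Ne, ← orderOf_dvd_iff_pow_eq_one]
    intro hd
    have h1 : 0 < orderOf c := orderOf_pos c
    have := Nat.le_of_dvd (by omega) hd
    omega
  have hwc : w ∈ Subgroup.center G := by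
    refine h.mem_center_of_commute (h.commute_commutator.pow_right _) ?_
    have h1 : b * w * b⁻¹ = w := by
      rw [hw, ← conj_pow, h.conj_commutator, inv_pow, ← hw, inv_eq_iff_mul_eq_one, ← pow_two, hw2]
    exact mul_inv_eq_iff_eq_mul.1 h1
  have hcsq : c ∈ squareSubgroup G := commutator_mem_squareSubgroup a b
  have hwP : w ∈ Subgroup.center G ⊓ squareSubgroup G := Subgroup.mem_inf.2 ⟨hwc, pow_mem hcsq _⟩
  obtain ⟨z, hz, hzsq, hzP⟩ := exists_center_generator hG w (fun x hx hx2 => by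
    by_cases hx1 : x = 1
    · exact Or.inl hx1
    · exact Or.inr (hsoc x w hx hwP hx2 hw2 hx1 hw1)) hwP
  obtain ⟨k, hk⟩ := hzP _ (Subgroup.mem_inf.2 ⟨h.reflect_mem, by
    have h1 : b * a * b⁻¹ * a = (b * a) ^ 2 * (b ^ 2)⁻¹ := by
      rw [h.shift_sq, mul_inv_cancel_right]
    rw [h1]
    exact mul_mem (sq_mem_squareSubgroup _) (inv_mem (sq_mem_squareSubgroup _))⟩)
  obtain ⟨l, hl⟩ := hzP _ (Subgroup.mem_inf.2 ⟨h.sq_mem, sq_mem_squareSubgroup b⟩)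
  obtain ⟨m, hm⟩ := hzP w hwP
  have hz1 : z ≠ 1 := by
    rintro rfl
    exact hw1 (by rw [hm, one_zpow])
  have hwz : w ∈ Subgroup.zpowers z := ⟨m, hm.symm⟩
  obtain ⟨E, hE1, hE2, hE3, hE4⟩ := exists_central_complement hz hzsq hwz hw2 hw1
  obtain ⟨a', b', s, t, hab, hcc, hs, ht, hst⟩ := h.exists_reduced hG hz hz1 (fun h2 => by
    refine hzP c (Subgroup.mem_inf.2 ⟨h.mem_center_of_commute h.commute_commutator ?_, hcsq⟩)
    have h1 := h.conj_commutator
    rw [← hc] at h1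
    have h3 : c⁻¹ = c := by rw [inv_eq_iff_mul_eq_one, ← pow_two, h2]
    rw [h3] at h1
    exact mul_inv_eq_iff_eq_mul.1 h1) hk hl
  have hord : orderOf (a' * b' * a'⁻¹ * b'⁻¹) = orderOf c := by
    rcases hcc with h1 | h1 <;> rw [h1]
    exact orderOf_inv c
  refine ⟨a', b', z, E, s, t, ⟨hab, hz, hz1, hE1, hE2, hE3, hE4, hs, ht, ?_⟩, ?_⟩
  · rw [hord, ← eq_pow_half_orderOf_of_mem_zpowers hwz hw2 hw1]
    rcases hcc with h1 | h1 <;> rw [h1]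
    rw [inv_pow, ← hc, ← hw, inv_eq_iff_mul_eq_one, ← pow_two, hw2]
  · rw [hord]
    rcases hst with h1 | h1 | ⟨h1, h2, h3⟩
    · exact Or.inl h1
    · exact Or.inr (Or.inl h1)
    · refine Or.inr (Or.inr ⟨h1, h2, ?_⟩)
      rw [Ne, ← orderOf_dvd_iff_pow_eq_one, hn] at h3
      rw [hn]
      cases n with
      | zero => exact absurd (by norm_num) h3
      | succ n => exact ⟨2 ^ n, by ring⟩

theorem nonempty_mulEquiv_of_sq_eq_one {E E' : Type*} [CommGroup E] [CommGroup E'] [Finite E]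
    [Finite E'] (h : ∀ x : E, x ^ 2 = 1) (h' : ∀ x : E', x ^ 2 = 1)
    (hcard : Nat.card E = Nat.card E') : Nonempty (E ≃* E') := by
  let _ : Module (ZMod 2) (Additive E) := AddCommGroup.zmodModule (n := 2) (fun x => h x.toMul)
  let _ : Module (ZMod 2) (Additive E') := AddCommGroup.zmodModule (n := 2) (fun x => h' x.toMul)
  have h1 := Module.natCard_eq_pow_finrank (K := ZMod 2) (V := Additive E)
  have h2 := Module.natCard_eq_pow_finrank (K := ZMod 2) (V := Additive E')
  have h3 : Module.finrank (ZMod 2) (Additive E) = Module.finrank (ZMod 2) (Additive E') := by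
    have h4 : Nat.card (Additive E) = Nat.card (Additive E') := hcard
    rw [h1, h2, Nat.card_zmod] at h4
    exact Nat.pow_right_injective le_rfl h4
  exact ⟨MulEquiv.toAdditive.symm (LinearEquiv.ofFinrankEq _ _ h3).toAddEquiv⟩

/-! ### The numerical data determine the group -/

namespace NormalForm

variable {G : Type*} [Group G] {a b z : G} {E : Subgroup G} {s t : ℕ}

theorem mul_rot_rot (h : NormalForm a b z E s t) (i j k l : ℤ) (x y : E) :
    a ^ i * (x * z ^ k) * (a ^ j * (y * z ^ l)) = a ^ (i + j) * ((x * y : E) * z ^ (k + l)) := by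
  have hx : ∀ g, Commute g (x : G) := central_comm (h.E_le x.2)
  have hy : ∀ g, Commute g (y : G) := central_comm (h.E_le y.2)
  have hz : ∀ (m : ℤ) g, Commute g (z ^ m) := fun m => central_comm (zpow_mem h.z_mem m)
  rw [zpow_add, zpow_add, Subgroup.coe_mul, mul_assoc, ← mul_assoc _ (a ^ j),
    ← ((hx (a ^ j)).mul_right (hz k (a ^ j))).eq, mul_assoc, mul_assoc]
  simp only [mul_assoc]
  rw [← mul_assoc (z ^ k), ← (hz k y).eq, mul_assoc]

theorem zpow_mul_reflection (h : NormalForm a b z E s t) (i : ℤ) :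
    a ^ i * b = b * (a ^ (-i) * z ^ (s * i)) := by
  have h1 := h.pair.conj_zpow_eq (-i)
  have h2 : Commute (a ^ i) (z ^ (s * i)) := central_comm (zpow_mem h.z_mem _) _
  have h3 : Commute b (z ^ (s * i)) := central_comm (zpow_mem h.z_mem _) _
  rw [h.reflect, neg_neg, ← zpow_natCast z, ← zpow_mul, mul_neg, zpow_neg z,
    mul_inv_eq_iff_eq_mul] at h1
  rw [← mul_assoc, h1, mul_assoc, mul_assoc, h3.eq, inv_mul_cancel_left]

theorem mul_rot_refl (h : NormalForm a b z E s t) (i j k l : ℤ) (x y : E) :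
    a ^ i * (x * z ^ k) * (b * a ^ j * (y * z ^ l)) =
      b * a ^ (j - i) * ((x * y : E) * z ^ (k + l + s * i)) := by
  have hx : ∀ g, Commute g (x : G) := central_comm (h.E_le x.2)
  have hz : ∀ (m : ℤ) g, Commute g (z ^ m) := fun m => central_comm (zpow_mem h.z_mem m)
  have h1 : a ^ i * (x * z ^ k) * (b * a ^ j * (y * z ^ l)) =
      a ^ i * b * ((x * z ^ k) * (a ^ j * (y * z ^ l))) := by
    rw [mul_assoc (a ^ i), mul_assoc b, ← mul_assoc _ b,
      ← ((hx b).mul_right (hz k b)).eq]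
    simp only [mul_assoc]
  have h2 := h.mul_rot_rot 0 j k l x y
  rw [zpow_zero, one_mul, zero_add] at h2
  rw [h1, h2, h.zpow_mul_reflection, sub_eq_neg_add, zpow_add, zpow_add z, mul_assoc b,
    mul_assoc (a ^ (-i))]
  rw [(hz (s * i) _).symm.eq]
  simp only [mul_assoc, zpow_add]

theorem mul_refl_refl (h : NormalForm a b z E s t) (i j k l : ℤ) (x y : E) :
    b * a ^ i * (x * z ^ k) * (b * a ^ j * (y * z ^ l)) =
      a ^ (j - i) * ((x * y : E) * z ^ (k + l + s * i + t)) := by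
  have h1 : b * a ^ i * (x * z ^ k) * (b * a ^ j * (y * z ^ l)) =
      b * (a ^ i * (x * z ^ k) * (b * a ^ j * (y * z ^ l))) := by simp only [mul_assoc]
  rw [h1, h.mul_rot_refl, zpow_add z _ (t : ℤ), zpow_natCast, ← h.sq]
  have h2 := central_comm h.pair.sq_mem (a ^ (j - i) * ((x * y : E) * z ^ (k + l + s * i)))
  simp only [mul_assoc] at h2 ⊢
  rw [h2, pow_two]
  simp only [mul_assoc]

/-- Since c = a²ζ⁻¹, the identification of c^(q/2) with the involution of ⟨z⟩ turns into a formula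
for a^q. It is the one relation between a and the center. -/
theorem zpow_orderOf_commutator [Finite G] (hG : IsPGroup 2 G) (h : NormalForm a b z E s t) :
    a ^ orderOf (a * b * a⁻¹ * b⁻¹) =
      z ^ (orderOf z / 2 + s * (orderOf (a * b * a⁻¹ * b⁻¹) / 2)) := by
  obtain ⟨n, hn⟩ := h.pair.orderOf_commutator hG
  have h1 := h.half
  have hq : orderOf (a * b * a⁻¹ * b⁻¹) = 2 * (orderOf (a * b * a⁻¹ * b⁻¹) / 2) := by
    rw [hn, pow_succ]; omega
  generalize orderOf (a * b * a⁻¹ * b⁻¹) = q at *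
  rw [DihedralPair.commutator_eq] at h1
  have h2 : Commute (a ^ 2) (b * a * b⁻¹ * a)⁻¹ :=
    central_comm (inv_mem h.pair.reflect_mem) _
  rw [h2.mul_pow, inv_pow, mul_inv_eq_iff_eq_mul, h.reflect, ← pow_mul, ← hq, ← pow_mul] at h1
  rw [h1, pow_add]

/-- Coordinates are not unique, but this criterion for representing the identity involves only q,
|z| and s. It makes the comparison of coordinates in two groups well defined. -/
theorem rot_eq_one_iff [Finite G] (hG : IsPGroup 2 G) (h : NormalForm a b z E s t) (i k : ℤ)
    (x : E) : a ^ i * (x * z ^ k) = 1 ↔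
      ∃ j : ℤ, i = orderOf (a * b * a⁻¹ * b⁻¹) * j ∧ x = 1 ∧
        (orderOf z : ℤ) ∣ ((orderOf z / 2 : ℕ) +
          s * (orderOf (a * b * a⁻¹ * b⁻¹) / 2 : ℕ)) * j + k := by
  have hM := h.zpow_orderOf_commutator hG
  have hpow : ∀ j : ℤ, a ^ (orderOf (a * b * a⁻¹ * b⁻¹) * j) =
      z ^ ((((orderOf z / 2 : ℕ) + s * (orderOf (a * b * a⁻¹ * b⁻¹) / 2 : ℕ)) : ℤ) * j) := by
    intro j
    rw [zpow_mul, zpow_natCast, hM, zpow_mul]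
    norm_cast
  constructor
  · intro h1
    have h2 : a ^ i ∈ Subgroup.center G := by
      rw [mul_eq_one_iff_eq_inv.1 h1]
      exact inv_mem (mul_mem (h.E_le x.2) (zpow_mem h.z_mem k))
    obtain ⟨j, rfl⟩ := (h.pair.zpow_mem_center_iff_dvd i).1 h2
    refine ⟨j, rfl, ?_⟩
    have hx : Commute (x : G) (z ^ (((orderOf z / 2 : ℕ) +
      s * (orderOf (a * b * a⁻¹ * b⁻¹) / 2 : ℕ)) * j)) := central_comm (zpow_mem h.z_mem _) _
    rw [hpow, ← mul_assoc, ← hx.eq, mul_assoc, ← zpow_add] at h1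
    have hx1 : (x : G) = 1 := by
      apply h.E_inter x x.2
      rw [mul_eq_one_iff_eq_inv.1 h1]
      exact inv_mem ⟨_, rfl⟩
    rw [hx1, one_mul, ← orderOf_dvd_iff_zpow_eq_one] at h1
    exact ⟨Subtype.ext hx1, h1⟩
  · rintro ⟨j, rfl, rfl, h1⟩
    rw [hpow, Subgroup.coe_one, one_mul, ← zpow_add, ← orderOf_dvd_iff_zpow_eq_one]
    exact h1

theorem refl_ne_one (h : NormalForm a b z E s t) (i k : ℤ) (x : E) :
    b * a ^ i * (x * z ^ k) ≠ 1 := by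
  intro h1
  apply h.pair.mul_zpow_notMem_center i
  rw [mul_eq_one_iff_eq_inv.1 h1]
  exact inv_mem (mul_mem (h.E_le x.2) (zpow_mem h.z_mem k))

theorem exists_eq (h : NormalForm a b z E s t) (g : G) :
    ∃ (i k : ℤ) (x : E), g = a ^ i * (x * z ^ k) ∨ g = b * a ^ i * (x * z ^ k) := by
  obtain ⟨i, u, hu, hg⟩ := h.pair.cover g
  obtain ⟨x, hx, k, rfl⟩ := h.decomp u hu
  exact ⟨i, k, ⟨x, hx⟩, hg⟩

variable {H : Type*} [Group H] {a' b' z' : H} {E' : Subgroup H}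

/-- The pairs of elements of two groups in normal form with the same coordinates. -/
def graph (h : NormalForm a b z E s t) (h' : NormalForm a' b' z' E' s t) (σ : E ≃* E') :
    Submonoid (G × H) where
  carrier := {p | ∃ (i k : ℤ) (x : E),
    (p.1 = a ^ i * (x * z ^ k) ∧ p.2 = a' ^ i * (σ x * z' ^ k)) ∨
    (p.1 = b * a ^ i * (x * z ^ k) ∧ p.2 = b' * a' ^ i * (σ x * z' ^ k))}
  one_mem' := ⟨0, 0, 1, Or.inl (by simp)⟩
  mul_mem' := by
    rintro ⟨p1, p2⟩ ⟨r1, r2⟩ ⟨i, k, x, ⟨h1, h2⟩ | ⟨h1, h2⟩⟩ ⟨j, l, y, ⟨h3, h4⟩ | ⟨h3, h4⟩⟩ <;>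
      simp only at h1 h2 h3 h4 <;> subst h1 h2 h3 h4
    · exact ⟨i + j, k + l, x * y, Or.inl
        ⟨h.mul_rot_rot .., by rw [map_mul]; exact h'.mul_rot_rot ..⟩⟩
    · exact ⟨j - i, k + l + s * i, x * y, Or.inr
        ⟨h.mul_rot_refl .., by rw [map_mul]; exact h'.mul_rot_refl ..⟩⟩
    · refine ⟨i + j, k + l, x * y, Or.inr ⟨?_, ?_⟩⟩
      · simp only [Prod.fst_mul]
        rw [mul_assoc b, mul_assoc b, mul_assoc b, h.mul_rot_rot]
      · simp only [Prod.snd_mul]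
        rw [map_mul, mul_assoc b', mul_assoc b', mul_assoc b', h'.mul_rot_rot]
    · exact ⟨j - i, k + l + s * i + t, x * y, Or.inl
        ⟨h.mul_refl_refl .., by rw [map_mul]; exact h'.mul_refl_refl ..⟩⟩

/-- Two groups in normal form with the same numerical data are isomorphic. -/
theorem nonempty_mulEquiv [Finite G] [Finite H] (hG : IsPGroup 2 G) (hH : IsPGroup 2 H)
    (h : NormalForm a b z E s t) (h' : NormalForm a' b' z' E' s t)
    (hq : orderOf (a * b * a⁻¹ * b⁻¹) = orderOf (a' * b' * a'⁻¹ * b'⁻¹))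
    (hz : orderOf z = orderOf z') (hE : Nat.card E = Nat.card E') : Nonempty (G ≃* H) := by
  let _ : CommGroup E := { (inferInstance : Group E) with
    mul_comm := fun x y => Subtype.ext (central_comm (h.E_le y.2) x) }
  let _ : CommGroup E' := { (inferInstance : Group E') with
    mul_comm := fun x y => Subtype.ext (central_comm (h'.E_le y.2) x) }
  obtain ⟨σ⟩ := nonempty_mulEquiv_of_sq_eq_one (fun x : E => Subtype.ext (h.E_sq x x.2))
    (fun x : E' => Subtype.ext (h'.E_sq x x.2)) hE
  set L := graph h h' σ with hL
  have hone : ∀ p ∈ L, p.1 = 1 ↔ p.2 = 1 := by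
    rintro ⟨p1, p2⟩ ⟨i, k, x, ⟨h1, h2⟩ | ⟨h1, h2⟩⟩ <;> simp only at h1 h2 <;> subst h1 h2
    · simp only
      rw [h.rot_eq_one_iff hG, h'.rot_eq_one_iff hH, hq, hz]
      simp only [EmbeddingLike.map_eq_one_iff]
    · exact iff_of_false (h.refl_ne_one i k x) (h'.refl_ne_one i k (σ x))
  -- In a finite group inverses are powers, so the submonoid is closed under them.
  have hinv : ∀ p ∈ L, p⁻¹ ∈ L := by
    intro p hp
    have h1 : p⁻¹ = p ^ (orderOf p - 1) := by
      rw [inv_eq_iff_mul_eq_one, ← pow_succ', Nat.sub_add_cancel (orderOf_pos p),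
        pow_orderOf_eq_one]
    rw [h1]
    exact pow_mem hp _
  -- Injectivity holds because one component is trivial exactly when the other is; so the pairs form
  -- the graph of an isomorphism.
  have hf : Function.Bijective ((MonoidHom.fst G H).comp L.subtype) := by
    refine ⟨fun p r hpr => ?_, fun g => ?_⟩
    · have h1 : (p.1 * r.1⁻¹).2 = 1 := (hone _ (mul_mem p.2 (hinv _ r.2))).1 (by
        change p.1.1 * r.1.1⁻¹ = 1
        rw [mul_inv_eq_one]; exact hpr)
      exact Subtype.ext (Prod.ext hpr (mul_inv_eq_one.1 h1))
    · obtain ⟨i, k, x, rfl | rfl⟩ := h.exists_eq g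
      · exact ⟨⟨(_, a' ^ i * (σ x * z' ^ k)), ⟨i, k, x, Or.inl ⟨rfl, rfl⟩⟩⟩, rfl⟩
      · exact ⟨⟨(_, b' * a' ^ i * (σ x * z' ^ k)), ⟨i, k, x, Or.inr ⟨rfl, rfl⟩⟩⟩, rfl⟩
  have hs : Function.Bijective ((MonoidHom.snd G H).comp L.subtype) := by
    refine ⟨fun p r hpr => ?_, fun g => ?_⟩
    · have h1 : (p.1 * r.1⁻¹).1 = 1 := (hone _ (mul_mem p.2 (hinv _ r.2))).2 (by
        change p.1.2 * r.1.2⁻¹ = 1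
        rw [mul_inv_eq_one]; exact hpr)
      exact Subtype.ext (Prod.ext (mul_inv_eq_one.1 h1) hpr)
    · obtain ⟨i, k, x, rfl | rfl⟩ := h'.exists_eq g
      · exact ⟨⟨(a ^ i * (σ.symm x * z ^ k), _), ⟨i, k, σ.symm x, Or.inl ⟨rfl, by simp; rfl⟩⟩⟩, rfl⟩
      · exact ⟨⟨(b * a ^ i * (σ.symm x * z ^ k), _), ⟨i, k, σ.symm x, Or.inr ⟨rfl, by simp; rfl⟩⟩⟩, rfl⟩
  exact ⟨(MulEquiv.ofBijective _ hf).symm.trans (MulEquiv.ofBijective _ hs)⟩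

end NormalForm

/-! ### Class functions in characteristic two -/

section ClassFunctions

variable {G : Type*} [Group G]

/-- In characteristic two, a class function on a finite `2`-group and its restriction to the center
have the same sum. -/
theorem sum_eq_sum_center [Fintype G] [DecidablePred (· ∈ Subgroup.center G)] (hG : IsPGroup 2 G)
    {M : Type*} [AddCommMonoid M] (h2 : ∀ m : M, m + m = 0) (f : G → M)
    (hf : ∀ g x, f (g * x * g⁻¹) = f x) :
    ∑ g, f g = ∑ g with g ∈ Subgroup.center G, f g := by
  classical
  rw [← Finset.sum_filter_add_sum_filter_not Finset.univ (· ∈ Subgroup.center G) f]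
  convert add_zero _
  refine (Finset.sum_comp (fun v : M => v) f).trans ?_
  refine Finset.sum_eq_zero fun v _ => ?_
  rw [Finset.filter_filter]
  -- The noncentral elements where f takes the value v form a conjugation-stable set without fixed
  -- points, so their number is even and v + v = 0 kills their contribution.
  let S : SubMulAction (ConjAct G) G :=
    { carrier := {x | x ∉ Subgroup.center G ∧ f x = v}
      smul_mem' := by
        rintro g x ⟨hx, hfx⟩
        rw [Set.mem_ofPred_eq, ConjAct.smul_def, hf]
        refine ⟨fun hmem => hx ?_, hfx⟩
        have h1 := (inferInstance : (Subgroup.center G).Normal).conj_mem _ hmem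
          (ConjAct.ofConjAct g)⁻¹
        convert h1 using 1
        group }
  have hcong := IsPGroup.card_modEq_card_fixedPoints (p := 2) (G := ConjAct G)
    (IsPGroup.of_equiv hG ConjAct.toConjAct) S
  have hfix : IsEmpty (MulAction.fixedPoints (ConjAct G) S) := by
    refine ⟨fun ⟨⟨x, hx⟩, hfx⟩ => hx.1 ?_⟩
    rw [Subgroup.mem_center_iff]
    intro g
    have h1 := congrArg Subtype.val (hfx (ConjAct.toConjAct g))
    change ConjAct.toConjAct g • x = x at h1
    rw [ConjAct.smul_def, ConjAct.ofConjAct_toConjAct] at h1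
    exact mul_inv_eq_iff_eq_mul.1 h1
  have hcard : Nat.card S =
      (Finset.univ.filter fun x => x ∉ Subgroup.center G ∧ f x = v).card := by
    rw [← Fintype.card_subtype, ← Nat.card_eq_fintype_card]
    rfl
  rw [hcard, Nat.card_of_isEmpty] at hcong
  obtain ⟨m, hm⟩ := (Nat.modEq_zero_iff_dvd).1 hcong
  rw [hm, mul_comm, mul_nsmul, two_nsmul, h2]

end ClassFunctions

/-! ### Subspaces preserved by algebra isomorphisms -/

section Transport

variable {F : Type*} [Field F]

theorem finrank_eq_of_linearEquiv {V V' : Type*} [AddCommGroup V] [Module F V] [AddCommGroup V']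
    [Module F V'] (e : V ≃ₗ[F] V') {D : Submodule F V} {D' : Submodule F V'}
    (h : ∀ x ∈ D, e x ∈ D') (h' : ∀ x ∈ D', e.symm x ∈ D) :
    Module.finrank F D = Module.finrank F D' := by
  have h1 : D.map (e : V →ₗ[F] V') = D' := by
    ext x
    constructor
    · rintro ⟨y, hy, rfl⟩
      exact h y hy
    · intro hx
      exact ⟨e.symm x, h' x hx, e.apply_symm_apply x⟩
  rw [← h1, LinearEquiv.finrank_map_eq]

/-- The two-sided ideal generated by a set, as a linear subspace. -/
def idealSpan (F : Type*) [Field F] {R : Type*} [Ring R] [Algebra F R] (S : Set R) :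
    Submodule F R :=
  Submodule.span F {x | ∃ r s t, s ∈ S ∧ x = r * s * t}

variable {R R' : Type*} [Ring R] [Algebra F R] [Ring R'] [Algebra F R']

theorem subset_idealSpan (S : Set R) {s : R} (hs : s ∈ S) : s ∈ idealSpan F S :=
  Submodule.subset_span ⟨1, s, 1, hs, by simp⟩

theorem mul_mem_idealSpan (S : Set R) (x y : R) {z : R} (hz : z ∈ idealSpan F S) :
    x * z * y ∈ idealSpan F S := by
  induction hz using Submodule.span_induction with
  | mem z hz =>
    obtain ⟨r, s, t, hs, rfl⟩ := hz
    exact Submodule.subset_span ⟨x * r, s, t * y, hs, by simp only [mul_assoc]⟩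
  | zero => simp
  | add a b _ _ ha hb => rw [mul_add, add_mul]; exact add_mem ha hb
  | smul c a _ ha => rw [mul_smul_comm, smul_mul_assoc]; exact Submodule.smul_mem _ c ha

theorem map_mem_idealSpan (φ : R ≃ₐ[F] R') {S : Set R} {S' : Set R'} (h : ∀ s ∈ S, φ s ∈ S')
    {x : R} (hx : x ∈ idealSpan F S) : φ x ∈ idealSpan F S' := by
  induction hx using Submodule.span_induction with
  | mem z hz =>
    obtain ⟨r, s, t, hs, rfl⟩ := hz
    exact Submodule.subset_span ⟨φ r, φ s, φ t, h s hs, by simp only [map_mul]⟩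
  | zero => simp
  | add a b _ _ ha hb => rw [map_add]; exact add_mem ha hb
  | smul c a _ ha => rw [map_smul]; exact Submodule.smul_mem _ c ha

theorem finrank_idealSpan_eq (φ : R ≃ₐ[F] R') {S : Set R} {S' : Set R'} (h : ∀ s ∈ S, φ s ∈ S')
    (h' : ∀ s ∈ S', φ.symm s ∈ S) :
    Module.finrank F (idealSpan F S) = Module.finrank F (idealSpan F S') :=
  finrank_eq_of_linearEquiv φ.toLinearEquiv (fun _ hx => map_mem_idealSpan φ h hx)
    (fun _ hx => map_mem_idealSpan φ.symm h' hx)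

variable (R) in
/-- The set of additive commutators. -/
def addCommutators : Set R := {x | ∃ a b : R, x = a * b - b * a}

variable (R) in
/-- The squares of the nilpotent elements. -/
def nilpotentSquares : Set R := {x | ∃ a : R, IsNilpotent a ∧ x = a ^ 2}

variable (R) in
/-- The nilpotent central elements. -/
def centralNilpotents : Set R := {x | (∀ r, r * x = x * r) ∧ IsNilpotent x}

variable (R) in
/-- The central elements with square zero. -/
def centralSquareZero : Set R := {x | (∀ r, r * x = x * r) ∧ x * x = 0}

theorem central_map (φ : R ≃ₐ[F] R') {x : R} (hx : ∀ r, r * x = x * r) (r : R') :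
    r * φ x = φ x * r := by
  have h := congrArg φ (hx (φ.symm r))
  simpa using h

theorem addCommutators_map (φ : R ≃ₐ[F] R') {s : R} (hs : s ∈ addCommutators R) :
    φ s ∈ addCommutators R' := by
  obtain ⟨a, b, rfl⟩ := hs
  exact ⟨φ a, φ b, by simp⟩

theorem nilpotentSquares_map (φ : R ≃ₐ[F] R') {s : R} (hs : s ∈ nilpotentSquares R) :
    φ s ∈ nilpotentSquares R' := by
  obtain ⟨a, ha, rfl⟩ := hs
  exact ⟨φ a, ha.map φ, by simp⟩

theorem centralNilpotents_map (φ : R ≃ₐ[F] R') {s : R} (hs : s ∈ centralNilpotents R) :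
    φ s ∈ centralNilpotents R' :=
  ⟨central_map φ hs.1, hs.2.map φ⟩

theorem centralSquareZero_map (φ : R ≃ₐ[F] R') {s : R} (hs : s ∈ centralSquareZero R) :
    φ s ∈ centralSquareZero R' :=
  ⟨central_map φ hs.1, by rw [← map_mul, hs.2, map_zero]⟩

end Transport

/-! ### Coefficients and central elements of the group algebra -/

namespace MonoidAlgebra

variable {F G : Type*} [Field F] [Group G]

/-- The coefficients of an element of the group algebra of a finite group. -/
noncomputable def coeffFun (F G : Type*) [Field F] [Group G] [Finite G] :
    MonoidAlgebra F G ≃ₗ[F] (G → F) where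
  toFun x := x.coeff
  invFun f := ofCoeff (Finsupp.equivFunOnFinite.symm f)
  map_add' x y := by ext; simp
  map_smul' c x := by ext; simp
  left_inv x := by ext; simp
  right_inv f := by ext; simp

@[simp]
theorem coeff_coeffFun_symm [Finite G] (f : G → F) (g : G) :
    ((coeffFun F G).symm f).coeff g = f g :=
  congrFun ((coeffFun F G).apply_symm_apply f) g

instance finiteDimensional_of_finite [Finite G] : FiniteDimensional F (MonoidAlgebra F G) :=
  Module.Finite.equiv (coeffFun F G).symm

theorem finrank_eq_card [Finite G] : Module.finrank F (MonoidAlgebra F G) = Nat.card G := by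
  have := Fintype.ofFinite G
  rw [(coeffFun F G).finrank_eq, Module.finrank_fintype_fun_eq_card, Nat.card_eq_fintype_card]

theorem sum_single_coeff {X : Type*} [Fintype X] (x : MonoidAlgebra F X) :
    ∑ g, single g (x.coeff g) = x := by
  ext h
  classical
  rw [coeff_sum, Finset.sum_apply']
  simp [Finsupp.single_apply]

theorem coeff_conj {x : MonoidAlgebra F G} (hx : ∀ r, r * x = x * r) (g h : G) :
    x.coeff (g * h * g⁻¹) = x.coeff h := by
  have h1 := congrArg (fun y => y.coeff (g * h)) (hx (single g 1))
  simpa using h1.symm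

theorem central_of_coeff_conj [Finite G] {x : MonoidAlgebra F G}
    (hx : ∀ g h, x.coeff (g * h * g⁻¹) = x.coeff h) (r : MonoidAlgebra F G) : r * x = x * r := by
  induction r using induction_linear with
  | zero => simp
  | add a b ha hb => rw [add_mul, mul_add, ha, hb]
  | single g c =>
    ext h
    have h1 := hx g (g⁻¹ * h)
    simp only [coeff_single_mul_apply, coeff_mul_single_apply]
    rw [← h1, mul_comm]
    congr 2
    group

theorem mul_coeff [Fintype G] (x y : MonoidAlgebra F G) (g : G) :
    (x * y).coeff g = ∑ h, x.coeff h * y.coeff (h⁻¹ * g) := by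
  rw [coeff_mul_apply_left]
  exact Finsupp.sum_fintype _ _ (by simp)

/-- The square of a central element, evaluated at a central group element. -/
theorem sq_coeff_of_central [CharP F 2] [Fintype G] [DecidableEq G]
    [DecidablePred (· ∈ Subgroup.center G)] (hG : IsPGroup 2 G) {x : MonoidAlgebra F G}
    (hx : ∀ r, r * x = x * r) {w : G} (hw : w ∈ Subgroup.center G) :
    (x * x).coeff w = (∑ z with z ∈ Subgroup.center G ∧ z ^ 2 = w, x.coeff z) ^ 2 := by
  have h2 : ∀ m : F, m + m = 0 := CharTwo.add_self_eq_zero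
  rw [mul_coeff, sum_eq_sum_center hG h2]
  swap
  · intro g h
    have h1 : (g * h * g⁻¹)⁻¹ * w = g * (h⁻¹ * w) * g⁻¹ := by
      rw [← mul_assoc g, mul_assoc _ w, ← central_comm hw]; group
    rw [h1, coeff_conj hx, coeff_conj hx]
  rw [CharTwo.sum_sq, ← Finset.filter_filter,
    ← Finset.sum_filter_add_sum_filter_not _ (fun z => z ^ 2 = w)]
  have hcomm : ∀ z : G, z⁻¹ * w = w * z⁻¹ := fun z => central_comm hw _
  -- The terms of z and z⁻¹w cancel in characteristic two; only the fixed points z² = w survive.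
  rw [Finset.sum_involution (s := Finset.filter (fun z => ¬ z ^ 2 = w) _) (fun z _ => z⁻¹ * w),
    add_zero]
  · refine Finset.sum_congr rfl fun z hz => ?_
    have h3 := (Finset.mem_filter.1 hz).2
    rw [← h3, pow_two, inv_mul_cancel_left, pow_two]
  · intro z _
    rw [hcomm, mul_inv_rev, inv_inv, mul_assoc, inv_mul_cancel, mul_one, mul_comm (x.coeff (w * _)),
      h2]
  · intro z hz _ heq
    apply (Finset.mem_filter.1 hz).2
    rw [pow_two]
    exact (inv_mul_eq_iff_eq_mul.1 heq).symm
  · intro z hz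
    simp only [Finset.mem_filter, Finset.mem_univ, true_and] at hz ⊢
    refine ⟨mul_mem (inv_mem hz.1) hw, fun heq => hz.2 ?_⟩
    have h3 : Commute z⁻¹ w := hcomm z
    rw [h3.mul_pow, inv_pow, pow_two w, ← mul_assoc, mul_eq_right, inv_mul_eq_one] at heq
    exact heq
  · intro z _
    rw [mul_inv_rev, inv_inv, mul_assoc, central_comm hw z, inv_mul_cancel_left]

end MonoidAlgebra

/-! ### Ideals that are kernels of maps to quotient group algebras -/

namespace MonoidAlgebra

variable {F G Q : Type*} [Field F] [Group G]

theorem single_sub_one_mul_mem (S : Set (MonoidAlgebra F G)) (x y : G)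
    (hx : (single x 1 - 1 : MonoidAlgebra F G) ∈ idealSpan F S)
    (hy : (single y 1 - 1 : MonoidAlgebra F G) ∈ idealSpan F S) :
    (single (x * y) 1 - 1 : MonoidAlgebra F G) ∈ idealSpan F S := by
  have h : (single (x * y) 1 - 1 : MonoidAlgebra F G) =
      single x 1 * (single y 1 - 1) * 1 + (single x 1 - 1) := by
    rw [mul_one, mul_sub, single_mul_single, mul_one, mul_one]; abel
  rw [h]
  exact add_mem (mul_mem_idealSpan S _ _ hy) hx

/-- The subgroup of the elements congruent to `1` modulo a two-sided ideal. -/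
def congruenceSubgroup (S : Set (MonoidAlgebra F G)) : Subgroup G where
  carrier := {x | (single x 1 - 1 : MonoidAlgebra F G) ∈ idealSpan F S}
  one_mem' := by
    change (single 1 1 - 1 : MonoidAlgebra F G) ∈ idealSpan F S
    rw [← one_def, sub_self]; exact zero_mem _
  mul_mem' {x y} hx hy := single_sub_one_mul_mem S x y hx hy
  inv_mem' {x} hx := by
    have h : (single x⁻¹ 1 - 1 : MonoidAlgebra F G) =
        -(single x⁻¹ 1 * (single x 1 - 1) * 1) := by
      rw [mul_one, mul_sub, single_mul_single, mul_one, mul_one, inv_mul_cancel, one_def]; abel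
    change (single x⁻¹ 1 - 1 : MonoidAlgebra F G) ∈ idealSpan F S
    rw [h]
    exact neg_mem (mul_mem_idealSpan S _ _ hx)

theorem mem_congruenceSubgroup {S : Set (MonoidAlgebra F G)} {x : G} :
    x ∈ congruenceSubgroup S ↔ (single x 1 - 1 : MonoidAlgebra F G) ∈ idealSpan F S := Iff.rfl

/-- In the group algebra, xyx⁻¹y⁻¹ − 1 = (xy − yx)x⁻¹y⁻¹. -/
theorem commutator_le_congruenceSubgroup {S : Set (MonoidAlgebra F G)}
    (hS : addCommutators (MonoidAlgebra F G) ⊆ S) : commutator G ≤ congruenceSubgroup S := by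
  rw [commutator_def, Subgroup.commutator_le]
  intro x _ y _
  rw [mem_congruenceSubgroup]
  have h : (single (x * y * x⁻¹ * y⁻¹) 1 - 1 : MonoidAlgebra F G) =
      1 * (single x 1 * single y 1 - single y 1 * single x 1) * single (x⁻¹ * y⁻¹) 1 := by
    rw [one_mul, sub_mul]
    simp only [single_mul_single, mul_one]
    rw [one_def, ← mul_assoc, ← mul_assoc, mul_inv_cancel_right, mul_inv_cancel]
  change (single (x * y * x⁻¹ * y⁻¹) 1 - 1 : MonoidAlgebra F G) ∈ idealSpan F S
  rw [h]
  exact Submodule.subset_span ⟨_, _, _, hS ⟨_, _, rfl⟩, rfl⟩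

theorem isNilpotent_single_sub_one [CharP F 2] [Finite G] (hG : IsPGroup 2 G) (g : G) :
    IsNilpotent (single g 1 - 1 : MonoidAlgebra F G) := by
  obtain ⟨k, hk⟩ := hG g
  have : CharP (MonoidAlgebra F G) 2 :=
    charP_of_injective_algebraMap (algebraMap F (MonoidAlgebra F G)).injective 2
  refine ⟨2 ^ k, ?_⟩
  rw [sub_pow_char_pow_of_commute 2 k (Commute.one_right _), single_pow, hk, one_pow, one_pow,
    one_def, sub_self]

theorem squareSubgroup_le_congruenceSubgroup [CharP F 2] [Finite G] (hG : IsPGroup 2 G)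
    {S : Set (MonoidAlgebra F G)} (hS : nilpotentSquares (MonoidAlgebra F G) ⊆ S) :
    squareSubgroup G ≤ congruenceSubgroup S := by
  rw [squareSubgroup, Subgroup.closure_le]
  rintro _ ⟨g, rfl⟩
  have : CharP (MonoidAlgebra F G) 2 :=
    charP_of_injective_algebraMap (algebraMap F (MonoidAlgebra F G)).injective 2
  have h : (single (g ^ 2) 1 - 1 : MonoidAlgebra F G) = (single g 1 - 1) ^ 2 := by
    have h1 := sub_pow_char_pow_of_commute 2 1
      (Commute.one_right (single g 1 : MonoidAlgebra F G))
    rw [pow_one] at h1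
    rw [h1, single_pow, one_pow, one_pow]
  change (single (g ^ 2) 1 - 1 : MonoidAlgebra F G) ∈ idealSpan F S
  rw [h]
  exact subset_idealSpan S (hS ⟨_, isNilpotent_single_sub_one hG g, rfl⟩)

variable [Group Q]

theorem mapDomain_mem_span (S : Set (MonoidAlgebra F G)) (f : G →* Q) (r : Q → G)
    (hr : ∀ g, f (r (f g)) = f g) (hf : f.ker ≤ congruenceSubgroup S) (x : MonoidAlgebra F G) :
    x - mapDomain r (mapDomain f x) ∈ idealSpan F S := by
  induction x using induction_linear with
  | zero => simp
  | add a b ha hb =>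
    rw [mapDomain_add, mapDomain_add, add_sub_add_comm]
    exact add_mem ha hb
  | single g c =>
    rw [mapDomain_single, mapDomain_single]
    have hk : (r (f g))⁻¹ * g ∈ f.ker := by
      rw [MonoidHom.mem_ker, map_mul, map_inv, hr, inv_mul_cancel]
    have h : (single g c - single (r (f g)) c : MonoidAlgebra F G) =
        single (r (f g)) c * (single ((r (f g))⁻¹ * g) 1 - 1) * 1 := by
      rw [mul_one, mul_sub, single_mul_single, mul_one, mul_one, mul_inv_cancel_left]
    rw [h]
    exact mul_mem_idealSpan S _ _ (mem_congruenceSubgroup.1 (hf hk))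

/-- The ideal generated by S is the kernel of FG → FQ: it dies in FQ, and modulo it every group
element is congruent to its chosen representative. If S is defined from the algebra alone, |Q|
becomes an invariant of FG. -/
theorem finrank_idealSpan_add_card [Finite G] (S : Set (MonoidAlgebra F G)) (f : G →* Q)
    (hsurj : Function.Surjective f) (hf : f.ker ≤ congruenceSubgroup S)
    (hS : ∀ s ∈ S, mapDomain f s = 0) :
    Nat.card Q + Module.finrank F (idealSpan F S) = Nat.card G := by
  have : Finite Q := Finite.of_surjective f hsurj
  set π := (mapDomainAlgHom F F f).toLinearMap with hπ
  have hπa : ∀ x, π x = mapDomain f x := fun x => rfl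
  have hker : LinearMap.ker π = idealSpan F S := by
    apply le_antisymm
    · intro x hx
      have h := mapDomain_mem_span S f (Function.surjInv hsurj)
        (fun g => Function.surjInv_eq hsurj _) hf x
      rw [LinearMap.mem_ker, hπa] at hx
      rwa [hx, mapDomain_zero, sub_zero] at h
    · rw [idealSpan, Submodule.span_le]
      rintro _ ⟨r, s, t, hs, rfl⟩
      rw [SetLike.mem_coe, LinearMap.mem_ker, hπa, mapDomain_mul, mapDomain_mul, hS s hs, mul_zero,
        zero_mul]
  have hrange : LinearMap.range π = ⊤ := by
    rw [LinearMap.range_eq_top]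
    intro y
    refine ⟨mapDomain (Function.surjInv hsurj) y, ?_⟩
    rw [hπa]
    induction y using induction_linear with
    | zero => simp
    | add a b ha hb => rw [mapDomain_add, mapDomain_add, ha, hb]
    | single q c => rw [mapDomain_single, mapDomain_single, Function.surjInv_eq hsurj]
  have h := LinearMap.finrank_range_add_finrank_ker π
  rw [hker, hrange, finrank_top, finrank_eq_card, finrank_eq_card] at h
  exact h

end MonoidAlgebra

namespace MonoidAlgebra

variable {F G Q : Type*} [Field F] [Group G] [CommGroup Q]

theorem mapDomain_addCommutators (f : G →* Q) {s : MonoidAlgebra F G}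
    (hs : s ∈ addCommutators (MonoidAlgebra F G)) : mapDomain f s = 0 := by
  obtain ⟨a, b, rfl⟩ := hs
  change mapDomainAlgHom F F f _ = 0
  rw [map_sub, map_mul, map_mul, mul_comm, sub_self]

/-- Frobenius sends every element of Q to 1, so it factors through the augmentation. Squares of
nilpotent elements therefore vanish. -/
theorem sq_eq_of_sq_eq_one [CharP F 2] (hQ : ∀ q : Q, q ^ 2 = 1) (x : MonoidAlgebra F Q) :
    x ^ 2 = algebraMap F _ ((lift F F Q 1 x) ^ 2) := by
  have : CharP (MonoidAlgebra F Q) 2 :=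
    charP_of_injective_algebraMap (algebraMap F (MonoidAlgebra F Q)).injective 2
  have h : frobenius (MonoidAlgebra F Q) 2 = ((algebraMap F (MonoidAlgebra F Q)).comp
      (frobenius F 2)).comp (lift F F Q 1 : MonoidAlgebra F Q →ₐ[F] F).toRingHom := by
    apply ringHom_ext
    · intro r
      simp [frobenius_def, single_pow]
    · intro q
      simp [frobenius_def, single_pow, hQ]
  exact RingHom.congr_fun h x

theorem mapDomain_nilpotentSquares [CharP F 2] (hQ : ∀ q : Q, q ^ 2 = 1) (f : G →* Q)
    {s : MonoidAlgebra F G} (hs : s ∈ nilpotentSquares (MonoidAlgebra F G)) :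
    mapDomain f s = 0 := by
  obtain ⟨a, ha, rfl⟩ := hs
  change mapDomainAlgHom F F f _ = 0
  rw [map_pow, sq_eq_of_sq_eq_one hQ,
    ((ha.map (mapDomainAlgHom F F f)).map (lift F F Q 1)).eq_zero]
  simp

theorem mapDomain_eq_sum_center [CharP F 2] [Fintype G] [DecidablePred (· ∈ Subgroup.center G)]
    (hG : IsPGroup 2 G) (f : G →* Q) {x : MonoidAlgebra F G} (hx : ∀ r, r * x = x * r) :
    mapDomain f x = ∑ z with z ∈ Subgroup.center G, single (f z) (x.coeff z) := by
  have h1 : mapDomain f x = ∑ g, single (f g) (x.coeff g) := by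
    conv_lhs => rw [← sum_single_coeff x]
    change mapDomainAlgHom F F f _ = _
    rw [map_sum]
    simp
  rw [h1]
  refine sum_eq_sum_center hG (fun m => ?_) _ fun g h => ?_
  · have : CharP (MonoidAlgebra F Q) 2 :=
      charP_of_injective_algebraMap (algebraMap F (MonoidAlgebra F Q)).injective 2
    exact CharTwo.add_self_eq_zero m
  · rw [coeff_conj hx, map_mul, map_mul, map_inv, mul_comm (f g), mul_inv_cancel_right]

/-- Noncentral elements contribute nothing to the image, and central ones map to 1. So the image is
a scalar, and a nilpotent scalar is zero. -/
theorem mapDomain_centralNilpotents [CharP F 2] [Finite G] (hG : IsPGroup 2 G) (f : G →* Q)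
    (hf : Subgroup.center G ≤ f.ker) {s : MonoidAlgebra F G}
    (hs : s ∈ centralNilpotents (MonoidAlgebra F G)) : mapDomain f s = 0 := by
  classical
  have := Fintype.ofFinite G
  have h1 := mapDomain_eq_sum_center hG f hs.1
  have h2 : mapDomain f s = algebraMap F _ (∑ z with z ∈ Subgroup.center G, s.coeff z) := by
    rw [h1, map_sum]
    refine Finset.sum_congr rfl fun z hz => ?_
    rw [MonoidHom.mem_ker.1 (hf (Finset.mem_filter.1 hz).2)]
    rfl
  have h3 : IsNilpotent (mapDomain f s) := hs.2.map (mapDomainAlgHom F F f)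
  rw [h2] at h3 ⊢
  have h4 := (h3.map (lift F F Q 1)).eq_zero
  rw [AlgHom.commutes] at h4
  have h5 : (∑ z with z ∈ Subgroup.center G, s.coeff z) = 0 := h4
  rw [h5, map_zero]

/-- The coefficient of s² at a central w is the square of the sum of coefficients of s over the
central square roots of w. These sums vanish, and f is constant on each such set of roots. -/
theorem mapDomain_centralSquareZero [CharP F 2] [Finite G] (hG : IsPGroup 2 G) (f : G →* Q)
    (hf : ∀ z ∈ Subgroup.center G, z ^ 2 = 1 → f z = 1) {s : MonoidAlgebra F G}
    (hs : s ∈ centralSquareZero (MonoidAlgebra F G)) : mapDomain f s = 0 := by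
  classical
  have := Fintype.ofFinite G
  rw [mapDomain_eq_sum_center hG f hs.1, ← Finset.sum_fiberwise _ (fun z => z ^ 2)]
  refine Finset.sum_eq_zero fun w _ => ?_
  rw [Finset.filter_filter]
  by_cases hw : ∃ z ∈ Subgroup.center G, z ^ 2 = w
  · obtain ⟨z₀, hz₀, rfl⟩ := hw
    have h1 := sq_coeff_of_central hG hs.1 (pow_mem hz₀ 2)
    rw [hs.2] at h1
    have h2 : (∑ z with z ∈ Subgroup.center G ∧ z ^ 2 = z₀ ^ 2, s.coeff z) = 0 := by
      simpa using h1.symm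
    have h3 : ∑ z with z ∈ Subgroup.center G ∧ z ^ 2 = z₀ ^ 2, single (f z) (s.coeff z) =
        single (f z₀) (∑ z with z ∈ Subgroup.center G ∧ z ^ 2 = z₀ ^ 2, s.coeff z) := by
      change _ = lsingle (R := F) (f z₀) _
      rw [map_sum]
      refine Finset.sum_congr rfl fun z hz => ?_
      obtain ⟨hz1, hz2⟩ := (Finset.mem_filter.1 hz).2
      have h4 : f (z₀⁻¹ * z) = 1 := by
        refine hf _ (mul_mem (inv_mem hz₀) hz1) ?_
        have h5 : Commute z₀⁻¹ z := central_comm hz1 _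
        rw [h5.mul_pow, hz2, inv_pow, inv_mul_cancel]
      rw [map_mul, map_inv, inv_mul_eq_one] at h4
      rw [h4]; rfl
    rw [h3, h2, single_zero]
  · rw [Finset.filter_false_of_mem, Finset.sum_empty]
    rintro z - ⟨hz1, hz2⟩
    exact hw ⟨z, hz1, hz2⟩

end MonoidAlgebra

/-! ### Three indices as codimensions of ideals -/

/-- The subgroup of central elements with square one. -/
def centralInvolutions (G : Type*) [Group G] : Subgroup G where
  carrier := {x | x ∈ Subgroup.center G ∧ x ^ 2 = 1}
  one_mem' := ⟨one_mem _, one_pow 2⟩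
  mul_mem' {x y} hx hy := ⟨mul_mem hx.1 hy.1, by
    rw [(show Commute x y from central_comm hy.1 x).mul_pow, hx.2, hy.2, one_mul]⟩
  inv_mem' {x} hx := ⟨inv_mem hx.1, by rw [inv_pow, hx.2, inv_one]⟩

instance centralInvolutions_normal {G : Type*} [Group G] : (centralInvolutions G).Normal :=
  ⟨fun n hn g => by rw [central_comm hn.1 g, mul_inv_cancel_right]; exact hn⟩

namespace MonoidAlgebra

variable {F G : Type*} [Field F] [CharP F 2] [Group G] [Finite G]

/-- The quotient by a normal subgroup containing the commutator subgroup is commutative. -/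
abbrev quotientCommGroup (N : Subgroup G) [N.Normal] (h : commutator G ≤ N) : CommGroup (G ⧸ N) :=
  { (inferInstance : Group (G ⧸ N)) with
    mul_comm := fun x y => by
      induction x using QuotientGroup.induction_on with
      | H x =>
      induction y using QuotientGroup.induction_on with
      | H y =>
      change ((x * y : G) : G ⧸ N) = ((y * x : G) : G ⧸ N)
      rw [QuotientGroup.eq]
      apply h
      have h1 : (x * y)⁻¹ * (y * x) = y⁻¹ * x⁻¹ * y⁻¹⁻¹ * x⁻¹⁻¹ := by group
      rw [h1]
      exact Subgroup.commutator_mem_commutator (Subgroup.mem_top _) (Subgroup.mem_top _) }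

/-- The generating set is intrinsic to the algebra, so the index is an invariant of FG. The next two
index formulas serve the same purpose. -/
theorem index_commutator_sup_center (hG : IsPGroup 2 G) :
    (commutator G ⊔ Subgroup.center G).index + Module.finrank F
      (idealSpan F (addCommutators (MonoidAlgebra F G) ∪ centralNilpotents _)) = Nat.card G := by
  set N := commutator G ⊔ Subgroup.center G with hN
  let _ := quotientCommGroup N le_sup_left
  refine finrank_idealSpan_add_card _ (QuotientGroup.mk' N) (QuotientGroup.mk'_surjective N) ?_ ?_
  · rw [QuotientGroup.ker_mk']
    refine sup_le (commutator_le_congruenceSubgroup Set.subset_union_left) fun z hz => ?_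
    exact subset_idealSpan _ (Or.inr ⟨fun r => by
      have h1 := single_commute (r := (1 : F)) (fun g => (central_comm hz g).symm)
        (fun c => Commute.one_left c) r
      exact (h1.sub_left (Commute.one_left r)).symm, isNilpotent_single_sub_one hG z⟩)
  · rintro s (hs | hs)
    · exact mapDomain_addCommutators (QuotientGroup.mk' N) hs
    · refine mapDomain_centralNilpotents hG (QuotientGroup.mk' N) ?_ hs
      rw [QuotientGroup.ker_mk']
      exact le_sup_right

omit [Finite G] in
theorem quotient_sq_eq_one (N : Subgroup G) [N.Normal] (h : squareSubgroup G ≤ N) (q : G ⧸ N) :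
    q ^ 2 = 1 := by
  induction q using QuotientGroup.induction_on with
  | H x => exact (QuotientGroup.eq_one_iff _).2 (h (sq_mem_squareSubgroup x))

theorem index_squareSubgroup (hG : IsPGroup 2 G) :
    (squareSubgroup G).index + Module.finrank F
      (idealSpan F (addCommutators (MonoidAlgebra F G) ∪ nilpotentSquares _)) = Nat.card G := by
  set N := squareSubgroup G with hN
  let _ := quotientCommGroup N commutator_le_squareSubgroup
  refine finrank_idealSpan_add_card _ (QuotientGroup.mk' N) (QuotientGroup.mk'_surjective N) ?_ ?_
  · rw [QuotientGroup.ker_mk']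
    exact squareSubgroup_le_congruenceSubgroup hG Set.subset_union_right
  · rintro s (hs | hs)
    · exact mapDomain_addCommutators (QuotientGroup.mk' N) hs
    · exact mapDomain_nilpotentSquares (quotient_sq_eq_one N le_rfl) (QuotientGroup.mk' N) hs

theorem index_squareSubgroup_sup_centralInvolutions (hG : IsPGroup 2 G) :
    (squareSubgroup G ⊔ centralInvolutions G).index + Module.finrank F
      (idealSpan F (addCommutators (MonoidAlgebra F G) ∪ nilpotentSquares _ ∪
        centralSquareZero _)) = Nat.card G := by
  set N := squareSubgroup G ⊔ centralInvolutions G with hN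
  let _ := quotientCommGroup N (commutator_le_squareSubgroup.trans le_sup_left)
  refine finrank_idealSpan_add_card _ (QuotientGroup.mk' N) (QuotientGroup.mk'_surjective N) ?_ ?_
  · rw [QuotientGroup.ker_mk']
    refine sup_le (squareSubgroup_le_congruenceSubgroup hG
      (Set.subset_union_right.trans Set.subset_union_left)) fun z hz => ?_
    refine subset_idealSpan _ (Or.inr ⟨fun r => ?_, ?_⟩)
    · have h1 := single_commute (r := (1 : F)) (fun g => (central_comm hz.1 g).symm)
        (fun c => Commute.one_left c) r
      exact (h1.sub_left (Commute.one_left r)).symm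
    · have : CharP (MonoidAlgebra F G) 2 :=
        charP_of_injective_algebraMap (algebraMap F (MonoidAlgebra F G)).injective 2
      have h1 := sub_pow_char_pow_of_commute 2 1
        (Commute.one_right (single z 1 : MonoidAlgebra F G))
      rw [pow_one] at h1
      rw [← pow_two, h1, single_pow, one_pow, one_pow, hz.2, one_def, sub_self]
  · rintro s ((hs | hs) | hs)
    · exact mapDomain_addCommutators (QuotientGroup.mk' N) hs
    · exact mapDomain_nilpotentSquares (quotient_sq_eq_one N le_sup_left) (QuotientGroup.mk' N) hs
    · refine mapDomain_centralSquareZero hG (QuotientGroup.mk' N) (fun z hz hz2 => ?_) hs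
      exact (QuotientGroup.eq_one_iff _).2 (Subgroup.mem_sup_right ⟨hz, hz2⟩)

end MonoidAlgebra

/-! ### The center of an algebra and its additive commutators -/

section CenterInvariants

theorem finrank_add_finrank_of_surjOn {F V W : Type*} [Field F] [AddCommGroup V] [Module F V]
    [AddCommGroup W] [Module F W] [FiniteDimensional F V] (K D : Submodule F V) (hD : D ≤ K)
    (ρ : V →ₗ[F] W) (hker : ∀ x ∈ K, x ∈ D ↔ ρ x = 0) (hsurj : ∀ w, ∃ x ∈ K, ρ x = w) :
    Module.finrank F W + Module.finrank F D = Module.finrank F K := by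
  have h := LinearMap.finrank_range_add_finrank_ker (ρ.comp K.subtype)
  have h1 : LinearMap.range (ρ.comp K.subtype) = ⊤ := by
    rw [LinearMap.range_eq_top]
    intro w
    obtain ⟨x, hx, rfl⟩ := hsurj w
    exact ⟨⟨x, hx⟩, rfl⟩
  have h2 : LinearMap.ker (ρ.comp K.subtype) = D.comap K.subtype := by
    ext x
    exact (hker x x.2).symm
  rw [h1, h2, finrank_top, (Submodule.comapSubtypeEquivOfLe hD).finrank_eq] at h
  exact h

variable (F : Type*) [Field F]

/-- The center of an algebra, as a linear subspace. -/
def centerSubspace (R : Type*) [Ring R] [Algebra F R] : Submodule F R where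
  carrier := {x | ∀ r, r * x = x * r}
  zero_mem' r := by rw [mul_zero, zero_mul]
  add_mem' {x y} hx hy r := by rw [mul_add, add_mul, hx, hy]
  smul_mem' c x hx r := by rw [mul_smul_comm, smul_mul_assoc, hx]

/-- The linear span of the additive commutators of an algebra. -/
def commutatorSpan (R : Type*) [Ring R] [Algebra F R] : Submodule F R :=
  Submodule.span F (addCommutators R)

theorem add_self_eq_zero_of_charTwo [CharP F 2] {M : Type*} [AddCommGroup M] [Module F M] (m : M) :
    m + m = 0 := by
  rw [← two_smul F m, CharTwo.two_eq_zero, zero_smul]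

/-- The central elements whose square lies in the span of the additive commutators. -/
def centralSquareCommutator [CharP F 2] (R : Type*) [Ring R] [Algebra F R] : Submodule F R where
  carrier := {x | (∀ r, r * x = x * r) ∧ x * x ∈ commutatorSpan F R}
  zero_mem' := ⟨fun r => by rw [mul_zero, zero_mul], by rw [mul_zero]; exact zero_mem _⟩
  add_mem' {x y} hx hy := by
    refine ⟨fun r => by rw [mul_add, add_mul, hx.1, hy.1], ?_⟩
    have h : (x + y) * (x + y) = x * x + y * y := by
      have h1 := add_self_eq_zero_of_charTwo F (y * x)
      rw [add_mul, mul_add, mul_add, hy.1 x,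
        show x * x + y * x + (y * x + y * y) = x * x + y * y + (y * x + y * x) by abel, h1,
        add_zero]
    rw [h]
    exact add_mem hx.2 hy.2
  smul_mem' c x hx := by
    refine ⟨fun r => by rw [mul_smul_comm, smul_mul_assoc, hx.1], ?_⟩
    rw [smul_mul_smul_comm]
    exact Submodule.smul_mem _ _ hx.2

variable {F} {R R' : Type*} [Ring R] [Algebra F R] [Ring R'] [Algebra F R']

theorem commutatorSpan_map (φ : R ≃ₐ[F] R') {x : R} (hx : x ∈ commutatorSpan F R) :
    φ x ∈ commutatorSpan F R' := by
  induction hx using Submodule.span_induction with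
  | mem z hz => exact Submodule.subset_span (addCommutators_map φ hz)
  | zero => simp
  | add a b _ _ ha hb => rw [map_add]; exact add_mem ha hb
  | smul c a _ ha => rw [map_smul]; exact Submodule.smul_mem _ c ha

theorem finrank_centerSubspace_eq (φ : R ≃ₐ[F] R') :
    Module.finrank F (centerSubspace F R) = Module.finrank F (centerSubspace F R') :=
  finrank_eq_of_linearEquiv φ.toLinearEquiv (fun _ hx => central_map φ hx)
    (fun _ hx => central_map φ.symm hx)

theorem finrank_center_inf_commutatorSpan_eq (φ : R ≃ₐ[F] R') :
    Module.finrank F (centerSubspace F R ⊓ commutatorSpan F R : Submodule F R) =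
      Module.finrank F (centerSubspace F R' ⊓ commutatorSpan F R' : Submodule F R') :=
  finrank_eq_of_linearEquiv φ.toLinearEquiv
    (fun _ hx => Submodule.mem_inf.2 ⟨central_map φ hx.1, commutatorSpan_map φ hx.2⟩)
    (fun _ hx => Submodule.mem_inf.2 ⟨central_map φ.symm hx.1, commutatorSpan_map φ.symm hx.2⟩)

theorem finrank_centralSquareCommutator_eq [CharP F 2] (φ : R ≃ₐ[F] R') :
    Module.finrank F (centralSquareCommutator F R) =
      Module.finrank F (centralSquareCommutator F R') :=
  finrank_eq_of_linearEquiv φ.toLinearEquiv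
    (fun x hx => ⟨central_map φ hx.1, by
      have h := commutatorSpan_map φ hx.2
      rwa [map_mul] at h⟩)
    (fun x hx => ⟨central_map φ.symm hx.1, by
      have h := commutatorSpan_map φ.symm hx.2
      rwa [map_mul] at h⟩)

end CenterInvariants

/-! ### Orders of the center and of its squares from the group algebra -/

namespace MonoidAlgebra

variable {F G : Type*} [Field F] [Group G] [Finite G]

theorem coeff_eq_zero_of_mem_commutatorSpan {x : MonoidAlgebra F G}
    (hx : x ∈ commutatorSpan F (MonoidAlgebra F G)) {w : G} (hw : w ∈ Subgroup.center G) :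
    x.coeff w = 0 := by
  have := Fintype.ofFinite G
  induction hx using Submodule.span_induction with
  | mem z hz =>
    obtain ⟨a, b, rfl⟩ := hz
    rw [coeff_sub, Finsupp.sub_apply, sub_eq_zero, mul_coeff, mul_coeff]
    refine Fintype.sum_equiv ((Equiv.inv G).trans (Equiv.mulRight w)) _ _ fun h => ?_
    simp only [Equiv.trans_apply, Equiv.inv_apply, Equiv.coe_mulRight]
    rw [mul_comm, mul_inv_rev, inv_inv, mul_assoc, central_comm hw h, inv_mul_cancel_left]
  | zero => simp
  | add a b _ _ ha hb => rw [coeff_add, Finsupp.add_apply, ha, hb, add_zero]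
  | smul c a _ ha => rw [coeff_smul_apply, ha, smul_zero]

/-- Modulo additive commutators conjugate group elements coincide, so x becomes the sum of a class
function, which is supported on the center of the group. -/
theorem mem_commutatorSpan_of_central [CharP F 2] (hG : IsPGroup 2 G) {x : MonoidAlgebra F G}
    (hx : ∀ r, r * x = x * r) (h0 : ∀ w ∈ Subgroup.center G, x.coeff w = 0) :
    x ∈ commutatorSpan F (MonoidAlgebra F G) := by
  classical
  have := Fintype.ofFinite G
  rw [← Submodule.Quotient.mk_eq_zero]
  change (commutatorSpan F (MonoidAlgebra F G)).mkQ x = 0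
  rw [← sum_single_coeff x, map_sum, sum_eq_sum_center hG (add_self_eq_zero_of_charTwo F)]
  · refine Finset.sum_eq_zero fun w hw => ?_
    rw [h0 w (Finset.mem_filter.1 hw).2, single_zero, map_zero]
  · intro g h
    rw [coeff_conj hx, ← sub_eq_zero, ← map_sub, Submodule.mkQ_apply,
      Submodule.Quotient.mk_eq_zero]
    refine Submodule.subset_span ⟨single g (x.coeff h), single (h * g⁻¹) 1, ?_⟩
    rw [single_mul_single, single_mul_single, mul_one, one_mul, inv_mul_cancel_right, mul_assoc]

/-- Restricting coefficients to the center of the group is surjective on central elements, and its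
kernel there consists of the elements in the commutator span. -/
theorem finrank_center_inf_commutatorSpan [CharP F 2] (hG : IsPGroup 2 G) :
    Nat.card (Subgroup.center G) + Module.finrank F (centerSubspace F (MonoidAlgebra F G) ⊓
      commutatorSpan F (MonoidAlgebra F G) : Submodule F (MonoidAlgebra F G)) =
      Module.finrank F (centerSubspace F (MonoidAlgebra F G)) := by
  classical
  have := Fintype.ofFinite (Subgroup.center G)
  have h := finrank_add_finrank_of_surjOn (W := Subgroup.center G → F)
    (centerSubspace F (MonoidAlgebra F G))
    (centerSubspace F (MonoidAlgebra F G) ⊓ commutatorSpan F (MonoidAlgebra F G)) inf_le_left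
    ((LinearMap.funLeft F F (Subtype.val : Subgroup.center G → G)).comp
      (coeffFun F G).toLinearMap) ?_ ?_
  · rwa [Module.finrank_fintype_fun_eq_card, ← Nat.card_eq_fintype_card] at h
  · intro x hx
    constructor
    · intro hx'
      ext w
      exact coeff_eq_zero_of_mem_commutatorSpan hx'.2 w.2
    · intro hx'
      refine Submodule.mem_inf.2 ⟨hx, mem_commutatorSpan_of_central hG hx fun w hw => ?_⟩
      exact congrFun hx' ⟨w, hw⟩
  · intro w
    refine ⟨(coeffFun F G).symm (fun g => if hg : g ∈ Subgroup.center G then w ⟨g, hg⟩ else 0),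
      ?_, ?_⟩
    · refine central_of_coeff_conj fun g h => ?_
      simp only [coeff_coeffFun_symm]
      by_cases hh : h ∈ Subgroup.center G
      · rw [central_comm hh g, mul_inv_cancel_right]
      · rw [dif_neg hh, dif_neg]
        intro h1
        apply hh
        have h2 := (inferInstance : (Subgroup.center G).Normal).conj_mem _ h1 g⁻¹
        convert h2 using 1
        group
    · ext u
      simp [LinearMap.funLeft_apply]

/-- The squaring homomorphism of the center. -/
def centerSquareHom (G : Type*) [Group G] : Subgroup.center G →* Subgroup.center G where
  toFun x := x ^ 2
  map_one' := one_pow 2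
  map_mul' x y := (show Commute x y from Subtype.ext (central_comm y.2 x)).mul_pow 2

/-- The subgroup of squares of central elements. -/
abbrev centerSquares (G : Type*) [Group G] : Subgroup (Subgroup.center G) :=
  (centerSquareHom G).range

omit [Finite G] in
theorem card_centerSquares_mul (G : Type*) [Group G] :
    Nat.card (centralInvolutions G) * Nat.card (centerSquares G) =
      Nat.card (Subgroup.center G) := by
  rw [← (centerSquareHom G).ker.card_mul_index, Subgroup.index_ker]
  congr 1
  refine Nat.card_congr
    { toFun := fun x => ⟨⟨x, x.2.1⟩, Subtype.ext x.2.2⟩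
      invFun := fun x => ⟨x.1, x.1.2, congrArg Subtype.val x.2⟩
      left_inv := fun _ => rfl
      right_inv := fun _ => rfl }

/-- For central x, the square lies in the commutator span exactly when the coefficients of x sum to
zero over the central square roots of each w. Each central square w gives one independent condition.
-/
theorem finrank_centralSquareCommutator [CharP F 2] (hG : IsPGroup 2 G) :
    Nat.card (centerSquares G) + Module.finrank F (centralSquareCommutator F (MonoidAlgebra F G)) =
      Module.finrank F (centerSubspace F (MonoidAlgebra F G)) := by
  classical
  have := Fintype.ofFinite G
  have := Fintype.ofFinite (centerSquares G)
  let ρ : MonoidAlgebra F G →ₗ[F] (centerSquares G → F) :=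
    { toFun := fun x w => ∑ z with z ∈ Subgroup.center G ∧ z ^ 2 = (w : Subgroup.center G),
        x.coeff z
      map_add' := fun x y => by ext w; simp [Finset.sum_add_distrib]
      map_smul' := fun c x => by ext w; simp [Finset.mul_sum] }
  have hρ : ∀ x w, ρ x w =
    ∑ z with z ∈ Subgroup.center G ∧ z ^ 2 = (w : Subgroup.center G), x.coeff z := fun _ _ => rfl
  have h := finrank_add_finrank_of_surjOn (centerSubspace F (MonoidAlgebra F G))
    (centralSquareCommutator F (MonoidAlgebra F G)) (fun x hx => hx.1) ρ ?_ ?_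
  · rwa [Module.finrank_fintype_fun_eq_card, ← Nat.card_eq_fintype_card] at h
  · intro x hx
    constructor
    · intro hx'
      ext w
      have h1 := coeff_eq_zero_of_mem_commutatorSpan hx'.2 w.1.2
      rw [sq_coeff_of_central hG hx w.1.2] at h1
      simpa [hρ] using h1
    · intro hx'
      refine ⟨hx, mem_commutatorSpan_of_central hG ?_ fun w hw => ?_⟩
      · intro r
        rw [← mul_assoc, hx r, mul_assoc, hx r, mul_assoc]
      · rw [sq_coeff_of_central hG hx hw]
        by_cases h1 : ∃ z ∈ Subgroup.center G, z ^ 2 = w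
        · obtain ⟨z, hz, rfl⟩ := h1
          have h2 := congrFun hx' ⟨⟨z ^ 2, hw⟩, MonoidHom.mem_range.2 ⟨⟨z, hz⟩, rfl⟩⟩
          rw [hρ] at h2
          rw [h2]; simp
        · rw [Finset.filter_false_of_mem]
          · simp
          · rintro z - ⟨hz1, hz2⟩
            exact h1 ⟨z, hz1, hz2⟩
  · intro φ
    have hr : ∀ w : centerSquares G, ∃ z : Subgroup.center G, z ^ 2 = w := fun w =>
      MonoidHom.mem_range.1 w.2
    choose r hr using hr
    -- One chosen central square root per w prescribes all the sums independently.
    refine ⟨∑ w, single (r w : G) (φ w), ?_, ?_⟩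
    · refine Submodule.sum_mem _ fun w _ x => ?_
      exact (single_commute (fun g => (central_comm (r w).2 g).symm)
        (fun c => Commute.all _ _) x).symm
    · rw [map_sum]
      conv_rhs => rw [← Finset.univ_sum_single φ]
      refine Finset.sum_congr rfl fun w _ => ?_
      ext u
      rw [hρ, Finset.sum_filter]
      have hru : ((r w : G) ∈ Subgroup.center G ∧ (r w : G) ^ 2 = (u : Subgroup.center G)) ↔
          u = w := by
        have h1 : (r w : G) ^ 2 = (w : Subgroup.center G) := congrArg Subtype.val (hr w)
        rw [h1, Subtype.ext_iff, Subtype.ext_iff, eq_comm]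
        exact and_iff_right (r w).2
      rw [Finset.sum_eq_single (r w : G)]
      · simp only [hru, coeff_single, Finsupp.single_eq_same, Pi.single_apply]
      · intro g _ hg
        simp [Finsupp.single_eq_of_ne hg]
      · simp

end MonoidAlgebra

/-! ### Derivations of an algebra -/

section Derivations

variable (F : Type*) [Field F]

/-- The linear derivations of a possibly noncommutative algebra into itself. -/
def leibnizSubspace (R : Type*) [Ring R] [Algebra F R] : Submodule F (R →ₗ[F] R) where
  carrier := {D | ∀ x y, D (x * y) = D x * y + x * D y}
  zero_mem' x y := by simp
  add_mem' {D D'} h h' x y := by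
    simp only [LinearMap.add_apply]
    rw [h, h', add_mul, mul_add]; abel
  smul_mem' c D h x y := by
    simp only [LinearMap.smul_apply]
    rw [h, smul_add, smul_mul_assoc, mul_smul_comm]

variable {F} {R R' : Type*} [Ring R] [Algebra F R] [Ring R'] [Algebra F R']

theorem finrank_leibnizSubspace_eq (φ : R ≃ₐ[F] R') :
    Module.finrank F (leibnizSubspace F R) = Module.finrank F (leibnizSubspace F R') := by
  refine finrank_eq_of_linearEquiv (LinearEquiv.arrowCongr φ.toLinearEquiv φ.toLinearEquiv)
    (fun D hD x y => ?_) (fun D hD x y => ?_)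
  · change φ (D (φ.symm (x * y))) = φ (D (φ.symm x)) * y + x * φ (D (φ.symm y))
    rw [map_mul, hD, map_add, map_mul, map_mul, φ.apply_symm_apply, φ.apply_symm_apply]
  · change φ.symm (D (φ (x * y))) = φ.symm (D (φ x)) * y + x * φ.symm (D (φ y))
    rw [map_mul, hD, map_add, map_mul, map_mul, φ.symm_apply_apply, φ.symm_apply_apply]

variable (F R) in
/-- The linear map sending an element to the corresponding inner derivation. -/
def innerDerivation : R →ₗ[F] (R →ₗ[F] R) := LinearMap.mul F R - (LinearMap.mul F R).flip

theorem innerDerivation_apply (x y : R) : innerDerivation F R x y = x * y - y * x := rfl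

theorem innerDerivation_mem (x : R) : innerDerivation F R x ∈ leibnizSubspace F R := by
  intro a b
  simp only [innerDerivation_apply, sub_mul, mul_sub, mul_assoc]
  abel

theorem finrank_range_innerDerivation [FiniteDimensional F R] :
    Module.finrank F (LinearMap.range (innerDerivation F R)) +
      Module.finrank F (centerSubspace F R) = Module.finrank F R := by
  have h : LinearMap.ker (innerDerivation F R) = centerSubspace F R := by
    ext x
    rw [LinearMap.mem_ker]
    constructor
    · intro hx r
      have h1 := LinearMap.congr_fun hx r
      rw [innerDerivation_apply] at h1
      exact (sub_eq_zero.1 h1).symm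
    · intro hx
      ext r
      rw [innerDerivation_apply, hx r, sub_self, LinearMap.zero_apply]
  rw [← h]
  exact LinearMap.finrank_range_add_finrank_ker _

end Derivations

/-! ### Outer derivations as characters of centralizers -/

namespace MonoidAlgebra

variable {F G : Type*} [Field F] [Group G]

/-- The additive characters with values in `F` of the centralizer of an element. -/
abbrev CentralizerChar (F : Type*) [Field F] {G : Type*} [Group G] (x : G) : Type _ :=
  Additive (Subgroup.centralizer ({x} : Set G)) →+ F

/-- The crossed homomorphism of a derivation. -/
noncomputable def crossed (D : MonoidAlgebra F G →ₗ[F] MonoidAlgebra F G) (g x : G) : F :=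
  (D (single g 1)).coeff (x * g)

/-- This is the Leibniz rule in coordinates: D becomes a 1-cocycle of G in the functions on G under
conjugation. It is additive on the centralizer of x. -/
theorem crossed_mul {D : MonoidAlgebra F G →ₗ[F] MonoidAlgebra F G}
    (hD : D ∈ leibnizSubspace F (MonoidAlgebra F G)) (g h x : G) :
    crossed D (g * h) x = crossed D g x + crossed D h (g⁻¹ * x * g) := by
  have h1 := hD (single g 1) (single h 1)
  rw [single_mul_single, mul_one] at h1
  rw [crossed, h1, coeff_add, Finsupp.add_apply]
  simp only [coeff_mul_single_apply, coeff_single_mul_apply, mul_one, one_mul, crossed]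
  congr 2 <;> group

theorem mem_leibnizSubspace_of_single {D : MonoidAlgebra F G →ₗ[F] MonoidAlgebra F G}
    (h : ∀ g k : G, D (single (g * k) 1) = D (single g 1) * single k 1 +
      single g 1 * D (single k 1)) : D ∈ leibnizSubspace F (MonoidAlgebra F G) := by
  have hs : ∀ (g : G) (c : F), (single g c : MonoidAlgebra F G) = c • single g 1 := fun g c => by
    rw [smul_single', mul_one]
  intro x y
  induction x using induction_linear with
  | zero => simp
  | add a b ha hb =>
    rw [add_mul, map_add, ha, hb, map_add, add_mul, add_mul]; abel
  | single g c =>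
    induction y using induction_linear with
    | zero => simp
    | add a b ha hb =>
      rw [mul_add, map_add, ha, hb, map_add, mul_add, mul_add]; abel
    | single k d =>
      rw [single_mul_single, hs (g * k), hs g c, hs k d, map_smul, map_smul, map_smul, h]
      simp only [smul_mul_assoc, mul_smul_comm, smul_add, smul_smul, mul_comm c d]

theorem exists_conj_rep (x : G) :
    ∃ s : G, s * (ConjClasses.mk x).out * s⁻¹ = x := by
  have h : ConjClasses.mk (ConjClasses.mk x).out = ConjClasses.mk x := Quotient.out_eq _
  rw [ConjClasses.mk_eq_mk_iff_isConj, isConj_iff] at h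
  exact h

theorem mk_conj (g x : G) : ConjClasses.mk (g⁻¹ * x * g) = ConjClasses.mk x := by
  rw [ConjClasses.mk_eq_mk_iff_isConj, isConj_iff]
  exact ⟨g, by group⟩

/-- A derivation of the group algebra gives an additive character on the centralizer of each
conjugacy class representative. -/
noncomputable def derivationChar : leibnizSubspace F (MonoidAlgebra F G) →ₗ[F]
    ((c : ConjClasses G) → CentralizerChar F c.out) where
  toFun D c := AddMonoidHom.mk' (fun h => crossed D.1 (h.toMul : G) c.out) fun h k => by
    have h1 := crossed_mul D.2 (h.toMul : G) (k.toMul : G) c.out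
    have h2 := Subgroup.mem_centralizer_singleton_iff.1 h.toMul.2
    have h3 : (h.toMul : G)⁻¹ * c.out * (h.toMul : G) = c.out := by
      rw [mul_assoc, ← h2, inv_mul_cancel_left]
    rw [h3] at h1
    exact h1
  map_add' D D' := rfl
  map_smul' c D := rfl

theorem crossed_innerDerivation (u : MonoidAlgebra F G) (g x : G) :
    crossed (innerDerivation F _ u) g x = u.coeff x - u.coeff (g⁻¹ * x * g) := by
  rw [crossed, innerDerivation_apply, coeff_sub, Finsupp.sub_apply]
  simp only [coeff_mul_single_apply, coeff_single_mul_apply, mul_one, one_mul, mul_inv_cancel,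
    mul_assoc]

theorem ext_crossed {D D' : MonoidAlgebra F G →ₗ[F] MonoidAlgebra F G}
    (h : ∀ g x, crossed D g x = crossed D' g x) : D = D' := by
  ext g y
  have h1 := h g (y * g⁻¹)
  simpa [crossed] using h1

/-- This is injectivity in Shapiro's lemma: a cocycle that is trivial on the stabilizers of all
class representatives is a coboundary, and coboundaries are the inner derivations. -/
theorem derivationChar_eq_zero_iff [Finite G] (D : leibnizSubspace F (MonoidAlgebra F G)) :
    derivationChar D = 0 ↔ D.1 ∈ LinearMap.range (innerDerivation F (MonoidAlgebra F G)) := by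
  constructor
  · intro hD
    choose s hs using exists_conj_rep (G := G)
    -- The coefficient at x is the cocycle evaluated at the element s x that conjugates the class
    -- representative to x.
    refine ⟨(coeffFun F G).symm fun x => crossed D.1 (s x) x, ext_crossed fun g x => ?_⟩
    rw [crossed_innerDerivation, coeff_coeffFun_symm, coeff_coeffFun_symm]
    set y := g⁻¹ * x * g with hy
    have hc : ConjClasses.mk y = ConjClasses.mk x := mk_conj g x
    have hsx := hs x
    have hsy := hs y
    rw [hc] at hsy
    set r := (ConjClasses.mk x).out with hr
    have hmem : (s x)⁻¹ * g * s y ∈ Subgroup.centralizer ({r} : Set G) := by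
      rw [Subgroup.mem_centralizer_singleton_iff]
      have e1 : r = (s x)⁻¹ * x * s x := by nth_rewrite 2 [← hsx]; group
      have e2 : s y * r = y * s y := by nth_rewrite 2 [← hsy]; group
      calc (s x)⁻¹ * g * s y * r = (s x)⁻¹ * g * (y * s y) := by rw [mul_assoc, e2]
        _ = (s x)⁻¹ * x * g * s y := by rw [hy]; group
        _ = r * ((s x)⁻¹ * g * s y) := by rw [e1]; group
    have h0 : crossed D.1 ((s x)⁻¹ * g * s y) r = 0 :=
      DFunLike.congr_fun (congrFun hD (ConjClasses.mk x)) (Additive.ofMul ⟨_, hmem⟩)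
    have h1 := crossed_mul D.2 g (s y) x
    have h2 := crossed_mul D.2 (s x) ((s x)⁻¹ * g * s y) x
    have h3 : (s x)⁻¹ * x * s x = r := by nth_rewrite 2 [← hsx]; group
    rw [h3, h0, add_zero, show s x * ((s x)⁻¹ * g * s y) = g * s y by group, h1] at h2
    rw [← h2, add_sub_cancel_right]
  · rintro ⟨u, hu⟩
    funext c
    ext h
    change crossed D.1 (h : G) c.out = 0
    have h2 := Subgroup.mem_centralizer_singleton_iff.1 h.2
    rw [← hu, crossed_innerDerivation, mul_assoc, ← h2, inv_mul_cancel_left, sub_self]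

/-- This is surjectivity in Shapiro's lemma: characters of the stabilizers are spread over the
classes by transversals. -/
theorem derivationChar_surjective [Finite G] :
    Function.Surjective (derivationChar (F := F) (G := G)) := by
  classical
  intro φ
  have := Fintype.ofFinite G
  choose s hs using exists_conj_rep (G := G)
  -- The value zero outside the centralizer only makes Φ total; additivity is used on centralizer
  -- elements alone.
  let Φ : ConjClasses G → G → F := fun c h =>
    if hh : h ∈ Subgroup.centralizer ({c.out} : Set G) then φ c (Additive.ofMul ⟨h, hh⟩) else 0
  have hΦ : ∀ c h, (hh : h ∈ Subgroup.centralizer ({c.out} : Set G)) →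
      Φ c h = φ c (Additive.ofMul ⟨h, hh⟩) := fun c h hh => dif_pos hh
  have hΦmul : ∀ c h k, h ∈ Subgroup.centralizer ({c.out} : Set G) →
      k ∈ Subgroup.centralizer ({c.out} : Set G) → Φ c (h * k) = Φ c h + Φ c k := by
    intro c h k hh hk
    rw [hΦ c h hh, hΦ c k hk, hΦ c (h * k) (mul_mem hh hk), ← map_add]
    rfl
  have hmem : ∀ g x, (s x)⁻¹ * g * s (g⁻¹ * x * g) ∈
      Subgroup.centralizer ({(ConjClasses.mk x).out} : Set G) := by
    intro g x
    have hsx := hs x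
    have hsy := hs (g⁻¹ * x * g)
    rw [mk_conj g x] at hsy
    set r := (ConjClasses.mk x).out with hr
    set y := g⁻¹ * x * g with hy
    rw [Subgroup.mem_centralizer_singleton_iff]
    have e1 : r = (s x)⁻¹ * x * s x := by nth_rewrite 2 [← hsx]; group
    have e2 : s y * r = y * s y := by nth_rewrite 2 [← hsy]; group
    calc (s x)⁻¹ * g * s y * r = (s x)⁻¹ * g * (y * s y) := by rw [mul_assoc, e2]
      _ = (s x)⁻¹ * x * g * s y := by rw [hy]; group
      _ = r * ((s x)⁻¹ * g * s y) := by rw [e1]; group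
  -- The transversal s moves g into the centralizer of the representative, and the products
  -- telescope to give the cocycle identity.
  let f : G → G → F := fun g x => Φ (ConjClasses.mk x) ((s x)⁻¹ * g * s (g⁻¹ * x * g))
  have hf : ∀ g h x, f (g * h) x = f g x + f h (g⁻¹ * x * g) := by
    intro g h x
    have h1 := hmem h (g⁻¹ * x * g)
    rw [mk_conj g x] at h1
    change Φ _ _ = Φ _ _ + Φ _ _
    rw [mk_conj g x, ← hΦmul _ _ _ (hmem g x) h1]
    congr 1
    have h2 : (g * h)⁻¹ * x * (g * h) = h⁻¹ * (g⁻¹ * x * g) * h := by group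
    rw [h2]; group
  let D : MonoidAlgebra F G →ₗ[F] MonoidAlgebra F G :=
    { toFun := fun a => (coeffFun F G).symm fun y => ∑ g, a.coeff g * f g (y * g⁻¹)
      map_add' := fun a b => by ext y; simp [add_mul, Finset.sum_add_distrib]
      map_smul' := fun c a => by ext y; simp [Finset.mul_sum, mul_assoc] }
  have hDs : ∀ g y, (D (single g 1)).coeff y = f g (y * g⁻¹) := by
    intro g y
    change ((coeffFun F G).symm fun y => ∑ h, (single g (1 : F)).coeff h * f h (y * h⁻¹)).coeff y = _
    rw [coeff_coeffFun_symm, Finset.sum_eq_single g]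
    · simp
    · intro h _ hne
      simp [Finsupp.single_eq_of_ne hne]
    · simp
  have hDc : ∀ g x, crossed D g x = f g x := fun g x => by
    rw [crossed, hDs, mul_inv_cancel_right]
  have hDmem : D ∈ leibnizSubspace F (MonoidAlgebra F G) := by
    refine mem_leibnizSubspace_of_single fun g h => ?_
    ext y
    rw [hDs, coeff_add, Finsupp.add_apply]
    simp only [coeff_mul_single_apply, coeff_single_mul_apply, mul_one, one_mul]
    rw [hDs, hDs, hf]
    congr 2 <;> group
  refine ⟨⟨D, hDmem⟩, ?_⟩
  funext c
  ext h
  change crossed D (h : G) c.out = φ c (Additive.ofMul h)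
  have h2 := Subgroup.mem_centralizer_singleton_iff.1 h.2
  have hc : ConjClasses.mk c.out = c := Quotient.out_eq c
  have hsr := hs c.out
  rw [hc] at hsr
  have hsmem : s c.out ∈ Subgroup.centralizer ({c.out} : Set G) := by
    rw [Subgroup.mem_centralizer_singleton_iff]
    exact mul_inv_eq_iff_eq_mul.1 hsr
  have h3 : (h : G)⁻¹ * c.out * (h : G) = c.out := by
    rw [mul_assoc, ← h2, inv_mul_cancel_left]
  have h4 := hΦmul c _ _ (inv_mem hsmem) hsmem
  have h5 : Φ c 1 = 0 := by
    have h6 := hΦmul c 1 1 (one_mem _) (one_mem _)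
    rw [mul_one] at h6
    exact left_eq_add.1 h6
  rw [inv_mul_cancel, h5] at h4
  rw [hDc]
  change Φ (ConjClasses.mk c.out) ((s c.out)⁻¹ * (h : G) * s ((h : G)⁻¹ * c.out * (h : G))) = _
  rw [hc, h3, hΦmul c _ _ (mul_mem (inv_mem hsmem) h.2) hsmem,
    hΦmul c _ _ (inv_mem hsmem) h.2, ← hΦ c h h.2, add_right_comm, ← h4, zero_add]

theorem finrank_leibnizSubspace [Finite G] :
    Module.finrank F ((c : ConjClasses G) → CentralizerChar F c.out) + Nat.card G =
      Module.finrank F (leibnizSubspace F (MonoidAlgebra F G)) +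
        Module.finrank F (centerSubspace F (MonoidAlgebra F G)) := by
  have h1 := LinearMap.finrank_range_add_finrank_ker (K := F)
    (V := leibnizSubspace F (MonoidAlgebra F G))
    (V₂ := (c : ConjClasses G) → CentralizerChar F c.out) (derivationChar (F := F) (G := G))
  rw [LinearMap.range_eq_top.2 derivationChar_surjective, finrank_top] at h1
  have h2 := finrank_range_innerDerivation (F := F) (R := MonoidAlgebra F G)
  have h3 : LinearMap.ker (derivationChar (F := F) (G := G)) =
      (LinearMap.range (innerDerivation F (MonoidAlgebra F G))).comap
        (leibnizSubspace F (MonoidAlgebra F G)).subtype := by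
    ext D
    exact derivationChar_eq_zero_iff D
  rw [h3, (Submodule.comapSubtypeEquivOfLe (by
    rintro _ ⟨u, rfl⟩; exact innerDerivation_mem u)).finrank_eq] at h1
  rw [finrank_eq_card] at h2
  omega

end MonoidAlgebra

/-! ### Additive characters of finite groups -/

section Characters

variable {F : Type*} [Field F]

instance finite_additive_hom {C : Type*} [Group C] [Finite C] :
    Module.Finite F (Additive C →+ F) := by
  let ι : (Additive C →+ F) →ₗ[F] (Additive C → F) :=
    { toFun := fun f => f
      map_add' := fun _ _ => rfl
      map_smul' := fun _ _ => rfl }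
  have : Finite (Additive C) := ‹Finite C›
  exact Module.Finite.of_injective ι DFunLike.coe_injective

theorem finrank_additive_hom_congr {C C' : Type*} [Group C] [Group C'] (e : C ≃* C') :
    Module.finrank F (Additive C →+ F) = Module.finrank F (Additive C' →+ F) := by
  refine LinearEquiv.finrank_eq
    { toFun := fun f => f.comp (MulEquiv.toAdditive e.symm).toAddMonoidHom
      invFun := fun f => f.comp (MulEquiv.toAdditive e).toAddMonoidHom
      map_add' := fun _ _ => rfl
      map_smul' := fun _ _ => rfl
      left_inv := fun f => by ext x; simp
      right_inv := fun f => by ext x; simp }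

theorem two_pow_finrank_of_sq_eq_one [CharP F 2] {V : Type*} [CommGroup V] [Finite V]
    (hV : ∀ v : V, v ^ 2 = 1) : 2 ^ Module.finrank F (Additive V →+ F) = Nat.card V := by
  let _ : Module (ZMod 2) (Additive V) := AddCommGroup.zmodModule (n := 2) (fun x => hV x.toMul)
  let _ : Algebra (ZMod 2) F := ZMod.algebra F 2
  have h1 := Module.natCard_eq_pow_finrank (K := ZMod 2) (V := Additive V)
  have h2 := Module.finrank_linearMap (ZMod 2) F (Additive V) F
  have h3 : Module.finrank F (Additive V →+ F) =
      Module.finrank F (Additive V →ₗ[ZMod 2] F) := by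
    refine LinearEquiv.finrank_eq
      { toFun := fun f => AddMonoidHom.toZModLinearMap 2 f
        invFun := fun f => f.toAddMonoidHom
        map_add' := fun _ _ => rfl
        map_smul' := fun _ _ => rfl
        left_inv := fun f => rfl
        right_inv := fun f => rfl }
  rw [Nat.card_zmod] at h1
  rw [h3, h2, Module.finrank_self, mul_one, ← h1]
  rfl

/-- The dimension of the space of additive characters of a finite group in characteristic two. -/
theorem two_pow_finrank_additive_hom [CharP F 2] {C : Type*} [Group C] [Finite C] :
    2 ^ Module.finrank F (Additive C →+ F) = (squareSubgroup C).index := by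
  let _ := MonoidAlgebra.quotientCommGroup (squareSubgroup C) commutator_le_squareSubgroup
  have h1 := two_pow_finrank_of_sq_eq_one (F := F)
    (MonoidAlgebra.quotient_sq_eq_one (squareSubgroup C) le_rfl)
  rw [Subgroup.index, ← h1]
  congr 1
  symm
  let mk : Additive C →+ Additive (C ⧸ squareSubgroup C) :=
    MonoidHom.toAdditive (QuotientGroup.mk' (squareSubgroup C))
  let ι : (Additive (C ⧸ squareSubgroup C) →+ F) →ₗ[F] (Additive C →+ F) :=
    { toFun := fun f => f.comp mk
      map_add' := fun _ _ => rfl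
      map_smul' := fun _ _ => rfl }
  refine (LinearEquiv.ofBijective ι ⟨fun f g hfg => ?_, fun f => ?_⟩).finrank_eq
  · refine DFunLike.ext f g fun x => ?_
    obtain ⟨c, rfl⟩ := QuotientGroup.mk'_surjective _ x.toMul
    exact DFunLike.congr_fun hfg (Additive.ofMul c)
  · let f' : C →* Multiplicative F := AddMonoidHom.toMultiplicativeRight f
    have hf' : squareSubgroup C ≤ f'.ker := by
      rw [squareSubgroup, Subgroup.closure_le]
      rintro _ ⟨g, rfl⟩
      change f (Additive.ofMul (g ^ 2)) = 0
      rw [ofMul_pow, map_nsmul, two_nsmul, CharTwo.add_self_eq_zero]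
    refine ⟨AddMonoidHom.toMultiplicativeRight.symm (QuotientGroup.lift _ f' hf'), ?_⟩
    ext x
    rfl

/-- Squaring is an endomorphism here; the index of its image equals the order of its kernel. -/
theorem index_squareSubgroup_of_commute {C : Type*} [Group C] [Finite C]
    (hC : ∀ x y : C, Commute x y) : (squareSubgroup C).index = Nat.card {x : C // x ^ 2 = 1} := by
  let f : C →* C :=
    { toFun := fun x => x ^ 2
      map_one' := one_pow 2
      map_mul' := fun x y => (hC x y).mul_pow 2 }
  have h1 : squareSubgroup C = f.range := by
    apply le_antisymm
    · rw [squareSubgroup, Subgroup.closure_le]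
      rintro _ ⟨g, rfl⟩
      exact ⟨g, rfl⟩
    · rintro _ ⟨g, rfl⟩
      exact sq_mem_squareSubgroup g
  have h2 := f.range.card_mul_index
  have h3 := f.ker.card_mul_index
  rw [Subgroup.index_ker] at h3
  have h4 : Nat.card f.ker = Nat.card {x : C // x ^ 2 = 1} := rfl
  rw [h1, ← h4]
  have h5 : 0 < Nat.card f.range := Nat.card_pos
  apply Nat.eq_of_mul_eq_mul_left h5
  rw [h2, ← h3, mul_comm]

end Characters

/-! ### From conjugacy classes to group elements -/

namespace MonoidAlgebra

variable {F G : Type*} [Field F] [Group G] [Finite G]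

omit [Finite G] in
theorem finrank_centralizerChar_conj (g x : G) :
    Module.finrank F (CentralizerChar F (g * x * g⁻¹)) =
      Module.finrank F (CentralizerChar F x) := by
  refine finrank_additive_hom_congr
    { toFun := fun h => ⟨g⁻¹ * h * g, ?_⟩
      invFun := fun h => ⟨g * h * g⁻¹, ?_⟩
      left_inv := fun h => Subtype.ext (by simp only; group)
      right_inv := fun h => Subtype.ext (by simp only; group)
      map_mul' := fun h k => Subtype.ext (by simp only [Subgroup.coe_mul]; group) }
  · have h1 := Subgroup.mem_centralizer_singleton_iff.1 h.2
    rw [Subgroup.mem_centralizer_singleton_iff]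
    calc g⁻¹ * h * g * x = g⁻¹ * (h * (g * x * g⁻¹)) * g := by group
      _ = x * (g⁻¹ * h * g) := by rw [h1]; group
  · have h1 := Subgroup.mem_centralizer_singleton_iff.1 h.2
    rw [Subgroup.mem_centralizer_singleton_iff]
    calc g * h * g⁻¹ * (g * x * g⁻¹) = g * (h * x) * g⁻¹ := by group
      _ = g * x * g⁻¹ * (g * h * g⁻¹) := by rw [h1]; group

omit [Finite G] in
theorem card_centralizer_conj (g x : G) :
    Nat.card (Subgroup.centralizer ({g * x * g⁻¹} : Set G)) =
      Nat.card (Subgroup.centralizer ({x} : Set G)) := by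
  have h1 := Subgroup.nat_card_centralizer_nat_card_stabilizer (g * x * g⁻¹)
  have h2 := Subgroup.nat_card_centralizer_nat_card_stabilizer x
  rw [h1, h2]
  have h3 : g * x * g⁻¹ = ConjAct.toConjAct g • x := by
    rw [ConjAct.smul_def, ConjAct.ofConjAct_toConjAct]
  rw [h3]
  exact (Nat.card_congr (MulAction.stabilizerEquivStabilizer (G := ConjAct G) rfl).toEquiv).symm

omit [Finite G] in
theorem card_class_mul_card_centralizer (x : G) :
    (MulAction.orbit (ConjAct G) x).ncard * Nat.card (Subgroup.centralizer ({x} : Set G)) =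
      Nat.card G := by
  rw [Subgroup.nat_card_centralizer_nat_card_stabilizer, ← MulAction.index_stabilizer, mul_comm,
    Subgroup.card_mul_index]
  rfl

/-- By orbit-stabilizer, weighting by the order of the centralizer gives each class total weight
|G|. The sum over classes can thus be evaluated element by element. -/
theorem sum_centralizerChar [Fintype G] :
    ∑ x : G, Nat.card (Subgroup.centralizer ({x} : Set G)) *
        Module.finrank F (CentralizerChar F x) =
      Nat.card G * Module.finrank F ((c : ConjClasses G) → CentralizerChar F c.out) := by
  classical
  have := Fintype.ofFinite (ConjClasses G)
  rw [Module.finrank_pi_fintype, Finset.mul_sum, ← Finset.sum_fiberwise _ ConjClasses.mk]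
  refine Finset.sum_congr rfl fun c _ => ?_
  have hc : ConjClasses.mk c.out = c := Quotient.out_eq c
  have h1 : ∀ x ∈ Finset.univ.filter (fun x : G => ConjClasses.mk x = c),
      Nat.card (Subgroup.centralizer ({x} : Set G)) * Module.finrank F (CentralizerChar F x) =
      Nat.card (Subgroup.centralizer ({c.out} : Set G)) *
        Module.finrank F (CentralizerChar F c.out) := by
    intro x hx
    have h2 := (Finset.mem_filter.1 hx).2
    rw [← hc, ConjClasses.mk_eq_mk_iff_isConj] at h2
    obtain ⟨g, hg⟩ := isConj_iff.1 h2
    rw [← hg, card_centralizer_conj, finrank_centralizerChar_conj]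
  rw [Finset.sum_congr rfl h1, Finset.sum_const, smul_eq_mul, ← mul_assoc]
  congr 1
  rw [← card_class_mul_card_centralizer c.out]
  congr 1
  rw [← Set.ncard_coe_finset]
  congr 1
  ext x
  simp only [Finset.coe_filter, Finset.mem_univ, true_and, Set.mem_ofPred_eq]
  rw [ConjAct.mem_orbit_conjAct, ← ConjClasses.mk_eq_mk_iff_isConj, hc]

end MonoidAlgebra

/-! ### Orders of subgroups in normal form -/

namespace NormalForm

variable {G : Type*} [Group G] {a b z : G} {E : Subgroup G} {s t : ℕ}

theorem card_center [Finite G] (h : NormalForm a b z E s t) :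
    Nat.card (Subgroup.center G) = Nat.card E * orderOf z := by
  rw [← Nat.card_zpowers, ← Nat.card_prod]
  symm
  refine Nat.card_congr (Equiv.ofBijective (fun p : E × Subgroup.zpowers z =>
    (⟨p.1 * p.2, mul_mem (h.E_le p.1.2) (Subgroup.zpowers_le.2 h.z_mem p.2.2)⟩ :
      Subgroup.center G)) ⟨?_, ?_⟩)
  · rintro ⟨x, y⟩ ⟨x', y'⟩ hxy
    have h1 : (x : G) * y = x' * y' := congrArg Subtype.val hxy
    have h2 : ((x' : G)⁻¹ * x : G) = y' * (y : G)⁻¹ := by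
      rw [inv_mul_eq_iff_eq_mul, ← mul_assoc, ← h1, mul_inv_cancel_right]
    have h3 := h.E_inter ((x' : G)⁻¹ * x) (mul_mem (inv_mem x'.2) x.2)
      (by rw [h2]; exact mul_mem y'.2 (inv_mem y.2))
    have h4 : x = x' := Subtype.ext (inv_mul_eq_one.1 h3).symm
    rw [h3] at h2
    exact Prod.ext h4 (Subtype.ext (mul_inv_eq_one.1 h2.symm).symm)
  · rintro ⟨u, hu⟩
    obtain ⟨x, hx, k, rfl⟩ := h.decomp u hu
    exact ⟨⟨⟨x, hx⟩, ⟨z ^ k, k, rfl⟩⟩, rfl⟩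

theorem orderOf_z [Finite G] (hG : IsPGroup 2 G) (h : NormalForm a b z E s t) :
    ∃ k, orderOf z = 2 ^ (k + 1) := by
  obtain ⟨k, hk⟩ := (IsPGroup.iff_orderOf.1 hG) z
  cases k with
  | zero => exact absurd (orderOf_eq_one_iff.1 (by simpa using hk)) h.z_ne_one
  | succ k => exact ⟨k, hk⟩

/-- A power of the generator of the cyclic factor is the square of a central element exactly when
its exponent is even. -/
theorem zpow_eq_sq_iff [Finite G] (hG : IsPGroup 2 G) (h : NormalForm a b z E s t) (j : ℤ) :
    (∃ u ∈ Subgroup.center G, u ^ 2 = z ^ j) ↔ Even j := by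
  constructor
  · rintro ⟨u, hu, huj⟩
    obtain ⟨x, hx, k, rfl⟩ := h.decomp u hu
    have h1 : Commute x (z ^ k) := central_comm (zpow_mem h.z_mem k) x
    rw [h1.mul_pow, h.E_sq x hx, one_mul, ← zpow_natCast, ← zpow_mul, ← mul_inv_eq_one,
      ← zpow_neg, ← zpow_add, ← orderOf_dvd_iff_zpow_eq_one] at huj
    obtain ⟨n, hn⟩ := h.orderOf_z hG
    have h2 : (2 : ℤ) ∣ orderOf z := by
      rw [hn]; push_cast; exact ⟨2 ^ n, by ring⟩
    have h3 := h2.trans huj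
    rw [even_iff_two_dvd]
    push_cast at h3
    omega
  · rintro ⟨k, rfl⟩
    exact ⟨z ^ k, zpow_mem h.z_mem k, by rw [zpow_add, pow_two]⟩

theorem card_centralInvolutions [Finite G] (hG : IsPGroup 2 G) (h : NormalForm a b z E s t) :
    Nat.card (centralInvolutions G) = 2 * Nat.card E := by
  obtain ⟨n, hn⟩ := h.orderOf_z hG
  set w := z ^ (orderOf z / 2) with hw
  have hord : orderOf z / 2 * 2 = orderOf z := by rw [hn, pow_succ]; omega
  have hw2 : w ^ 2 = 1 := by rw [hw, ← pow_mul, hord, pow_orderOf_eq_one]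
  have hpos := orderOf_pos z
  have hw1 : w ≠ 1 := by
    rw [hw, Ne, ← orderOf_dvd_iff_pow_eq_one]
    intro hd
    have := Nat.le_of_dvd (by omega) hd
    omega
  have hwz : w ∈ Subgroup.zpowers z := pow_mem (Subgroup.mem_zpowers z) _
  have hwc : w ∈ Subgroup.center G := pow_mem h.z_mem _
  have hset : ((centralInvolutions G : Subgroup G) : Set G) =
      (E : Set G) ∪ (fun x => x * w) '' (E : Set G) := by
    ext u
    constructor
    · rintro ⟨hu, hu2⟩
      obtain ⟨x, hx, k, rfl⟩ := h.decomp u hu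
      have h1 : Commute x (z ^ k) := central_comm (zpow_mem h.z_mem k) x
      rw [h1.mul_pow, h.E_sq x hx, one_mul] at hu2
      by_cases hk : z ^ k = 1
      · left; rw [hk, mul_one]; exact hx
      · right
        exact ⟨x, hx, by
          have e := eq_pow_half_orderOf_of_mem_zpowers (x := z ^ k) ⟨k, rfl⟩ hu2 hk
          rw [e]⟩
    · rintro (hu | ⟨x, hx, rfl⟩)
      · exact ⟨h.E_le hu, h.E_sq u hu⟩
      · refine ⟨mul_mem (h.E_le hx) hwc, ?_⟩
        have h1 : Commute x w := central_comm hwc x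
        simp only
        rw [h1.mul_pow, h.E_sq x hx, hw2, one_mul]
  have hdisj : Disjoint (E : Set G) ((fun x => x * w) '' (E : Set G)) := by
    rw [Set.disjoint_left]
    rintro _ hu ⟨x, hx, rfl⟩
    have h1 : w ∈ E := by
      have h2 := mul_mem (inv_mem hx) hu
      simpa using h2
    exact hw1 (h.E_inter w h1 hwz)
  rw [← SetLike.coe_sort_coe, Nat.card_coe_set_eq, hset, Set.ncard_union_eq hdisj,
    Set.ncard_image_of_injective _ (mul_left_injective w), two_mul, ← Nat.card_coe_set_eq]
  rfl

/-- The image of a in G/Z has order q and generates a subgroup of index two. So q can be recovered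
from |G| and |Z|. -/
theorem card_eq [Finite G] (h : NormalForm a b z E s t) :
    Nat.card G = 2 * orderOf (a * b * a⁻¹ * b⁻¹) * Nat.card (Subgroup.center G) := by
  have h1 := h.pair.index_eq_two
  rw [← index_zpowers_mk_center] at h1
  have h2 := (Subgroup.zpowers (QuotientGroup.mk a : G ⧸ Subgroup.center G)).card_mul_index
  rw [h1, Nat.card_zpowers] at h2
  have h3 : orderOf (QuotientGroup.mk a : G ⧸ Subgroup.center G) =
      orderOf (a * b * a⁻¹ * b⁻¹) := by
    apply Nat.dvd_antisymm
    · rw [orderOf_dvd_iff_pow_eq_one]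
      refine (QuotientGroup.eq_one_iff (a ^ orderOf (a * b * a⁻¹ * b⁻¹))).2 ?_
      have h4 := (h.pair.zpow_mem_center_iff_dvd (orderOf (a * b * a⁻¹ * b⁻¹))).2 dvd_rfl
      exact_mod_cast h4
    · have h4 : a ^ orderOf (QuotientGroup.mk a : G ⧸ Subgroup.center G) ∈ Subgroup.center G :=
        (QuotientGroup.eq_one_iff _).1
          (pow_orderOf_eq_one (QuotientGroup.mk a : G ⧸ Subgroup.center G))
      have h5 := (h.pair.zpow_mem_center_iff_dvd
        (orderOf (QuotientGroup.mk a : G ⧸ Subgroup.center G))).1 (by exact_mod_cast h4)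
      exact_mod_cast h5
  rw [h3] at h2
  rw [← (Subgroup.center G).card_mul_index, Subgroup.index, ← h2]
  ring

end NormalForm

open scoped Classical in
/-- Counting the involutions of an abelian subgroup which are central up to one coset of the
center. -/
theorem card_sq_eq_one_of_coset {G : Type*} [Group G] [Finite G] {C : Subgroup G}
    (hC : Subgroup.center G ≤ C) {y : G} (hy : y ∈ C) (hyZ : y ∉ Subgroup.center G)
    (hcov : ∀ x ∈ C, x ^ 2 = 1 → x ∈ Subgroup.center G ∨ y⁻¹ * x ∈ Subgroup.center G) :
    Nat.card {x : C // x ^ 2 = 1} =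
      Nat.card (centralInvolutions G) *
        if ∃ u ∈ Subgroup.center G, u ^ 2 = y ^ 2 then 2 else 1 := by
  have hyu : ∀ u ∈ Subgroup.center G, (y * u) ^ 2 = y ^ 2 * u ^ 2 := fun u hu =>
    (show Commute y u from central_comm hu y).mul_pow 2
  have h0 : Nat.card {x : C // x ^ 2 = 1} = {x : G | x ∈ C ∧ x ^ 2 = 1}.ncard := by
    rw [← Nat.card_coe_set_eq]
    refine Nat.card_congr
      { toFun := fun x => ⟨x.1.1, x.1.2, congrArg Subtype.val x.2⟩
        invFun := fun x => ⟨⟨x.1, x.2.1⟩, Subtype.ext x.2.2⟩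
        left_inv := fun x => rfl
        right_inv := fun x => rfl }
  have h1 : Nat.card (centralInvolutions G) = (centralInvolutions G : Set G).ncard := rfl
  rw [h0, h1]
  split_ifs with hu
  · obtain ⟨u, hu, huy⟩ := hu
    have huI : (y * u⁻¹) ^ 2 = 1 := by
      rw [hyu _ (inv_mem hu), inv_pow, huy, mul_inv_cancel]
    have hset : {x : G | x ∈ C ∧ x ^ 2 = 1} = (centralInvolutions G : Set G) ∪
        (fun x => y * u⁻¹ * x) '' (centralInvolutions G : Set G) := by
      ext x
      constructor
      · rintro ⟨hx, hx2⟩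
        rcases hcov x hx hx2 with h | h
        · exact Or.inl ⟨h, hx2⟩
        · refine Or.inr ⟨u * (y⁻¹ * x), ⟨mul_mem hu h, ?_⟩, by group⟩
          have h2 := hyu _ h
          rw [mul_inv_cancel_left, hx2, ← huy] at h2
          rw [(show Commute u (y⁻¹ * x) from central_comm h u).mul_pow, ← h2]
      · rintro (⟨hx, hx2⟩ | ⟨x, ⟨hx, hx2⟩, rfl⟩)
        · exact ⟨hC hx, hx2⟩
        · refine ⟨mul_mem (mul_mem hy (inv_mem (hC hu))) (hC hx), ?_⟩
          simp only
          rw [(show Commute (y * u⁻¹) x from central_comm hx _).mul_pow, huI, hx2, one_mul]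
    have hdisj : Disjoint (centralInvolutions G : Set G)
        ((fun x => y * u⁻¹ * x) '' (centralInvolutions G : Set G)) := by
      rw [Set.disjoint_left]
      rintro _ hx ⟨x, hx', rfl⟩
      apply hyZ
      have h2 := mul_mem (mul_mem hx.1 (inv_mem hx'.1)) hu
      simpa using h2
    rw [hset, Set.ncard_union_eq hdisj, Set.ncard_image_of_injective _ (mul_right_injective _),
      mul_two]
  · rw [mul_one]
    congr 1
    ext x
    refine ⟨?_, fun hx => ⟨hC hx.1, hx.2⟩⟩
    rintro ⟨hx, hx2⟩
    rcases hcov x hx hx2 with h | h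
    · exact ⟨h, hx2⟩
    · refine absurd ⟨(y⁻¹ * x)⁻¹, inv_mem h, ?_⟩ hu
      have h2 := hyu _ h
      rw [mul_inv_cancel_left, hx2] at h2
      rw [inv_pow, eq_comm, eq_inv_iff_mul_eq_one, h2]

/-! ### Centralizers in a group with a dihedral pair -/

namespace DihedralPair

variable {G : Type*} [Group G] {a b : G}

theorem commute_of_mem {x y : G} (hx : x ∈ Subgroup.zpowers a ⊔ Subgroup.center G)
    (hy : y ∈ Subgroup.zpowers a ⊔ Subgroup.center G) : Commute x y := by
  obtain ⟨i, u, hu, rfl⟩ := mem_zpowers_sup_center.1 hx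
  obtain ⟨j, v, hv, rfl⟩ := mem_zpowers_sup_center.1 hy
  have h1 : Commute (a ^ i * u) v := central_comm hv _
  have h2 : Commute u (a ^ j) := (central_comm hu (a ^ j) : Commute _ _).symm
  exact ((((Commute.refl a).zpow_zpow i j).mul_left h2).mul_right h1)

theorem mem_of_notMem_zpowers_sup_center (h : DihedralPair a b) {x g : G}
    (hx : x ∉ Subgroup.zpowers a ⊔ Subgroup.center G)
    (hg : g ∉ Subgroup.zpowers a ⊔ Subgroup.center G) :
    x⁻¹ * g ∈ Subgroup.zpowers a ⊔ Subgroup.center G := by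
  rw [Subgroup.mul_mem_iff_of_index_two h.index_eq_two, Subgroup.inv_mem_iff]
  tauto

/-- Elements commuting with some element on either side of the abelian subgroup are central. -/
theorem mem_center_of_commute_notMem (h : DihedralPair a b) {x g : G}
    (hx : x ∉ Subgroup.zpowers a ⊔ Subgroup.center G)
    (hg : g ∈ Subgroup.zpowers a ⊔ Subgroup.center G) (hgx : Commute g x) :
    g ∈ Subgroup.center G := by
  rw [Subgroup.mem_center_iff]
  intro y
  by_cases hy : y ∈ Subgroup.zpowers a ⊔ Subgroup.center G
  · exact commute_of_mem hy hg
  · have h1 := commute_of_mem hg (h.mem_of_notMem_zpowers_sup_center hx hy)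
    have h2 := hgx.mul_right h1
    rw [mul_inv_cancel_left] at h2
    exact h2.symm

theorem centralizer_of_mem (h : DihedralPair a b) {x : G}
    (hx : x ∈ Subgroup.zpowers a ⊔ Subgroup.center G) (hxZ : x ∉ Subgroup.center G) :
    Subgroup.centralizer {x} = Subgroup.zpowers a ⊔ Subgroup.center G := by
  ext g
  rw [Subgroup.mem_centralizer_singleton_iff]
  refine ⟨fun hg => ?_, fun hg => commute_of_mem hg hx⟩
  by_contra hgA
  exact hxZ (h.mem_center_of_commute_notMem hgA hx (show Commute g x from hg).symm)

/-- If g lies in ⟨a⟩Z and commutes with x, it is central; otherwise x⁻¹g lies in ⟨a⟩Z and commutes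
with x. -/
theorem mem_centralizer_iff_of_notMem (h : DihedralPair a b) {x g : G}
    (hx : x ∉ Subgroup.zpowers a ⊔ Subgroup.center G) :
    g ∈ Subgroup.centralizer {x} ↔ g ∈ Subgroup.center G ∨ x⁻¹ * g ∈ Subgroup.center G := by
  rw [Subgroup.mem_centralizer_singleton_iff]
  have hxx : ∀ u ∈ Subgroup.center G, Commute u x := fun u hu =>
    (show Commute x u from central_comm hu x).symm
  constructor
  · intro hg
    have hg' : Commute g x := hg
    by_cases hgA : g ∈ Subgroup.zpowers a ⊔ Subgroup.center G
    · exact Or.inl (h.mem_center_of_commute_notMem hx hgA hg')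
    · exact Or.inr (h.mem_center_of_commute_notMem hx (h.mem_of_notMem_zpowers_sup_center hx hgA)
        ((Commute.refl x).inv_left.mul_left hg'))
  · rintro (hg | hg)
    · exact hxx g hg
    · have h1 := (Commute.refl x).mul_left (hxx _ hg)
      rwa [mul_inv_cancel_left] at h1

theorem card_centralizer_of_notMem [Finite G] (h : DihedralPair a b) {x : G}
    (hx : x ∉ Subgroup.zpowers a ⊔ Subgroup.center G) :
    Nat.card (Subgroup.centralizer ({x} : Set G)) = 2 * Nat.card (Subgroup.center G) := by
  have hset : (Subgroup.centralizer ({x} : Set G) : Set G) =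
      (Subgroup.center G : Set G) ∪ (fun u => x * u) '' (Subgroup.center G : Set G) := by
    ext g
    rw [SetLike.mem_coe, h.mem_centralizer_iff_of_notMem hx]
    refine or_congr Iff.rfl ⟨fun hg => ⟨_, hg, mul_inv_cancel_left x g⟩, ?_⟩
    rintro ⟨u, hu, rfl⟩
    simpa using hu
  have hdisj : Disjoint (Subgroup.center G : Set G)
      ((fun u => x * u) '' (Subgroup.center G : Set G)) := by
    rw [Set.disjoint_left]
    rintro _ hg ⟨u, hu, rfl⟩
    apply hx
    have h2 := mul_mem (SetLike.mem_coe.1 hg) (inv_mem hu)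
    rw [mul_inv_cancel_right] at h2
    exact Subgroup.mem_sup_right h2
  have h1 : Nat.card (Subgroup.centralizer ({x} : Set G)) =
      (Subgroup.centralizer ({x} : Set G) : Set G).ncard := rfl
  have h2 : Nat.card (Subgroup.center G) = (Subgroup.center G : Set G).ncard := rfl
  rw [h1, h2, hset, Set.ncard_union_eq hdisj,
    Set.ncard_image_of_injective _ (mul_right_injective x), two_mul]

theorem commute_of_mem_centralizer (h : DihedralPair a b) {x g k : G}
    (hx : x ∉ Subgroup.zpowers a ⊔ Subgroup.center G) (hg : g ∈ Subgroup.centralizer {x})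
    (hk : k ∈ Subgroup.centralizer {x}) : Commute g k := by
  rcases (h.mem_centralizer_iff_of_notMem hx).1 hg with hg' | hg'
  · exact (central_comm hg' k : Commute k g).symm
  · have h1 : Commute (x⁻¹ * g) k := (central_comm hg' k : Commute k _).symm
    have h2 : Commute x k := (Subgroup.mem_centralizer_singleton_iff.1 hk : Commute k x).symm
    have h3 := h2.mul_left h1
    rwa [mul_inv_cancel_left] at h3

end DihedralPair

/-! ### Character dimensions of the centralizers -/

namespace NormalForm

open MonoidAlgebra Module

variable {F : Type*} [Field F] [CharP F 2]
variable {G : Type*} [Group G] [Finite G] {a b z : G} {E : Subgroup G} {s t : ℕ}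

open scoped Classical in
-- The centralizer is the abelian group ⟨a⟩Z, whose elements of square one lie in Z or a^(q/2)Z. The
-- second coset contributes exactly when a^q = z^(|z|/2 + sq/2) is a central square, that is, when
-- this exponent is even.
theorem two_pow_finrank_centralizerChar_of_mem (hG : IsPGroup 2 G) (h : NormalForm a b z E s t)
    (hs : s = 0 ∨ 4 ∣ orderOf (a * b * a⁻¹ * b⁻¹)) {x : G}
    (hx : x ∈ Subgroup.zpowers a ⊔ Subgroup.center G) (hxZ : x ∉ Subgroup.center G) :
    2 ^ finrank F (CentralizerChar F x) =
      Nat.card (centralInvolutions G) * if Even (orderOf z / 2) then 2 else 1 := by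
  have hcomm : ∀ g k : Subgroup.centralizer ({x} : Set G), Commute g k := fun g k =>
    Subtype.ext (DihedralPair.commute_of_mem ((h.pair.centralizer_of_mem hx hxZ).le g.2)
      ((h.pair.centralizer_of_mem hx hxZ).le k.2))
  rw [two_pow_finrank_additive_hom, index_squareSubgroup_of_commute hcomm]
  obtain ⟨n, hn⟩ := h.pair.orderOf_commutator hG
  have hM := h.zpow_orderOf_commutator hG
  have hdvd := h.pair.zpow_mem_center_iff_dvd
  set q := orderOf (a * b * a⁻¹ * b⁻¹) with hq
  have hq2 : q / 2 * 2 = q := by rw [hn, pow_succ]; omega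
  have hqpos : 0 < q := by rw [hn]; positivity
  have hqc : a ^ q ∈ Subgroup.center G := by
    have := (hdvd q).2 dvd_rfl
    exact_mod_cast this
  have hy2 : (a ^ (q / 2)) ^ 2 = a ^ q := by rw [← pow_mul, hq2]
  have key := card_sq_eq_one_of_coset (C := Subgroup.centralizer ({x} : Set G)) (y := a ^ (q / 2))
    (Subgroup.center_le_centralizer _)
    (by
      rw [h.pair.centralizer_of_mem hx hxZ]
      exact Subgroup.mem_sup_left (pow_mem (Subgroup.mem_zpowers a) _))
    (by
      intro hc
      have h1 := (hdvd (q / 2 : ℕ)).1 (by exact_mod_cast hc)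
      have h2 := Nat.le_of_dvd (by omega) (Int.natCast_dvd_natCast.1 h1)
      omega)
    (by
      intro g hg hg2
      rw [h.pair.centralizer_of_mem hx hxZ] at hg
      obtain ⟨i, u, hu, rfl⟩ := mem_zpowers_sup_center.1 hg
      rw [(show Commute (a ^ i) u from central_comm hu _).mul_pow, mul_eq_one_iff_eq_inv] at hg2
      have h1 : a ^ (i * 2) ∈ Subgroup.center G := by
        rw [zpow_mul]
        have : (a ^ i) ^ (2 : ℤ) = (a ^ i) ^ 2 := by norm_cast
        rw [this, hg2]
        exact inv_mem (pow_mem hu 2)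
      obtain ⟨j, hj⟩ := (hdvd _).1 h1
      have h2 : i = (q / 2 : ℕ) * j := by
        have : (q : ℤ) = (q / 2 : ℕ) * 2 := by exact_mod_cast hq2.symm
        rw [this] at hj
        linarith
      rcases Int.even_or_odd' j with ⟨m, rfl | rfl⟩
      · left
        refine mul_mem ((hdvd i).2 ⟨m, ?_⟩) hu
        rw [h2]
        have : (q : ℤ) = (q / 2 : ℕ) * 2 := by exact_mod_cast hq2.symm
        rw [this]; ring
      · right
        rw [← mul_assoc, ← zpow_natCast, ← zpow_neg, ← zpow_add]
        refine mul_mem ((hdvd _).2 ⟨m, ?_⟩) hu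
        rw [h2]
        have : (q : ℤ) = (q / 2 : ℕ) * 2 := by exact_mod_cast hq2.symm
        rw [this]; ring)
  rw [key, hy2, hM]
  congr 2
  have h3 := h.zpow_eq_sq_iff hG ((orderOf z / 2 + s * (q / 2) : ℕ) : ℤ)
  rw [zpow_natCast] at h3
  rw [h3]
  -- This is where the restriction on the case s = 1 matters: it makes the answer independent of s.
  have h4 : Even (s * (q / 2)) := by
    rcases hs with rfl | ⟨m, hm⟩
    · simp
    · exact Even.mul_left ⟨m, by omega⟩ s
  apply propext
  rw [Int.even_coe_nat, Nat.even_add]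
  tauto

open scoped Classical in
-- The centralizer is the abelian group Z ∪ xZ; the coset xZ contains elements of square one exactly
-- when x² is a central square.
theorem two_pow_finrank_centralizerChar_of_notMem (h : NormalForm a b z E s t) {x : G}
    (hx : x ∉ Subgroup.zpowers a ⊔ Subgroup.center G) :
    2 ^ finrank F (CentralizerChar F x) = Nat.card (centralInvolutions G) *
      if ∃ u ∈ Subgroup.center G, u ^ 2 = x ^ 2 then 2 else 1 := by
  rw [two_pow_finrank_additive_hom, index_squareSubgroup_of_commute
    fun g k => Subtype.ext (h.pair.commute_of_mem_centralizer hx g.2 k.2)]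
  refine card_sq_eq_one_of_coset (Subgroup.center_le_centralizer _)
    (Subgroup.mem_centralizer_singleton_iff.2 rfl) (fun hxZ => hx (Subgroup.mem_sup_right hxZ))
    fun g hg _ => (h.pair.mem_centralizer_iff_of_notMem hx).1 hg

theorem two_pow_finrank_centralizerChar_of_mem_center {x : G} (hx : x ∈ Subgroup.center G) :
    2 ^ finrank F (CentralizerChar F x) = (squareSubgroup G).index := by
  rw [← two_pow_finrank_additive_hom (F := F)]
  congr 1
  have h1 : Subgroup.centralizer ({x} : Set G) = ⊤ := by
    rw [Subgroup.centralizer_eq_top_iff_subset]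
    simpa using hx
  exact finrank_additive_hom_congr ((MulEquiv.subgroupCongr h1).trans Subgroup.topEquiv)

end NormalForm

/-! ### Counting reflections and the dimension formula -/

namespace NormalForm

open MonoidAlgebra Module

variable {F : Type*} [Field F] [CharP F 2]
variable {G : Type*} [Group G] [Finite G] {a b z : G} {E : Subgroup G} {s t : ℕ}

/-- The elements outside the abelian subgroup whose square is the square of a central element. -/
def reflectionsOverSquares (a : G) : Set G :=
  {x | x ∉ Subgroup.zpowers a ⊔ Subgroup.center G ∧ ∃ u ∈ Subgroup.center G, u ^ 2 = x ^ 2}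

omit [Finite G] in
theorem b_mul_zpow_notMem (h : NormalForm a b z E s t) (i : ℤ) :
    b * a ^ i ∉ Subgroup.zpowers a ⊔ Subgroup.center G := by
  intro hb
  have ha : a ∈ Subgroup.zpowers a ⊔ Subgroup.center G :=
    Subgroup.mem_sup_left (Subgroup.mem_zpowers a)
  have hb' : b ∈ Subgroup.zpowers a ⊔ Subgroup.center G :=
    (Subgroup.mul_mem_cancel_right _ (zpow_mem ha i)).1 hb
  exact h.pair.not_commute (DihedralPair.commute_of_mem ha hb')

omit [Finite G] in
theorem sq_b_mul_zpow (h : NormalForm a b z E s t) (i : ℤ) :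
    (b * a ^ i) ^ 2 = z ^ (s * i + t : ℤ) := by
  have h1 := h.mul_refl_refl i i 0 0 1 1
  simpa [pow_two] using h1

/-- The square is z^(si+t)u², and a power of z is a central square only for even exponents. Taking i
= 0 and i = 1 detects the parities of t and s + t. -/
theorem b_mul_zpow_mem_iff (hG : IsPGroup 2 G) (h : NormalForm a b z E s t) (i : ℤ) {u : G}
    (hu : u ∈ Subgroup.center G) :
    b * a ^ i * u ∈ reflectionsOverSquares a ↔ Even (s * i + t : ℤ) := by
  rw [← h.zpow_eq_sq_iff hG, ← h.sq_b_mul_zpow]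
  have h1 : (b * a ^ i * u) ^ 2 = (b * a ^ i) ^ 2 * u ^ 2 :=
    (show Commute (b * a ^ i) u from central_comm hu _).mul_pow 2
  have h2 : b * a ^ i * u ∉ Subgroup.zpowers a ⊔ Subgroup.center G := by
    rw [Subgroup.mul_mem_cancel_right _ (Subgroup.mem_sup_right hu)]
    exact h.b_mul_zpow_notMem i
  constructor
  · rintro ⟨-, v, hv, hv2⟩
    refine ⟨v * u⁻¹, mul_mem hv (inv_mem hu), ?_⟩
    rw [(show Commute v u⁻¹ from central_comm (inv_mem hu) _).mul_pow, hv2, h1, inv_pow,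
      mul_inv_cancel_right]
  · rintro ⟨v, hv, hv2⟩
    refine ⟨h2, v * u, mul_mem hv hu, ?_⟩
    rw [(show Commute v u from central_comm hu _).mul_pow, hv2, h1]

theorem compl_subset_reflectionsOverSquares_iff (hG : IsPGroup 2 G) (h : NormalForm a b z E s t) :
    ((Subgroup.zpowers a ⊔ Subgroup.center G : Subgroup G) : Set G)ᶜ ⊆ reflectionsOverSquares a ↔
      Even s ∧ Even t := by
  constructor
  · intro hsub
    have h0 := (h.b_mul_zpow_mem_iff hG 0 (one_mem _)).1
      (hsub (by simpa using h.b_mul_zpow_notMem 0))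
    have h1 := (h.b_mul_zpow_mem_iff hG 1 (one_mem _)).1
      (hsub (by simpa using h.b_mul_zpow_notMem 1))
    simp only [mul_zero, zero_add, mul_one, Int.even_coe_nat] at h0 h1
    rw [Int.even_add] at h1
    simp only [Int.even_coe_nat] at h1
    tauto
  · rintro ⟨hs, ht⟩ x hx
    obtain ⟨i, u, hu, rfl | rfl⟩ := h.pair.cover x
    · exact absurd (mem_zpowers_sup_center.2 ⟨i, u, hu, rfl⟩) hx
    · rw [h.b_mul_zpow_mem_iff hG i hu]
      exact (((Int.even_coe_nat s).2 hs).mul_right i).add ((Int.even_coe_nat t).2 ht)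

theorem reflectionsOverSquares_eq_empty_iff (hG : IsPGroup 2 G) (h : NormalForm a b z E s t) :
    reflectionsOverSquares a = ∅ ↔ Even s ∧ ¬ Even t := by
  rw [Set.eq_empty_iff_forall_notMem]
  constructor
  · intro hsub
    have h0 := (h.b_mul_zpow_mem_iff hG 0 (one_mem _)).not.1 (hsub _)
    have h1 := (h.b_mul_zpow_mem_iff hG 1 (one_mem _)).not.1 (hsub _)
    simp only [mul_zero, zero_add, mul_one, Int.even_coe_nat] at h0 h1
    rw [Int.even_add] at h1
    simp only [Int.even_coe_nat] at h1
    tauto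
  · rintro ⟨hs, ht⟩ x hx
    obtain ⟨i, u, hu, rfl | rfl⟩ := h.pair.cover x
    · exact hx.1 (mem_zpowers_sup_center.2 ⟨i, u, hu, rfl⟩)
    · rw [h.b_mul_zpow_mem_iff hG i hu, Int.even_add, Int.even_coe_nat] at hx
      exact ht (hx.1 (((Int.even_coe_nat s).2 hs).mul_right i))

omit [Finite G] in
theorem reflectionsOverSquares_subset (a : G) :
    reflectionsOverSquares a ⊆ ((Subgroup.zpowers a ⊔ Subgroup.center G : Subgroup G) : Set G)ᶜ :=
  fun _ hx => hx.1

theorem compl_subset_iff_ncard_le (a : G) :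
    ((Subgroup.zpowers a ⊔ Subgroup.center G : Subgroup G) : Set G)ᶜ ⊆ reflectionsOverSquares a ↔
      (((Subgroup.zpowers a ⊔ Subgroup.center G : Subgroup G) : Set G)ᶜ).ncard ≤
        (reflectionsOverSquares a).ncard :=
  ⟨fun hs => Set.ncard_le_ncard hs, fun hs =>
    (Set.eq_of_subset_of_ncard_le (reflectionsOverSquares_subset a) hs).ge⟩

omit [Finite G] in
theorem ncard_zpowers_sup_center (h : NormalForm a b z E s t) :
    Nat.card G = 2 * Nat.card (Subgroup.zpowers a ⊔ Subgroup.center G : Subgroup G) := by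
  rw [← (Subgroup.zpowers a ⊔ Subgroup.center G).card_mul_index, h.pair.index_eq_two, mul_comm]

theorem ncard_compl (h : NormalForm a b z E s t) :
    2 * (((Subgroup.zpowers a ⊔ Subgroup.center G : Subgroup G) : Set G)ᶜ).ncard = Nat.card G := by
  have h1 := Set.ncard_add_ncard_compl
    ((Subgroup.zpowers a ⊔ Subgroup.center G : Subgroup G) : Set G)
  have h2 : ((Subgroup.zpowers a ⊔ Subgroup.center G : Subgroup G) : Set G).ncard =
    Nat.card (Subgroup.zpowers a ⊔ Subgroup.center G : Subgroup G) := rfl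
  have h3 := h.ncard_zpowers_sup_center
  omega

/-- The number of elements of `reflectionsOverSquares a` determines the parities of the parameters. -/
theorem parity_eq_of_ncard_eq {H : Type*} [Group H] [Finite H] {a' b' z' : H} {E' : Subgroup H}
    {s' t' : ℕ} (hG : IsPGroup 2 G) (hH : IsPGroup 2 H) (h : NormalForm a b z E s t)
    (h' : NormalForm a' b' z' E' s' t') (hcard : Nat.card G = Nat.card H)
    (hN : (reflectionsOverSquares a).ncard = (reflectionsOverSquares a').ncard) :
    ((Even s ∧ Even t) ↔ (Even s' ∧ Even t')) ∧
      ((Even s ∧ ¬ Even t) ↔ (Even s' ∧ ¬ Even t')) := by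
  rw [← h.compl_subset_reflectionsOverSquares_iff hG,
    ← h'.compl_subset_reflectionsOverSquares_iff hH, ← h.reflectionsOverSquares_eq_empty_iff hG,
    ← h'.reflectionsOverSquares_eq_empty_iff hH, ← Set.ncard_eq_zero, ← Set.ncard_eq_zero, hN]
  refine ⟨?_, Iff.rfl⟩
  have h1 := h.ncard_compl
  have h2 := h'.ncard_compl
  rw [compl_subset_iff_ncard_le, compl_subset_iff_ncard_le]
  omega

open scoped Classical in
-- The three summands collect the central elements, the noncentral elements of ⟨a⟩Z and the elements
-- outside ⟨a⟩Z. Every quantity except the number of reflections over squares is already an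
-- invariant, so that number becomes one.
theorem card_mul_finrank_characters (F : Type*) [Field F] [CharP F 2] (hG : IsPGroup 2 G)
    (h : NormalForm a b z E s t) (hs : s = 0 ∨ 4 ∣ orderOf (a * b * a⁻¹ * b⁻¹)) :
    Nat.card G * finrank F ((c : ConjClasses G) → CentralizerChar F c.out) =
      Nat.card (Subgroup.center G) * (Nat.card G * Nat.log 2 (squareSubgroup G).index) +
      (Nat.card G / 2 - Nat.card (Subgroup.center G)) * (Nat.card G / 2 *
        Nat.log 2 (Nat.card (centralInvolutions G) * if Even (orderOf z / 2) then 2 else 1)) +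
      (2 * Nat.card (Subgroup.center G)) *
        (Nat.card G / 2 * Nat.log 2 (Nat.card (centralInvolutions G)) +
          (reflectionsOverSquares a).ncard) := by
  have := Fintype.ofFinite G
  have hlog : ∀ {k m : ℕ}, 2 ^ k = m → k = Nat.log 2 m := fun {k m} hk => by
    rw [← hk, Nat.log_pow (by norm_num)]
  -- As this order is a power of two, an extra factor two raises the logarithm by exactly one.
  obtain ⟨r, hr⟩ := (IsPGroup.iff_card.1 (hG.to_subgroup (centralInvolutions G)))
  have hA2 := h.ncard_zpowers_sup_center
  have hAc := h.ncard_compl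
  set A := Subgroup.zpowers a ⊔ Subgroup.center G with hA
  have hZA : Subgroup.center G ≤ A := le_sup_right
  have hAcard : Nat.card G / 2 = Nat.card A := by omega
  rw [← sum_centralizerChar, hAcard]
  set α := Nat.log 2 (Nat.card (centralInvolutions G) * if Even (orderOf z / 2) then 2 else 1)
  have hval : ∀ x : G, Nat.card (Subgroup.centralizer ({x} : Set G)) *
      finrank F (CentralizerChar F x) =
      if x ∈ A then
        if x ∈ Subgroup.center G then Nat.card G * Nat.log 2 (squareSubgroup G).index
        else Nat.card A * α
      else (2 * Nat.card (Subgroup.center G)) * (Nat.log 2 (Nat.card (centralInvolutions G)) +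
        if x ∈ reflectionsOverSquares a then 1 else 0) := by
    intro x
    by_cases hx : x ∈ A
    · by_cases hxZ : x ∈ Subgroup.center G
      · rw [if_pos hx, if_pos hxZ, hlog (two_pow_finrank_centralizerChar_of_mem_center hxZ)]
        have h1 : Subgroup.centralizer ({x} : Set G) = ⊤ := by
          rw [Subgroup.centralizer_eq_top_iff_subset]
          simpa using hxZ
        rw [h1, Subgroup.card_top]
      · rw [if_pos hx, if_neg hxZ,
          hlog (h.two_pow_finrank_centralizerChar_of_mem hG hs hx hxZ),
          h.pair.centralizer_of_mem hx hxZ]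
    · rw [if_neg hx, h.pair.card_centralizer_of_notMem hx,
        hlog (h.two_pow_finrank_centralizerChar_of_notMem hx), hr]
      congr 1
      have h2 : x ∈ reflectionsOverSquares a ↔ ∃ u ∈ Subgroup.center G, u ^ 2 = x ^ 2 :=
        ⟨fun h => h.2, fun h => ⟨hx, h⟩⟩
      by_cases hu : ∃ u ∈ Subgroup.center G, u ^ 2 = x ^ 2
      · rw [if_pos hu, if_pos (h2.2 hu), ← pow_succ, Nat.log_pow (by norm_num),
          Nat.log_pow (by norm_num)]
      · rw [if_neg hu, if_neg (h2.not.2 hu), mul_one, add_zero]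
  have hcard : ∀ (P : G → Prop) [DecidablePred P], (Finset.univ.filter P).card =
      Set.ncard {x | P x} := fun P _ => by
    rw [← Set.ncard_coe_finset]; congr 1; ext x; simp
  rw [Finset.sum_congr rfl fun x _ => hval x, Finset.sum_ite, Finset.sum_ite, Finset.sum_const,
    Finset.sum_const, ← Finset.mul_sum, Finset.sum_add_distrib, Finset.sum_const,
    Finset.sum_boole, Finset.filter_filter, Finset.filter_filter, Finset.filter_filter]
  have e1 : (Finset.univ.filter fun x => x ∈ A ∧ x ∈ Subgroup.center G).card =
      Nat.card (Subgroup.center G) := by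
    rw [hcard]
    change _ = (Subgroup.center G : Set G).ncard
    congr 1; ext x; exact ⟨fun h => h.2, fun h => ⟨hZA h, h⟩⟩
  have e2 : (Finset.univ.filter fun x => x ∈ A ∧ x ∉ Subgroup.center G).card =
      Nat.card A - Nat.card (Subgroup.center G) := by
    rw [hcard]
    change _ = (A : Set G).ncard - (Subgroup.center G : Set G).ncard
    rw [← Set.ncard_sdiff (show (Subgroup.center G : Set G) ⊆ A from hZA)]
    rfl
  have e3 : (Finset.univ.filter fun x => x ∉ A).card = Nat.card A := by
    rw [hcard]
    change ((A : Set G)ᶜ).ncard = _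
    omega
  have e4 : (Finset.univ.filter fun x => x ∉ A ∧ x ∈ reflectionsOverSquares a).card =
      (reflectionsOverSquares a).ncard := by
    rw [hcard]
    congr 1; ext x; exact ⟨fun h => h.2, fun h => ⟨h.1, h⟩⟩
  rw [e1, e2, e3, e4]
  simp only [smul_eq_mul, Nat.cast_id]

end NormalForm

/-! ### Invariants of the group algebra -/

section Invariants

open MonoidAlgebra Module

variable {F : Type*} [Field F] {G : Type*} [Group G] [Finite G] {H : Type*} [Group H] [Finite H]

theorem card_eq_of_algEquiv (φ : MonoidAlgebra F G ≃ₐ[F] MonoidAlgebra F H) :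
    Nat.card G = Nat.card H := by
  rw [← finrank_eq_card (F := F) (G := G), ← finrank_eq_card (F := F) (G := H)]
  exact φ.toLinearEquiv.finrank_eq

theorem finrank_characters_eq_of_algEquiv (φ : MonoidAlgebra F G ≃ₐ[F] MonoidAlgebra F H) :
    finrank F ((c : ConjClasses G) → CentralizerChar F c.out) =
      finrank F ((c : ConjClasses H) → CentralizerChar F c.out) := by
  have h1 := finrank_leibnizSubspace (F := F) (G := G)
  have h2 := finrank_leibnizSubspace (F := F) (G := H)
  rw [finrank_leibnizSubspace_eq φ, finrank_centerSubspace_eq φ, card_eq_of_algEquiv φ] at h1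
  omega

variable [CharP F 2]

theorem index_commutator_sup_center_eq_of_algEquiv (hG : IsPGroup 2 G) (hH : IsPGroup 2 H)
    (φ : MonoidAlgebra F G ≃ₐ[F] MonoidAlgebra F H) :
    (commutator G ⊔ Subgroup.center G).index = (commutator H ⊔ Subgroup.center H).index := by
  have h1 := index_commutator_sup_center (F := F) hG
  have h2 := index_commutator_sup_center (F := F) hH
  have h3 := finrank_idealSpan_eq φ
    (S := addCommutators (MonoidAlgebra F G) ∪ centralNilpotents _)
    (S' := addCommutators (MonoidAlgebra F H) ∪ centralNilpotents _)
    (fun s hs => hs.imp (addCommutators_map φ) (centralNilpotents_map φ))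
    (fun s hs => hs.imp (addCommutators_map φ.symm) (centralNilpotents_map φ.symm))
  rw [h3, card_eq_of_algEquiv φ] at h1
  omega

theorem index_squareSubgroup_eq_of_algEquiv (hG : IsPGroup 2 G) (hH : IsPGroup 2 H)
    (φ : MonoidAlgebra F G ≃ₐ[F] MonoidAlgebra F H) :
    (squareSubgroup G).index = (squareSubgroup H).index := by
  have h1 := index_squareSubgroup (F := F) hG
  have h2 := index_squareSubgroup (F := F) hH
  have h3 := finrank_idealSpan_eq φ
    (S := addCommutators (MonoidAlgebra F G) ∪ nilpotentSquares _)
    (S' := addCommutators (MonoidAlgebra F H) ∪ nilpotentSquares _)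
    (fun s hs => hs.imp (addCommutators_map φ) (nilpotentSquares_map φ))
    (fun s hs => hs.imp (addCommutators_map φ.symm) (nilpotentSquares_map φ.symm))
  rw [h3, card_eq_of_algEquiv φ] at h1
  omega

theorem index_squareSubgroup_sup_centralInvolutions_eq_of_algEquiv (hG : IsPGroup 2 G)
    (hH : IsPGroup 2 H) (φ : MonoidAlgebra F G ≃ₐ[F] MonoidAlgebra F H) :
    (squareSubgroup G ⊔ centralInvolutions G).index =
      (squareSubgroup H ⊔ centralInvolutions H).index := by
  have h1 := index_squareSubgroup_sup_centralInvolutions (F := F) hG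
  have h2 := index_squareSubgroup_sup_centralInvolutions (F := F) hH
  have h3 := finrank_idealSpan_eq φ
    (S := addCommutators (MonoidAlgebra F G) ∪ nilpotentSquares _ ∪ centralSquareZero _)
    (S' := addCommutators (MonoidAlgebra F H) ∪ nilpotentSquares _ ∪ centralSquareZero _)
    (fun s hs => hs.imp (fun h => h.imp (addCommutators_map φ) (nilpotentSquares_map φ))
      (centralSquareZero_map φ))
    (fun s hs => hs.imp (fun h => h.imp (addCommutators_map φ.symm) (nilpotentSquares_map φ.symm))
      (centralSquareZero_map φ.symm))
  rw [h3, card_eq_of_algEquiv φ] at h1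
  omega

theorem card_center_eq_of_algEquiv (hG : IsPGroup 2 G) (hH : IsPGroup 2 H)
    (φ : MonoidAlgebra F G ≃ₐ[F] MonoidAlgebra F H) :
    Nat.card (Subgroup.center G) = Nat.card (Subgroup.center H) := by
  have h1 := finrank_center_inf_commutatorSpan (F := F) hG
  have h2 := finrank_center_inf_commutatorSpan (F := F) hH
  rw [finrank_centerSubspace_eq φ, finrank_center_inf_commutatorSpan_eq φ] at h1
  omega

/-- The algebra gives the number of central squares; dividing |Z| by it gives the kernel of squaring
on Z. -/
theorem card_centralInvolutions_eq_of_algEquiv (hG : IsPGroup 2 G) (hH : IsPGroup 2 H)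
    (φ : MonoidAlgebra F G ≃ₐ[F] MonoidAlgebra F H) :
    Nat.card (centralInvolutions G) = Nat.card (centralInvolutions H) := by
  have h1 := finrank_centralSquareCommutator (F := F) hG
  have h2 := finrank_centralSquareCommutator (F := F) hH
  rw [finrank_centerSubspace_eq φ, finrank_centralSquareCommutator_eq φ] at h1
  have h3 := card_centerSquares_mul G
  have h4 := card_centerSquares_mul H
  have h5 : Nat.card (centerSquares G) = Nat.card (centerSquares H) := by omega
  rw [h5, card_center_eq_of_algEquiv hG hH φ, ← h4] at h3
  exact Nat.eq_of_mul_eq_mul_right Nat.card_pos h3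

/-- The order of the group of central involutions lying in the square subgroup. -/
theorem card_squareSubgroup_inf_centralInvolutions (G : Type*) [Group G] [Finite G] :
    Nat.card (squareSubgroup G ⊓ centralInvolutions G : Subgroup G) *
        (squareSubgroup G).index =
      Nat.card (centralInvolutions G) * (squareSubgroup G ⊔ centralInvolutions G).index := by
  have h1 := Subgroup.relIndex_mul_index
    (show squareSubgroup G ≤ squareSubgroup G ⊔ centralInvolutions G from le_sup_left)
  have h2 := Subgroup.card_mul_index
    ((squareSubgroup G).subgroupOf (centralInvolutions G))
  rw [Subgroup.relIndex_sup_left] at h1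
  rw [← h1, ← h2, Subgroup.relIndex, mul_assoc]
  congr 1
  rw [← Subgroup.inf_subgroupOf_right]
  exact (Nat.card_congr (Subgroup.subgroupOfEquivOfLe inf_le_right).toEquiv).symm

theorem card_inf_eq_of_algEquiv (hG : IsPGroup 2 G) (hH : IsPGroup 2 H)
    (φ : MonoidAlgebra F G ≃ₐ[F] MonoidAlgebra F H) :
    Nat.card (squareSubgroup G ⊓ centralInvolutions G : Subgroup G) =
      Nat.card (squareSubgroup H ⊓ centralInvolutions H : Subgroup H) := by
  have h1 := card_squareSubgroup_inf_centralInvolutions G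
  have h2 := card_squareSubgroup_inf_centralInvolutions H
  rw [card_centralInvolutions_eq_of_algEquiv hG hH φ,
    index_squareSubgroup_sup_centralInvolutions_eq_of_algEquiv hG hH φ, ← h2,
    index_squareSubgroup_eq_of_algEquiv hG hH φ] at h1
  exact Nat.eq_of_mul_eq_mul_right (Nat.pos_of_ne_zero Subgroup.index_ne_zero_of_finite) h1

end Invariants

/-! ### Conclusion -/

theorem squareSubgroup_inf_centralInvolutions_le {G : Type*} [Group G] [Finite G]
    (hG : IsPGroup 2 G) :
    squareSubgroup G ⊓ centralInvolutions G ≤ groupSocle G ⊓ frattini G := by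
  refine le_inf (fun x hx => ?_) (inf_le_left.trans (squareSubgroup_le_frattini hG))
  obtain ⟨hxc, hx2⟩ := (Subgroup.mem_inf.1 hx).2
  by_cases hx1 : x = 1
  · rw [hx1]; exact one_mem _
  · refine Subgroup.subset_closure ⟨hxc, ?_⟩
    rw [orderOf_eq_prime hx2 hx1]
    exact Nat.prime_two

theorem eq_of_card_squareSubgroup_inf_centralInvolutions_le_two {G : Type*} [Group G] [Finite G]
    (hcard : Nat.card (squareSubgroup G ⊓ centralInvolutions G : Subgroup G) ≤ 2) (x y : G)
    (hx : x ∈ Subgroup.center G ⊓ squareSubgroup G)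
    (hy : y ∈ Subgroup.center G ⊓ squareSubgroup G) (hx2 : x ^ 2 = 1) (hy2 : y ^ 2 = 1)
    (hx1 : x ≠ 1) (hy1 : y ≠ 1) : x = y := by
  by_contra hxy
  have h1 : ({1, x, y} : Set G).ncard = 3 := Set.ncard_eq_three.2
    ⟨1, x, y, hx1.symm, hy1.symm, hxy, rfl⟩
  have h2 : ({1, x, y} : Set G) ⊆ (squareSubgroup G ⊓ centralInvolutions G : Subgroup G) := by
    rintro g (rfl | rfl | rfl)
    · exact one_mem _
    · exact Subgroup.mem_inf.2 ⟨hx.2, hx.1, hx2⟩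
    · exact Subgroup.mem_inf.2 ⟨hy.2, hy.1, hy2⟩
  have h3 := Set.ncard_le_ncard h2
  rw [h1] at h3
  have h4 : Nat.card (squareSubgroup G ⊓ centralInvolutions G : Subgroup G) =
    ((squareSubgroup G ⊓ centralInvolutions G : Subgroup G) : Set G).ncard := rfl
  omega

/-- The socle condition is replaced by a bound on central involutions in the square subgroup, which
the algebra sees. So H inherits both hypotheses and has a normal form of its own. -/
theorem nonempty_mulEquiv_of_algEquiv {F : Type*} [Field F] [CharP F 2] {G : Type*} [Group G]
    [Finite G] {H : Type*} [Group H] [Finite H] (hG : IsPGroup 2 G) (hH : IsPGroup 2 H)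
    (φ : MonoidAlgebra F G ≃ₐ[F] MonoidAlgebra F H)
    (hindex : (commutator G ⊔ Subgroup.center G).index = 4)
    (hsq : Nat.card (squareSubgroup G ⊓ centralInvolutions G : Subgroup G) ≤ 2) :
    Nonempty (G ≃* H) := by
  obtain ⟨a, b, z, E, s, t, h, hst⟩ := exists_normalForm hG hindex
    (eq_of_card_squareSubgroup_inf_centralInvolutions_le_two hsq)
  rw [index_commutator_sup_center_eq_of_algEquiv hG hH φ] at hindex
  rw [card_inf_eq_of_algEquiv hG hH φ] at hsq
  obtain ⟨a', b', z', E', s', t', h', hst'⟩ := exists_normalForm hH hindex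
    (eq_of_card_squareSubgroup_inf_centralInvolutions_le_two hsq)
  have hcard := card_eq_of_algEquiv φ
  have hcenter := card_center_eq_of_algEquiv hG hH φ
  have hE : Nat.card E = Nat.card E' := by
    have h1 := card_centralInvolutions_eq_of_algEquiv hG hH φ
    rw [h.card_centralInvolutions hG, h'.card_centralInvolutions hH] at h1
    omega
  have hz : orderOf z = orderOf z' := by
    have h1 := hcenter
    rw [h.card_center, h'.card_center, hE] at h1
    exact Nat.eq_of_mul_eq_mul_left Nat.card_pos h1
  have hq : orderOf (a * b * a⁻¹ * b⁻¹) = orderOf (a' * b' * a'⁻¹ * b'⁻¹) := by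
    have h1 := hcard
    rw [h.card_eq, h'.card_eq, hcenter] at h1
    have h2 := Nat.eq_of_mul_eq_mul_right Nat.card_pos h1
    omega
  have hN : (NormalForm.reflectionsOverSquares a).ncard =
      (NormalForm.reflectionsOverSquares a').ncard := by
    have h1 := h.card_mul_finrank_characters F hG
      (hst.elim (fun h => Or.inl h.1) fun h => h.elim (fun h => Or.inl h.1) fun h => Or.inr h.2.2)
    have h2 := h'.card_mul_finrank_characters F hH
      (hst'.elim (fun h => Or.inl h.1) fun h => h.elim (fun h => Or.inl h.1) fun h => Or.inr h.2.2)
    rw [finrank_characters_eq_of_algEquiv φ, hcard, hcenter,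
      index_squareSubgroup_eq_of_algEquiv hG hH φ, card_centralInvolutions_eq_of_algEquiv hG hH φ,
      hz, h2] at h1
    -- After cancelling the known terms, the common factor 2|Z(H)| is nonzero.
    have h3 := Nat.eq_of_mul_eq_mul_left (by have := Nat.card_pos (α := Subgroup.center H); omega)
      (Nat.add_left_cancel h1)
    exact (Nat.add_left_cancel h3).symm
  have hpar := h.parity_eq_of_ncard_eq hG hH h' hcard hN
  -- The three admissible parameter pairs are separated by the two parity conditions.
  have hss : s = s' ∧ t = t' := by
    rcases hst with ⟨rfl, rfl⟩ | ⟨rfl, rfl⟩ | ⟨rfl, rfl, -⟩ <;>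
    rcases hst' with ⟨rfl, rfl⟩ | ⟨rfl, rfl⟩ | ⟨rfl, rfl, -⟩ <;> simp at hpar ⊢
  obtain ⟨rfl, rfl⟩ := hss
  exact h.nonempty_mulEquiv hG hH h' hq hz hE

theorem corollary5p13 {G : Type*} [Group G] [Finite G] (hG : IsPGroup 2 G)
    (hindex : (commutator G ⊔ Subgroup.center G).index = 4)
    (hsoc : Nat.card ↥(groupSocle G ⊓ frattini G) = 2) :
    ∀ (F : Type*) [Field F] [CharP F 2] (H : Type*) [Group H] [Finite H], IsPGroup 2 H →
      Nonempty (MonoidAlgebra F G ≃ₐ[F] MonoidAlgebra F H) → Nonempty (G ≃* H) := by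
  rintro F _ _ H _ _ hH ⟨φ⟩
  refine nonempty_mulEquiv_of_algEquiv hG hH φ hindex ?_
  rw [← hsoc]
  exact Nat.card_le_card_of_injective _
    (Subgroup.inclusion_injective (squareSubgroup_inf_centralInvolutions_le hG))
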